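/- Let $\sigma_1,\dots,\sigma_{b-1}$ be the standard generators of the braid group $B_b$ on $b\ge 1$ strings. A braid is \emph{quasipositive} if it is a (possibly empty) product of conjugates $w\sigma_iw^{-1}$, $w\in B_b$. Transverse links in $(S^3,\xi_{std})$ are represented by closed braids; two braid words represent the same transverse link if they are related by a finite sequence of equalities and conjugations in the braid groups, positive stabilizations ($b$-string word $\beta\mapsto\beta\sigma_b$ on $b+1$ strings) and their inverses. For a braid word on $b$ strings with closed braid diagram $L$, let $CKh(L)=\bigoplus_{v\in\{0,1\}^{n}}U^{\otimes k(v)}$ be the Khovanov complex over $\mathbb Z$, where $n$ is the number of crossings, $k(v)$ is the number of circles of the resolution $L_v$, and $U=\mathbb Z\langle \mathbf u_+,\mathbf u_-\rangle$. The $0$-resolution of a positive crossing $\sigma_i$ and the $1$-resolution of a negative crossing $\sigma_i^{-1}$ are the oriented (two parallel strings) ones. The differential is the signed sum over the edges of the cube $\{0,1\}^n$ (the sign of an edge in direction $t$ at $v$ is $(-1)^{\#\{j<t:\,v_j=1\}}$) of the merge and split maps given by \[ m(\mathbf u_+\otimes\mathbf u_+)=\mathbf u_+,\quad m(\mathbf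 u_+\otimes\mathbf u_-)=m(\mathbf u_-\otimes\mathbf u_+)=\mathbf u_-,\quad m(\mathbf u_-\otimes\mathbf u_-)=0, \] \[ \Delta(\mathbf u_+)=\mathbf u_+\otimes\mathbf u_-+\mathbf u_-\otimes\mathbf u_+,\quad \Delta(\mathbf u_-)=\mathbf u_-\otimes\mathbf u_-, \] and $Kh(L)$ is the homology (the total homology, over all bidegrees). Let $\psi(L)\in Kh(L)$ be the class of the cycle $\mathbf u_-\otimes\dots\otimes\mathbf u_-\in U^{\otimes b}$ at the oriented resolution of $L$. \textbf{Corollary.} If the transverse link $L$ is represented by a quasipositive braid, then $\psi(L)\neq0$. Moreover, $\psi(L)$ is a primitive non-torsion element of $Kh(L)$. More precisely: for every braid word, with closed braid diagram $L$, that represents the same transverse link as a word of some quasipositive braid, $\psi(L)\in Kh(L)$ is non-zero and not a torsion element, and it is primitive, i.e. its image in $Kh(L)$ modulo torsion is not a proper multiple: if $\psi(L)-k\,y$ is a torsion element, with $k\in\mathbb Z$ and $y\in Kh(L)$, then $k=\pm1$. In particular $\psi(L)$ itself is not a proper multiple of an element of $Kh(L)$. -/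

import Mathlib

namespace TransverseKhovanov

/-! ### Braids -/

/-- A braid word on `n + 1` strings. The letter `(i, true)` is the generator `σ_i`, which permutes the
strings `i` and `i + 1` (counted from `0`); the letter `(i, false)` is its inverse. -/
abbrev BraidWord (n : ℕ) : Type := List (Fin n × Bool)

/-- The relators of Artin's presentation of the braid group on `n + 1` strings. -/
def artinRels (n : ℕ) : Set (FreeGroup (Fin n)) :=
  {r | ∃ i j : Fin n, (i : ℕ) + 1 < j ∧
      r = (FreeGroup.of i * FreeGroup.of j) * (FreeGroup.of j * FreeGroup.of i)⁻¹} ∪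
  {r | ∃ i j : Fin n, (i : ℕ) + 1 = j ∧
      r = (FreeGroup.of i * FreeGroup.of j * FreeGroup.of i) *
        (FreeGroup.of j * FreeGroup.of i * FreeGroup.of j)⁻¹}

/-- The braid group on `n + 1` strings. -/
abbrev BraidGroup (n : ℕ) : Type := PresentedGroup (artinRels n)

/-- The standard generator `σ_i` of the braid group. -/
def sigma {n : ℕ} (i : Fin n) : BraidGroup n := PresentedGroup.of i

/-- The braid that a word represents. -/
def BraidWord.toBraid {n : ℕ} (w : BraidWord n) : BraidGroup n :=
  (w.map fun l => if l.2 then sigma l.1 else (sigma l.1)⁻¹).prod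

/-- A braid is quasipositive if it is a product of conjugates `g σ_i g⁻¹` of the standard
generators. -/
def IsQuasipositive {n : ℕ} (β : BraidGroup n) : Prop :=
  β ∈ Submonoid.closure {x : BraidGroup n | ∃ (g : BraidGroup n) (i : Fin n), x = g * sigma i * g⁻¹}

/-- Positive stabilization: add a last string and multiply by the new generator. -/
def BraidWord.stabilize {n : ℕ} (w : BraidWord n) : BraidWord (n + 1) :=
  w.map (fun l => (l.1.castSucc, l.2)) ++ [(Fin.last n, true)]

/-- The elementary moves of the transverse Markov theorem: isotopy of closed braids (equality and
conjugation in the braid group) and positive stabilization. -/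
inductive TransverseMove : (Σ n, BraidWord n) → (Σ n, BraidWord n) → Prop
  | conj {n : ℕ} (w w' : BraidWord n) (h : IsConj w.toBraid w'.toBraid) :
      TransverseMove ⟨n, w⟩ ⟨n, w'⟩
  | stab {n : ℕ} (w : BraidWord n) : TransverseMove ⟨n, w⟩ ⟨n + 1, w.stabilize⟩

/-- Two braid words represent the same transverse link if they are related by a finite sequence of
braid isotopies, positive stabilizations and positive destabilizations. -/
def SameTransverseLink : (Σ n, BraidWord n) → (Σ n, BraidWord n) → Prop :=
  Relation.EqvGen TransverseMove

/-! ### Resolutions of a closed braid diagram -/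

section Diagram

variable {n : ℕ} (w : BraidWord n)

/-- The points of the braid diagram of `w` that lie on string position `j` at one of the levels
`0, …, w.length`; the `t`-th letter is the crossing between the levels `t` and `t + 1`. -/
abbrev Point : Type := Fin (n + 1) × Fin (w.length + 1)

/-- A vertex of the cube of resolutions (`false` is `0` and `true` is `1`). -/
abbrev Vertex : Type := Fin w.length → Bool

/-- Left string position of the crossing `t`. -/
def left (t : Fin w.length) : Fin (n + 1) := (w.get t).1.castSucc

/-- Right string position of the crossing `t`. -/
def right (t : Fin w.length) : Fin (n + 1) := (w.get t).1.succ

/-- The crossing `t` is positive. -/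
def IsPos (t : Fin w.length) : Prop := (w.get t).2 = true

/-- At the vertex `v` the crossing `t` is replaced by two parallel strings: this is the
`0`-resolution of a positive crossing and the `1`-resolution of a negative one. -/
def IsParallel (v : Vertex w) (t : Fin w.length) : Prop := v t = false ↔ IsPos w t

/-- Two points are joined by an elementary arc of the resolution `v` of the closed diagram. -/
inductive Joined (v : Vertex w) : Point w → Point w → Prop
  /-- strings that do not take part in the crossing `t` -/
  | away (t : Fin w.length) (j : Fin (n + 1)) (hl : j ≠ left w t) (hr : j ≠ right w t) :
      Joined v (j, t.castSucc) (j, t.succ)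
  /-- crossing resolved into two parallel strings -/
  | parallelLeft (t : Fin w.length) (h : IsParallel w v t) :
      Joined v (left w t, t.castSucc) (left w t, t.succ)
  | parallelRight (t : Fin w.length) (h : IsParallel w v t) :
      Joined v (right w t, t.castSucc) (right w t, t.succ)
  /-- crossing resolved the other way -/
  | turnBefore (t : Fin w.length) (h : ¬ IsParallel w v t) :
      Joined v (left w t, t.castSucc) (right w t, t.castSucc)
  | turnAfter (t : Fin w.length) (h : ¬ IsParallel w v t) :
      Joined v (left w t, t.succ) (right w t, t.succ)
  /-- closing arcs of the braid -/
  | closing (j : Fin (n + 1)) : Joined v (j, Fin.last _) (j, 0)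

/-- The circles of the resolution `v`. -/
def Circle (v : Vertex w) : Type := Quot (Joined w v)

/-- The circle through a point. -/
def circle (v : Vertex w) (x : Point w) : Circle w v := Quot.mk _ x

/-! ### The Khovanov complex -/

/-- The two generators `u₊`, `u₋` of the module `U`. -/
inductive Label : Type
  | plus
  | minus

/-- The coefficient of `c` in the product `m (a ⊗ b)`. -/
def mulCoeff : Label → Label → Label → ℤ
  | .plus, .plus, .plus => 1
  | .plus, .minus, .minus => 1
  | .minus, .plus, .minus => 1
  | _, _, _ => 0

/-- The coefficient of `b ⊗ c` in the coproduct `Δ a`. -/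
def comulCoeff : Label → Label → Label → ℤ
  | .plus, .plus, .minus => 1
  | .plus, .minus, .plus => 1
  | .minus, .minus, .minus => 1
  | _, _, _ => 0

/-- The standard generators of the Khovanov complex: a vertex of the cube together with a labelling
of the circles of its resolution. -/
def Generator : Type := Σ v : Vertex w, (Circle w v → Label)

instance : Finite Label :=
  Finite.of_surjective (fun b : Bool => if b then Label.plus else Label.minus)
    (fun l => by cases l <;> [exact ⟨true, rfl⟩; exact ⟨false, rfl⟩])

instance (v : Vertex w) : Finite (Circle w v) := Quot.finite _

instance : Finite (Generator w) :=
  inferInstanceAs (Finite (Σ v : Vertex w, (Circle w v → Label)))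

noncomputable instance : Fintype (Generator w) := Fintype.ofFinite _

/-- The Khovanov chain group `⨁_v U^{⊗ k(v)}`, where `k(v)` is the number of circles at `v`. -/
abbrev CKh : Type := Generator w →₀ ℤ

open Classical in
/-- The coefficient of the generator `T` in `d_e S`, where `e` is the edge of the cube from the
vertex of `S` that changes the resolution of the crossing `t`. In either resolution of `t` the two
arcs near `t` pass through the points `p` (lower left) and `q` (upper right). If these lie on two
different circles at the vertex of `S`, the two circles merge, otherwise the one circle splits;
labels of all other circles are unchanged. -/
noncomputable def edgeCoeff (t : Fin w.length) (S T : Generator w) : ℤ :=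
  let p : Point w := (left w t, t.castSucc)
  let q : Point w := (right w t, t.succ)
  if ∀ x : Point w, circle w S.1 x ≠ circle w S.1 p → circle w S.1 x ≠ circle w S.1 q →
      T.2 (circle w T.1 x) = S.2 (circle w S.1 x) then
    if circle w S.1 p ≠ circle w S.1 q then
      mulCoeff (S.2 (circle w S.1 p)) (S.2 (circle w S.1 q)) (T.2 (circle w T.1 p))
    else
      comulCoeff (S.2 (circle w S.1 p)) (T.2 (circle w T.1 p)) (T.2 (circle w T.1 q))
  else 0

/-- The sign of the edge at `v` in direction `t`: `-1` to the number of `1`s of `v` before `t`. -/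
def edgeSign (v : Vertex w) (t : Fin w.length) : ℤ :=
  (-1) ^ (Finset.univ.filter fun j : Fin w.length => j < t ∧ v j = true).card

/-- The matrix of the differential: the coefficient of `T` in `d S`. -/
noncomputable def dCoeff (S T : Generator w) : ℤ :=
  ∑ t : Fin w.length,
    if S.1 t = false ∧ T.1 = Function.update S.1 t true then
      edgeSign w S.1 t * edgeCoeff w t S T
    else 0

/-- The Khovanov differential. -/
noncomputable def d : CKh w →ₗ[ℤ] CKh w :=
  Finsupp.linearCombination ℤ fun S : Generator w =>
    ∑ T : Generator w, dCoeff w S T • Finsupp.single T (1 : ℤ)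

/-- Khovanov homology of the closed braid diagram (the sum over all bidegrees): cycles modulo
boundaries. -/
abbrev Kh : Type :=
  LinearMap.ker (d w) ⧸ (LinearMap.range (d w)).submoduleOf (LinearMap.ker (d w))

/-! ### The element `ψ` -/

/-- The vertex of the oriented resolution: all crossings are resolved into parallel strings. -/
def orientedVertex : Vertex w := fun t => !(w.get t).2

/-- The generator of the oriented resolution with all circles labelled by `u₋`. -/
def psiGenerator : Generator w := ⟨orientedVertex w, fun _ => Label.minus⟩

/-- The distinguished chain `u₋ ⊗ ⋯ ⊗ u₋`. -/
noncomputable def psiChain : CKh w := Finsupp.single (psiGenerator w) 1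

theorem isParallel_orientedVertex (t : Fin w.length) : IsParallel w (orientedVertex w) t := by
  simp [IsParallel, orientedVertex, IsPos]

theorem fst_eq_of_joined {x y : Point w} (h : Joined w (orientedVertex w) x y) : x.1 = y.1 := by
  cases h with
  | turnBefore t h => exact absurd (isParallel_orientedVertex w t) h
  | turnAfter t h => exact absurd (isParallel_orientedVertex w t) h
  | _ => rfl

theorem circle_ne (t : Fin w.length) :
    circle w (orientedVertex w) (left w t, t.castSucc) ≠
      circle w (orientedVertex w) (right w t, t.succ) := by
  intro h
  have h2 := congrArg (Quot.lift (fun x : Point w => x.1) fun _ _ => fst_eq_of_joined w) h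
  have h3 : left w t = right w t := h2
  simp [left, right, Fin.ext_iff] at h3

theorem dCoeff_psiGenerator (T : Generator w) : dCoeff w (psiGenerator w) T = 0 := by
  refine Finset.sum_eq_zero fun t _ => ?_
  have h : edgeCoeff w t (psiGenerator w) T = 0 := by
    unfold edgeCoeff
    dsimp only
    split_ifs with h1 h2
    · rfl
    · exact absurd (circle_ne w t) h2
    · rfl
  rw [h, mul_zero, ite_self]

theorem psiChain_mem_ker : psiChain w ∈ LinearMap.ker (d w) := by
  simp [psiChain, d, dCoeff_psiGenerator]

/-- The class of the distinguished cycle in Khovanov homology. -/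
noncomputable def psi : Kh w := Submodule.Quotient.mk ⟨psiChain w, psiChain_mem_ker w⟩

end Diagram

/-- An element of an abelian group is primitive if its image in the quotient by the torsion subgroup
is not a proper multiple: if `x` equals `k • y` up to torsion then `k = ±1`. In particular `x` itself
is not a proper multiple of any element. -/
def IsPrimitive {M : Type*} [AddCommGroup M] (x : M) : Prop :=
  ∀ (k : ℤ) (y : M), x - k • y ∈ Submodule.torsion ℤ M → IsUnit k

end TransverseKhovanov

/-! It suffices to find a homomorphism `f : Kh w →ₗ[ℤ] ℤ` with `f (psi w) = ±1`. Such an `f` kills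
torsion, so `psi w` is neither zero nor torsion, and if `psi w - k • y` is torsion then `k * f y =
±1`, hence `k = ±1`. It comes from a cocycle of the dual Khovanov complex whose value on the chain
u₋ ⊗ ⋯ ⊗ u₋ is a unit; `Good` asserts that such a cocycle exists.

With u₊ = 1 and u₋ = X, the module at a vertex is a polynomial ring in the points of the diagram
modulo all squares X_z² and all differences X_x - X_y with x, y on one circle. A cochain is then a
family of functionals on one polynomial ring, common to all vertices, each `Killed` by the relations
of its vertex. A merge is a quotient map and a split is multiplication by X_p + X_q, so the
transpose of an edge map is the action of the scalar `sad`, which is 1 or X_p + X_q. Squares of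
saddles commute by `sad_square`. Variables exist for all of ℕ × ℕ; strings outside the braid only
add circles on which nothing is evaluated.

The empty word is `Good` (`good_nil`), and a positive crossing may be added
(`good_append_positive`): its 0-resolution is the old diagram, so the cocycle extends by zero over
the 1-resolution. `Good` is invariant under cyclic rotation (`good_rotate`), commutation of distant
crossings, cancellation of inverse letters, the braid relation (`good_braid`) and positive
stabilization. The moves are made at the end of a word, and rotation carries them everywhere; hence
`Good` depends only on the transverse link. A quasipositive braid arises from the empty word by
repeatedly inserting g g⁻¹ and then a generator between the two factors, so it is `Good`.

Planarity enters through `saddle_rel` (changing one resolution always merges two circles or splits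
one) and through Temperley–Lieb identities such as `rel_turn_turn_turn`. A cocycle condition after a
local move is tested only on polynomials in the points away from the move and, if a small circle
appears there, on their multiples by its variable (`Killed.eq_zero`). Finally `circle_eq_iff`,
`sum_edgeCoeff` and `chainFunctional_d` carry the cocycle to the Khovanov complex. -/

namespace TransverseKhovanov

/-! ### Functionals on polynomials in the points of a diagram -/

/-- A point `(j, s)`: string position `j` at level `s`. -/
abbrev Pt : Type := ℕ × ℕ

/-- Polynomials in variables indexed by points. -/
abbrev PtRing : Type := MvPolynomial Pt ℤ

/-- Additive functionals on `PtRing`, with the `PtRing`-module structure `(a • φ) b = φ (a * b)`. -/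
def Func : Type := PtRing →ₗ[ℤ] ℤ

noncomputable instance : AddCommGroup Func := inferInstanceAs (AddCommGroup (PtRing →ₗ[ℤ] ℤ))

instance : FunLike Func PtRing ℤ := inferInstanceAs (FunLike (PtRing →ₗ[ℤ] ℤ) PtRing ℤ)

instance : AddMonoidHomClass Func PtRing ℤ :=
  inferInstanceAs (AddMonoidHomClass (PtRing →ₗ[ℤ] ℤ) PtRing ℤ)

namespace Func

@[ext] theorem ext {φ ψ : Func} (h : ∀ a, φ a = ψ a) : φ = ψ := LinearMap.ext h

@[simp] theorem add_apply (φ ψ : Func) (a : PtRing) : (φ + ψ) a = φ a + ψ a := rfl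
@[simp] theorem neg_apply (φ : Func) (a : PtRing) : (-φ) a = -φ a := rfl
@[simp] theorem zero_apply (a : PtRing) : (0 : Func) a = 0 := rfl

noncomputable instance : Module PtRing Func where
  smul a φ := LinearMap.comp φ (LinearMap.mulLeft ℤ a)
  one_smul φ := LinearMap.ext fun b => congrArg φ (one_mul b)
  mul_smul a b φ := LinearMap.ext fun c => congrArg φ (by simp; ring)
  smul_zero a := rfl
  smul_add a φ ψ := rfl
  add_smul a b φ := LinearMap.ext fun c => by
    change φ ((a + b) * c) = φ (a * c) + φ (b * c)
    rw [add_mul, map_add]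
  zero_smul φ := LinearMap.ext fun c => by
    change φ (0 * c) = 0
    rw [zero_mul, map_zero]

@[simp] theorem smul_apply (a : PtRing) (φ : Func) (b : PtRing) : (a • φ) b = φ (a * b) := rfl

end Func

open MvPolynomial

/-! ### Relations, saddles -/

/-- A functional that does not distinguish related points and vanishes on squares of variables. -/
structure Killed (r : Pt → Pt → Prop) (φ : Func) : Prop where
  eq : ∀ x y, r x y → (X x : PtRing) • φ = (X y : PtRing) • φ
  sq : ∀ x, (X x : PtRing) • (X x : PtRing) • φ = 0

namespace Killed

variable {r : Pt → Pt → Prop} {φ ψ : Func}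

theorem zero : Killed r 0 := ⟨fun _ _ _ => by simp, fun _ => by simp⟩

theorem add (h : Killed r φ) (h' : Killed r ψ) : Killed r (φ + ψ) :=
  ⟨fun x y hxy => by rw [smul_add, smul_add, h.eq x y hxy, h'.eq x y hxy],
    fun x => by simp only [smul_add, h.sq, h'.sq, add_zero]⟩

theorem smul (a : PtRing) (h : Killed r φ) : Killed r (a • φ) :=
  ⟨fun x y hxy => by rw [smul_comm, h.eq x y hxy, smul_comm],
    fun x => by rw [smul_comm _ a, smul_comm _ a, h.sq, smul_zero]⟩

theorem neg (h : Killed r φ) : Killed r (-φ) := by simpa using h.smul (-1)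

theorem sum {ι : Type*} {s : Finset ι} {f : ι → Func} (h : ∀ i ∈ s, Killed r (f i)) :
    Killed r (∑ i ∈ s, f i) :=
  Finset.sum_induction _ (Killed r) (fun _ _ => add) zero h

theorem mono {r' : Pt → Pt → Prop} (hr : ∀ x y, r' x y → r x y) (h : Killed r φ) : Killed r' φ :=
  ⟨fun x y hxy => h.eq x y (hr x y hxy), h.sq⟩

end Killed

open Classical in
/-- The scalar by which a saddle through `p` and `q` acts. -/
noncomputable def sad (r : Pt → Pt → Prop) (p q : Pt) : PtRing := if r p q then X p + X q else 1

/-- The equivalence relation `r` with the classes of `p` and `q` joined. -/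
def Join (r : Pt → Pt → Prop) (p q x y : Pt) : Prop := r x y ∨ (r x p ∧ r q y) ∨ (r x q ∧ r p y)

/-- Two relations that differ by a saddle through `p` and `q`. -/
def Saddle (r r' : Pt → Pt → Prop) (p q : Pt) : Prop :=
  (¬ r p q ∧ ∀ x y, r' x y ↔ Join r p q x y) ∨ (¬ r' p q ∧ ∀ x y, r x y ↔ Join r' p q x y)

theorem Saddle.symm {r r' : Pt → Pt → Prop} {p q : Pt} (h : Saddle r r' p q) : Saddle r' r p q :=
  Or.symm h

theorem sad_of {r : Pt → Pt → Prop} {p q : Pt} (h : r p q) : sad r p q = X p + X q := if_pos h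

theorem sad_of_not {r : Pt → Pt → Prop} {p q : Pt} (h : ¬ r p q) : sad r p q = 1 := if_neg h

theorem sad_congr {r r' : Pt → Pt → Prop} {p q : Pt} (h : r p q ↔ r' p q) :
    sad r p q = sad r' p q := by
  by_cases h' : r p q
  · rw [sad_of h', sad_of (h.1 h')]
  · rw [sad_of_not h', sad_of_not (h'.imp h.2)]

/-- The transpose of an edge map lands in the dual of its source. For a merge, `r'` is coarser than
`r` and nothing has to be done. For a split, squares vanish, so X_p (X_p + X_q) and X_q (X_p + X_q)
both act as X_p X_q, and the classes of `p` and `q` are no longer distinguished. -/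
theorem Killed.sad_smul {r r' : Pt → Pt → Prop} {p q : Pt} {φ : Func} (hs : Saddle r r' p q)
    (hr' : Equivalence r') (h : Killed r' φ) : Killed r (sad r p q • φ) := by
  rcases hs with ⟨h1, h2⟩ | ⟨h1, h2⟩
  · rw [sad_of_not h1, one_smul]
    exact h.mono fun x y hxy => (h2 x y).2 (Or.inl hxy)
  · rw [sad_of ((h2 p q).2 (Or.inr (Or.inl ⟨hr'.refl _, hr'.refl _⟩)))]
    have key : (X p : PtRing) • (X p + X q : PtRing) • φ = (X q : PtRing) • (X p + X q : PtRing) •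
        φ := by
      have e1 := h.sq p
      have e2 := h.sq q
      simp only [add_smul, smul_add, e1, e2, zero_add, add_zero]
      exact smul_comm _ _ _
    refine ⟨fun x y hxy => ?_, (h.smul _).sq⟩
    have e := (h.smul (X p + X q)).eq
    rcases (h2 x y).1 hxy with h3 | ⟨h3, h4⟩ | ⟨h3, h4⟩
    · exact e _ _ h3
    · rw [e _ _ h3, key, e _ _ h4]
    · rw [e _ _ h3, ← key, e _ _ h4]

theorem sad_smul_congr {r r' : Pt → Pt → Prop} (hr : Equivalence r) {p q p' q' : Pt}
    (hp : r p p') (hq : r q q') (hp' : r' p p') (hq' : r' q q') {φ : Func} (h : Killed r' φ) :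
    sad r p q • φ = sad r p' q' • φ := by
  by_cases hpq : r p q
  · rw [sad_of hpq, sad_of (hr.trans (hr.trans (hr.symm hp) hpq) hq), add_smul, add_smul,
      h.eq _ _ hp', h.eq _ _ hq']
  · rw [sad_of_not hpq, sad_of_not fun h' => hpq (hr.trans (hr.trans hp h') (hr.symm hq))]

theorem Saddle.of_rel {r r' : Pt → Pt → Prop} {p q : Pt} (h : Saddle r r' p q) (hpq : r p q) :
    ¬ r' p q ∧ ∀ x y, r x y ↔ Join r' p q x y :=
  h.resolve_left fun h' => h'.1 hpq

theorem Saddle.of_not_rel {r r' : Pt → Pt → Prop} {p q : Pt} (hr : Equivalence r)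
    (hr' : Equivalence r') (h : Saddle r r' p q) (hpq : ¬ r p q) :
    r' p q ∧ ∀ x y, r' x y ↔ Join r p q x y := by
  rcases h with h | h
  · exact ⟨(h.2 p q).2 (Or.inr (Or.inl ⟨hr.refl _, hr.refl _⟩)), h.2⟩
  · exact absurd ((h.2 p q).2 (Or.inr (Or.inl ⟨hr'.refl _, hr'.refl _⟩))) hpq

theorem Killed.add_smul_eq_of_join {r r' : Pt → Pt → Prop} {p q p' q' : Pt} {φ : Func}
    (h : Killed r φ) (hr : ∀ x y, r' x y → r x y) (hj : Join r' p q p' q')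
    (hn : ¬ r' p' q') : (X p + X q : PtRing) • φ = (X p' + X q' : PtRing) • φ := by
  rcases hj with h3 | ⟨h3, h4⟩ | ⟨h3, h4⟩
  · exact absurd h3 hn
  · rw [add_smul, add_smul, h.eq _ _ (hr _ _ h3), h.eq _ _ (hr _ _ h4)]
  · rw [add_smul, add_smul, h.eq _ _ (hr _ _ h3), h.eq _ _ (hr _ _ h4), add_comm]

/-- If performing one saddle changes the type of the other, then both saddles split and become
merges, or both merge and become splits. The two composites are then X_p + X_q and X_p' + X_q', and
the pairs {p, q} and {p', q'} meet the same classes of `r11`. -/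
theorem sad_square_of_ne {r00 r10 r01 r11 : Pt → Pt → Prop} {p q p' q' : Pt}
    (e00 : Equivalence r00) (e10 : Equivalence r10) (e01 : Equivalence r01) (e11 : Equivalence r11)
    (h1 : Saddle r00 r10 p q) (h2 : Saddle r10 r11 p' q') (h3 : Saddle r00 r01 p' q')
    (h4 : Saddle r01 r11 p q) {φ : Func} (h : Killed r11 φ) (hne : ¬ (r00 p q ↔ r01 p q)) :
    sad r00 p q • sad r10 p' q' • φ = sad r00 p' q' • sad r01 p q • φ := by
  by_cases a : r00 p q
  · have e : ¬ r01 p q := fun e => hne ⟨fun _ => e, fun _ => a⟩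
    have b : r00 p' q' := by
      by_contra b
      exact e (((h3.of_not_rel e00 e01 b).2 p q).2 (Or.inl a))
    obtain ⟨h1a, h1b⟩ := h1.of_rel a
    obtain ⟨h4a, h4b⟩ := h4.of_not_rel e01 e11 e
    have c : ¬ r10 p' q' := fun c => h1a (((h2.of_rel c).2 p q).2 (Or.inl h4a))
    obtain ⟨h2a, h2b⟩ := h2.of_not_rel e10 e11 c
    rw [sad_of a, sad_of_not c, sad_of b, sad_of_not e, one_smul]
    exact h.add_smul_eq_of_join (fun x y hxy => (h2b x y).2 (Or.inl hxy)) ((h1b _ _).1 b) c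
  · have e : r01 p q := by
      by_contra e
      exact hne ⟨fun h => absurd h a, fun h => absurd h e⟩
    have b : ¬ r00 p' q' := fun b => a (((h3.of_rel b).2 p q).2 (Or.inl e))
    obtain ⟨h1a, h1b⟩ := h1.of_not_rel e00 e10 a
    obtain ⟨h4a, h4b⟩ := h4.of_rel e
    have c : r10 p' q' := by
      by_contra c
      exact h4a (((h2.of_not_rel e10 e11 c).2 p q).2 (Or.inl h1a))
    obtain ⟨h2a, h2b⟩ := h2.of_rel c
    rw [sad_of_not a, sad_of c, sad_of_not b, sad_of e, one_smul, one_smul]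
    exact h.add_smul_eq_of_join (fun _ _ hxy => hxy) ((h2b _ _).1 h1a) h4a

/-- The commutation of two saddles. -/
theorem sad_square {r00 r10 r01 r11 : Pt → Pt → Prop} {p q p' q' : Pt}
    (e00 : Equivalence r00) (e10 : Equivalence r10) (e01 : Equivalence r01) (e11 : Equivalence r11)
    (h1 : Saddle r00 r10 p q) (h2 : Saddle r10 r11 p' q') (h3 : Saddle r00 r01 p' q')
    (h4 : Saddle r01 r11 p q) {φ : Func} (h : Killed r11 φ) :
    sad r00 p q • sad r10 p' q' • φ = sad r00 p' q' • sad r01 p q • φ := by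
  by_cases hne : r00 p q ↔ r01 p q
  · by_cases hne' : r00 p' q' ↔ r10 p' q'
    -- If neither type changes, both composites are the same product of two scalars.
    · rw [smul_comm, sad_congr hne, sad_congr hne']
    · exact (sad_square_of_ne e00 e01 e10 e11 h3 h4 h1 h2 h hne').symm
  · exact sad_square_of_ne e00 e10 e01 e11 h1 h2 h3 h4 h hne

end TransverseKhovanov

namespace TransverseKhovanov
open MvPolynomial

/-! ### Extension and restriction of functionals -/

/-- The restriction of a relation to a set of points. -/
def onSet (O : Set Pt) (r : Pt → Pt → Prop) (x y : Pt) : Prop := x = y ∨ (x ∈ O ∧ y ∈ O ∧ r x y)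

theorem onSet_equivalence {O : Set Pt} {r : Pt → Pt → Prop} (e : Equivalence r) :
    Equivalence (onSet O r) where
  refl x := Or.inl rfl
  symm := by
    rintro x y (rfl | ⟨h1, h2, h3⟩)
    · exact Or.inl rfl
    · exact Or.inr ⟨h2, h1, e.symm h3⟩
  trans := by
    rintro x y z (rfl | ⟨h1, h2, h3⟩) (rfl | ⟨h4, h5, h6⟩)
    · exact Or.inl rfl
    · exact Or.inr ⟨h4, h5, h6⟩
    · exact Or.inr ⟨h1, h2, h3⟩
    · exact Or.inr ⟨h1, h5, e.trans h3 h6⟩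

theorem onSet_iff {O : Set Pt} {r : Pt → Pt → Prop} (e : Equivalence r) {x y : Pt} (hx : x ∈ O)
    (hy : y ∈ O) : onSet O r x y ↔ r x y := by
  constructor
  · rintro (rfl | h)
    exacts [e.refl _, h.2.2]
  · exact fun h => Or.inr ⟨hx, hy, h⟩

theorem onSet_le {O : Set Pt} {r : Pt → Pt → Prop} (e : Equivalence r) (x y : Pt)
    (h : onSet O r x y) : r x y := by
  rcases h with rfl | h
  exacts [e.refl _, h.2.2]

theorem Saddle.onSet {O : Set Pt} {r r' : Pt → Pt → Prop} {p q : Pt} (e : Equivalence r)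
    (e' : Equivalence r') (hp : p ∈ O) (hq : q ∈ O) (h : Saddle r r' p q) :
    Saddle (onSet O r) (onSet O r') p q := by
  have key : ∀ {s s' : Pt → Pt → Prop}, Equivalence s → Equivalence s' →
      (¬ s p q ∧ ∀ x y, s' x y ↔ Join s p q x y) →
      (¬ TransverseKhovanov.onSet O s p q ∧ ∀ x y, TransverseKhovanov.onSet O s' x y ↔
        Join (TransverseKhovanov.onSet O s) p q x y) := by
    intro s s' e e' h
    refine ⟨fun h' => h.1 ((onSet_iff e hp hq).1 h'), fun x y => ?_⟩
    by_cases hx : x ∈ O <;> by_cases hy : y ∈ O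
    · rw [onSet_iff e' hx hy, h.2, Join, Join, onSet_iff e hx hy, onSet_iff e hx hp,
        onSet_iff e hx hq, onSet_iff e hp hy, onSet_iff e hq hy]
    all_goals
      simp only [TransverseKhovanov.onSet, Join, hx, hy, hp, hq, true_and, false_and, and_false,
        or_false]
      constructor
      · exact fun h => Or.inl h
      · rintro (h | ⟨h1, h2⟩ | ⟨h1, h2⟩)
        · exact h
        all_goals
          subst_vars
          simp_all
  exact Or.imp (key e e') (key e' e) h

/-- The points that are not related to a point of `O`. -/
def Inner (O : Set Pt) (r : Pt → Pt → Prop) (z : Pt) : Prop := ¬ ∃ z' ∈ O, r z z'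

open Classical in
/-- A point of `O` related to `z`, if there is one. -/
noncomputable def outerRep (O : Set Pt) (r : Pt → Pt → Prop) (z : Pt) : Pt :=
  if z ∈ O then z else if h : ∃ z' ∈ O, r z z' then h.choose else z

section

variable {O : Set Pt} {r : Pt → Pt → Prop}

theorem not_inner (e : Equivalence r) {z : Pt} (hz : z ∈ O) : ¬ Inner O r z :=
  fun h => h ⟨z, hz, e.refl z⟩

theorem outerRep_of_mem {z : Pt} (hz : z ∈ O) : outerRep O r z = z := if_pos hz

theorem outerRep_spec (e : Equivalence r) {z : Pt} (hz : ¬ Inner O r z) :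
    outerRep O r z ∈ O ∧ r z (outerRep O r z) := by
  unfold outerRep
  rw [Inner, not_not] at hz
  split_ifs with h
  · exact ⟨h, e.refl z⟩
  · exact hz.choose_spec

theorem inner_congr (e : Equivalence r) {x y : Pt} (h : r x y) : Inner O r x ↔ Inner O r y :=
  not_congr ⟨fun ⟨z, hz, h'⟩ => ⟨z, hz, e.trans (e.symm h) h'⟩, fun ⟨z, hz, h'⟩ => ⟨z, hz, e.trans
      h h'⟩⟩

theorem outerRep_congr (e : Equivalence r) {x y : Pt} (h : r x y) (hx : ¬ Inner O r x) :
    onSet O r (outerRep O r x) (outerRep O r y) := by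
  have h1 := outerRep_spec e hx
  have h2 := outerRep_spec e ((inner_congr e h).not.1 hx)
  exact Or.inr ⟨h1.1, h2.1, e.trans (e.symm h1.2) (e.trans h h2.2)⟩

variable (O r)

open Classical in
/-- The homomorphism that moves the variables to `O` and sends all inner variables to `ε`. -/
noncomputable def collapse : PtRing →ₐ[ℤ] DualNumber PtRing :=
  aeval fun z => if Inner O r z then DualNumber.eps else TrivSqZeroExt.inl (X (outerRep O r z))

variable {O r}

theorem collapse_X_inner {z : Pt} (h : Inner O r z) : collapse O r (X z) = DualNumber.eps := by
  simp [collapse, h]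

theorem collapse_X_outer {z : Pt} (h : ¬ Inner O r z) :
    collapse O r (X z) = TrivSqZeroExt.inl (X (outerRep O r z)) := by
  simp [collapse, h]

variable (O r)

/-- The extension of a functional along `collapse` that is zero on inner variables. -/
noncomputable def extd (φ : Func) : Func where
  toFun a := φ (collapse O r a).fst
  map_add' a b := by simp
  map_smul' k a := by
    rw [map_smul, TrivSqZeroExt.fst_smul]
    exact LinearMap.map_smul φ k _

/-- The extension of a functional along `collapse` that takes the coefficient of the inner
variable. -/
noncomputable def circ (φ : Func) : Func where
  toFun a := φ (collapse O r a).snd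
  map_add' a b := by simp
  map_smul' k a := by
    rw [map_smul, TrivSqZeroExt.snd_smul]
    exact LinearMap.map_smul φ k _

@[simp] theorem extd_apply (φ : Func) (a : PtRing) : extd O r φ a = φ (collapse O r a).fst := rfl
@[simp] theorem circ_apply (φ : Func) (a : PtRing) : circ O r φ a = φ (collapse O r a).snd := rfl

@[simp] theorem extd_zero : extd O r 0 = 0 := rfl
@[simp] theorem circ_zero : circ O r 0 = 0 := rfl

theorem smul_extd (a : PtRing) (φ : Func) :
    a • extd O r φ = extd O r ((collapse O r a).fst • φ) := by
  ext b
  simp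

theorem smul_circ (a : PtRing) (φ : Func) :
    a • circ O r φ = circ O r ((collapse O r a).fst • φ) + extd O r ((collapse O r a).snd • φ) := by
  ext b
  simp [mul_comm]

variable {O r}

/-- With a single inner circle, `extd O r φ` is φ ⊗ u₊* and `circ O r φ` is φ ⊗ u₋*, where * denotes
the dual basis; the relation ε² = 0 of the dual numbers is the square relation of that circle.
Multiplication by the inner variable takes u₋* to u₊*. -/
theorem Killed.extd (e : Equivalence r) {φ : Func} (h : Killed (onSet O r) φ) :
    Killed r (extd O r φ) := by
  constructor
  · intro x y hxy
    by_cases hx : Inner O r x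
    · have hy := (inner_congr e hxy).1 hx
      simp [smul_extd, collapse_X_inner, hx, hy]
    · have hy := (inner_congr e hxy).not.1 hx
      simp [smul_extd, collapse_X_outer, hx, hy, h.eq _ _ (outerRep_congr e hxy hx)]
  · intro x
    by_cases hx : Inner O r x
    · simp [smul_extd, collapse_X_inner, hx]
    · simp [smul_extd, collapse_X_outer, hx, h.sq]

theorem Killed.circ (e : Equivalence r) {φ : Func} (h : Killed (onSet O r) φ) :
    Killed r (circ O r φ) := by
  constructor
  · intro x y hxy
    by_cases hx : Inner O r x
    · have hy := (inner_congr e hxy).1 hx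
      simp [smul_circ, collapse_X_inner, hx, hy]
    · have hy := (inner_congr e hxy).not.1 hx
      simp [smul_circ, collapse_X_outer, hx, hy, h.eq _ _ (outerRep_congr e hxy hx)]
  · intro x
    by_cases hx : Inner O r x
    · simp [smul_circ, smul_extd, collapse_X_inner, hx]
    · simp [smul_circ, collapse_X_outer, hx, h.sq]

theorem smul_circ_of_inner {c : Pt} (hc : Inner O r c) (φ : Func) :
    (X c : PtRing) • circ O r φ = extd O r φ := by
  simp [smul_circ, collapse_X_inner, hc]

variable (O)

open Classical in
/-- The endomorphism that annihilates the variables outside `O`. -/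
noncomputable def trunc : PtRing →ₐ[ℤ] PtRing := aeval fun z => if z ∈ O then X z else 0

variable {O}

theorem trunc_X {z : Pt} (h : z ∈ O) : trunc O (X z) = X z := by simp [trunc, h]

theorem trunc_sad {p q : Pt} (hp : p ∈ O) (hq : q ∈ O) (r : Pt → Pt → Prop) :
    trunc O (sad r p q) = sad r p q := by
  unfold sad
  split_ifs <;> simp [trunc_X, hp, hq]

variable (O)

/-- The restriction of a functional to the polynomials in the variables of `O`. -/
noncomputable def restr : Func →+ Func where
  toFun φ := (LinearMap.comp φ (trunc O).toLinearMap : PtRing →ₗ[ℤ] ℤ)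
  map_zero' := rfl
  map_add' _ _ := rfl

theorem restr_apply (φ : Func) (a : PtRing) : restr O φ a = φ (trunc O a) := rfl

variable {O}

theorem restr_smul {a : PtRing} (h : trunc O a = a) (φ : Func) :
    restr O (a • φ) = a • restr O φ := by
  ext b
  change φ (a * trunc O b) = φ (trunc O (a * b))
  rw [map_mul (trunc O), h]

theorem collapse_trunc (e : Equivalence r) (a : PtRing) :
    collapse O r (trunc O a) = TrivSqZeroExt.inl (trunc O a) := by
  have : (collapse O r).comp (trunc O) = (TrivSqZeroExt.inlAlgHom ℤ PtRing PtRing).comp (trunc O)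
      := by
    ext1 z
    by_cases hz : z ∈ O
    · simp [trunc_X hz, collapse_X_outer, not_inner e hz, outerRep_of_mem hz]
    · simp [trunc, hz]
  exact DFunLike.congr_fun this a

theorem restr_extd (e : Equivalence r) (φ : Func) : restr O (extd O r φ) = restr O φ := by
  ext a
  simp [restr_apply, collapse_trunc e]

theorem restr_circ (e : Equivalence r) (φ : Func) : restr O (circ O r φ) = 0 := by
  ext a
  simp [restr_apply, collapse_trunc e]

/-- A functional vanishes if it does so on polynomials in the variables of `O` and a further
variable `c`. -/
theorem Killed.eq_zero {φ : Func} (h : Killed r φ) (c : Pt)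
    (hc : ∀ z, (∃ z' ∈ O, r z z') ∨ r z c) (h0 : restr O φ = 0)
    (h1 : restr O ((X c : PtRing) • φ) = 0) : φ = 0 := by
  -- Modulo the relations every polynomial is b + b' X_c with b and b' in the variables of `O`; the
  -- square of X_c acts as zero.
  have key : ∀ a : PtRing, ∃ b b' : PtRing, trunc O b = b ∧ trunc O b' = b' ∧
      a • φ = b • φ + b' • (X c : PtRing) • φ := by
    intro a
    induction a using MvPolynomial.induction_on with
    | C k => exact ⟨C k, 0, by simp, by simp, by simp⟩
    | add p q hp hq =>
      obtain ⟨b, b', h1, h2, h3⟩ := hp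
      obtain ⟨d, d', h4, h5, h6⟩ := hq
      refine ⟨b + d, b' + d', by rw [map_add, h1, h4], by rw [map_add, h2, h5], ?_⟩
      rw [add_smul, h3, h6, add_smul, add_smul]
      abel
    | mul_X p z hp =>
      obtain ⟨b, b', h1, h2, h3⟩ := hp
      rcases hc z with ⟨z', hz', hr⟩ | hr
      · refine ⟨b * X z', b' * X z', by rw [map_mul, h1, trunc_X hz'],
          by rw [map_mul, h2, trunc_X hz'], ?_⟩
        rw [mul_smul, h.eq _ _ hr, smul_comm, h3, smul_add, mul_smul, mul_smul, smul_comm _ b,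
          smul_comm _ b', smul_comm (X z') (X c : PtRing)]
      · refine ⟨0, b, map_zero _, h1, ?_⟩
        rw [mul_smul, h.eq _ _ hr, smul_comm, h3, smul_add, smul_comm _ b, smul_comm _ b', h.sq]
        simp
  ext a
  obtain ⟨b, b', hb, hb', hab⟩ := key a
  have e0 := DFunLike.congr_fun h0 b
  have e1 := DFunLike.congr_fun h1 b'
  have e2 := DFunLike.congr_fun hab 1
  rw [restr_apply, hb] at e0
  rw [restr_apply, hb'] at e1
  simp only [Func.smul_apply, Func.add_apply, mul_one, Func.zero_apply] at e0 e1 e2 ⊢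
  rw [e2, e0, e1, add_zero]

theorem Killed.eq_zero_of_outer {φ : Func} (h : Killed r φ) (hc : ∀ z, ∃ z' ∈ O, r z z')
    (h0 : restr O φ = 0) : φ = 0 := by
  obtain ⟨c, hc', -⟩ := hc (0, 0)
  exact h.eq_zero c (fun z => Or.inl (hc z)) h0 (by rw [restr_smul (trunc_X hc'), h0, smul_zero])

end

end TransverseKhovanov

namespace TransverseKhovanov

/-! ### Cycles of a permutation multiplied by a transposition -/

section Perm

open Equiv

variable {α : Type*} [DecidableEq α] {π : Perm α} {p q : α}

/-- Multiplying by the transposition cuts the common cycle in two. With k minimal such that π^k p =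
q, the arc π p, …, π^k p is invariant under π ∘ swap; it contains q but not p. -/
theorem exists_separating_of_pow (hpq : p ≠ q) (h : ∃ k : ℕ, (π ^ k) p = q) :
    ∃ f : α → Prop, (∀ z, f (π (swap p q z)) ↔ f z) ∧ f q ∧ ¬ f p := by
  classical
  obtain ⟨k, hk, hmin⟩ : ∃ k : ℕ, (π ^ k) p = q ∧ ∀ m < k, (π ^ m) p ≠ q :=
    ⟨Nat.find h, Nat.find_spec h, fun m hm => Nat.find_min h hm⟩
  have hp : ∀ i, 0 < i → i ≤ k → (π ^ i) p ≠ p := by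
    intro i h0 hi hip
    refine hmin (k - i) (by omega) ?_
    rw [← hk, ← Nat.sub_add_cancel hi, pow_add, Perm.mul_apply, hip, Nat.add_sub_cancel]
  have hk0 : 0 < k := by
    rcases Nat.eq_zero_or_pos k with rfl | h
    · exact absurd hk (by simpa using hpq)
    · exact h
  have hsucc : ∀ i, (π ^ (i + 1)) p = π ((π ^ i) p) := fun i => by rw [pow_succ', Perm.mul_apply]
  refine ⟨fun z => ∃ i, 0 < i ∧ i ≤ k ∧ (π ^ i) p = z, fun z => ⟨?_, ?_⟩, ⟨k, hk0, le_rfl, hk⟩, ?_⟩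
  · rintro ⟨i, h0, hi, h⟩
    obtain ⟨i, rfl⟩ : ∃ j, i = j + 1 := ⟨i - 1, by omega⟩
    rw [hsucc] at h
    have h' := π.injective h
    rcases Nat.eq_zero_or_pos i with rfl | hi0
    · refine ⟨k, hk0, le_rfl, ?_⟩
      rw [hk]
      have : z = swap p q p := swap_apply_eq_iff.1 h'.symm
      rw [this, swap_apply_left]
    · refine ⟨i, hi0, by omega, ?_⟩
      have : z = swap p q ((π ^ i) p) := swap_apply_eq_iff.1 h'.symm
      rw [this, swap_apply_of_ne_of_ne (hp i hi0 (by omega)) (hmin i (by omega))]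
  · rintro ⟨i, h0, hi, rfl⟩
    rcases hi.lt_or_eq with hi | rfl
    · rw [swap_apply_of_ne_of_ne (hp i h0 hi.le) (hmin i hi), ← hsucc]
      exact ⟨i + 1, by omega, by omega, rfl⟩
    · rw [hk, swap_apply_right]
      exact ⟨1, by omega, by omega, by simp⟩
  · rintro ⟨i, h0, hi, h⟩
    exact hp i h0 hi h

theorem exists_separating (hpq : p ≠ q) (h : π.SameCycle p q) :
    ∃ f : α → Prop, (∀ z, f (π (swap p q z)) ↔ f z) ∧ ¬ (f p ↔ f q) := by
  obtain ⟨i, hi⟩ := h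
  obtain ⟨k, rfl | rfl⟩ := i.eq_nat_or_neg
  · obtain ⟨f, h1, h2, h3⟩ := exists_separating_of_pow hpq ⟨k, by simpa using hi⟩
    exact ⟨f, h1, fun h => h3 (h.2 h2)⟩
  · obtain ⟨f, h1, h2, h3⟩ := exists_separating_of_pow (π := π) hpq.symm
      ⟨k, by rw [← hi]; simp⟩
    rw [swap_comm] at h1
    exact ⟨f, h1, fun h => h3 (h.1 h2)⟩

/-- Under π ∘ swap the point q goes to π p and then runs along the cycle of p, which avoids q, until
it returns to p. Periodicity of p guarantees the return. -/
theorem iff_of_not_sameCycle (h : ¬ π.SameCycle p q) (hper : ∃ m, 0 < m ∧ (π ^ m) p = p)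
    {f : α → Prop} (hf : ∀ z, f (π (swap p q z)) ↔ f z) : f p ↔ f q := by
  classical
  obtain ⟨m, ⟨hm0, hm⟩, hmin⟩ : ∃ m, (0 < m ∧ (π ^ m) p = p) ∧ ∀ k < m, ¬ (0 < k ∧ (π ^ k) p = p) :=
    ⟨Nat.find hper, Nat.find_spec hper, fun k hk => Nat.find_min hper hk⟩
  have key : ∀ k, k < m → (f ((π ^ (k + 1)) p) ↔ f q) := by
    intro k
    induction k with
    | zero =>
      intro _
      have := hf q
      rw [swap_apply_right] at this
      simpa using this
    | succ k ih =>
      intro hk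
      rw [← ih (by omega), ← hf ((π ^ (k + 1)) p), swap_apply_of_ne_of_ne, ← Perm.mul_apply,
        ← pow_succ']
      · exact fun h' => hmin (k + 1) hk ⟨by omega, h'⟩
      · exact fun h' => h ⟨((k + 1 : ℕ) : ℤ), by rw [zpow_natCast]; exact h'⟩
  have := key (m - 1) (by omega)
  rwa [Nat.sub_add_cancel hm0, hm] at this

end Perm

/-! ### Resolved diagrams -/

/-- The condition that the truth value of `f` is constant along the arcs of a resolved crossing
between the levels `s` and `s + 1`: `none` stands for parallel strings, `some i` for the other
resolution of a crossing of the strings `i` and `i + 1`. -/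
def Step (s : ℕ) (f : Pt → Prop) : Option ℕ → Prop
  | none => ∀ j, f (j, s) ↔ f (j, s + 1)
  | some i => (f (i, s) ↔ f (i + 1, s)) ∧ (f (i, s + 1) ↔ f (i + 1, s + 1)) ∧
      ∀ j, j ≠ i → j ≠ i + 1 → (f (j, s) ↔ f (j, s + 1))

/-- The truth value of `f` is constant on the circles of the closure of a resolved diagram. -/
def Resp (e : List (Option ℕ)) (f : Pt → Prop) : Prop :=
  (∀ t o, e[t]? = some o → Step t f o) ∧ ∀ j s, e.length ≤ s → (f (j, s) ↔ f (j, 0))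

/-- Two points lie on the same circle of a resolved diagram. -/
def rel (e : List (Option ℕ)) (x y : Pt) : Prop := ∀ f, Resp e f → (f x ↔ f y)

theorem rel_equivalence (e : List (Option ℕ)) : Equivalence (rel e) where
  refl _ _ _ := Iff.rfl
  symm h f hf := (h f hf).symm
  trans h h' f hf := (h f hf).trans (h' f hf)

theorem Resp.of_le {e : List (Option ℕ)} {f : Pt → Prop} (h : ∀ x y, rel e x y → (f x ↔ f y)) :
    Resp e f := by
  refine ⟨fun t o ho => ?_, fun j s hs => h _ _ fun f hf => hf.2 j s hs⟩
  cases o with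
  | none => exact fun j => h _ _ fun f hf => hf.1 t _ ho j
  | some i =>
    exact ⟨h _ _ fun f hf => (hf.1 t _ ho).1, h _ _ fun f hf => (hf.1 t _ ho).2.1,
      fun j h1 h2 => h _ _ fun f hf => (hf.1 t _ ho).2.2 j h1 h2⟩

/-- The first hypothesis says that the two resolutions become the same after `p` and `q` are joined.
As exactly one of them already relates `p` and `q`, that one is the join of the other. -/
theorem saddle_of_resp {e e' : List (Option ℕ)} {p q : Pt}
    (h : ∀ f : Pt → Prop, (f p ↔ f q) → (Resp e f ↔ Resp e' f)) (hpq : rel e p q ↔ ¬ rel e' p q) :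
    Saddle (rel e) (rel e') p q := by
  have key : ∀ {e e' : List (Option ℕ)},
      (∀ f : Pt → Prop, (f p ↔ f q) → (Resp e f ↔ Resp e' f)) → rel e' p q →
      ∀ x y, rel e' x y ↔ Join (rel e) p q x y := by
    intro e e' h hpq x y
    have E := rel_equivalence e
    have hle : ∀ {x y}, rel e x y → rel e' x y := fun hxy f hf => hxy f ((h f (hpq f hf)).2 hf)
    constructor
    · intro hxy
      have hpq' : Join (rel e) p q x p ↔ Join (rel e) p q x q := by
        have h1 := E.refl p
        have h2 := E.refl q
        unfold Join
        constructor
        · rintro (h | ⟨h, -⟩ | ⟨h, -⟩)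
          exacts [Or.inr (Or.inl ⟨h, h2⟩), Or.inr (Or.inl ⟨h, h2⟩), Or.inl h]
        · rintro (h | ⟨h, -⟩ | ⟨h, -⟩)
          exacts [Or.inr (Or.inr ⟨h, h1⟩), Or.inl h, Or.inr (Or.inr ⟨h, h1⟩)]
      -- The joined class of `x` serves as the test predicate: it is constant on the circles of `e`
      -- and takes the same value at `p` and `q`.
      have hJ : Resp e (Join (rel e) p q x) := by
        refine Resp.of_le fun y z hyz => ?_
        have : ∀ {y z}, rel e y z → Join (rel e) p q x y → Join (rel e) p q x z := by
          rintro y z hyz (h | ⟨h, h'⟩ | ⟨h, h'⟩)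
          exacts [Or.inl (E.trans h hyz), Or.inr (Or.inl ⟨h, E.trans h' hyz⟩),
            Or.inr (Or.inr ⟨h, E.trans h' hyz⟩)]
        exact ⟨this hyz, this (E.symm hyz)⟩
      exact (hxy _ ((h _ hpq').1 hJ)).1 (Or.inl (E.refl x))
    · have E' := rel_equivalence e'
      rintro (h | ⟨h, h'⟩ | ⟨h, h'⟩)
      · exact hle h
      · exact E'.trans (hle h) (E'.trans hpq (hle h'))
      · exact E'.trans (hle h) (E'.trans (E'.symm hpq) (hle h'))
  by_cases h1 : rel e p q
  · exact Or.inr ⟨hpq.1 h1, key (fun f hf => (h f hf).symm) h1⟩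
  · exact Or.inl ⟨h1, key h (by_contra fun h' => h1 (hpq.2 h'))⟩

/-! ### The orientation of the circles -/

/-- The other end of the arc above a point. -/
def up (e : List (Option ℕ)) (z : Pt) : Pt :=
  match e[z.2]? with
  | some none => (z.1, z.2 + 1)
  | some (some i) => if z.1 = i then (i + 1, z.2) else if z.1 = i + 1 then (i, z.2)
      else (z.1, z.2 + 1)
  | none => if z.2 = e.length then (z.1, 0) else z

/-- The other end of the arc below a point. -/
def down (e : List (Option ℕ)) : Pt → Pt
  | (j, 0) => (j, e.length)
  | (j, s + 1) =>
    match e[s]? with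
    | some none => (j, s)
    | some (some i) => if j = i then (i + 1, s + 1) else if j = i + 1 then (i, s + 1) else (j, s)
    | none => (j, s + 1)

/-- The next point on an oriented circle, where strings at positions of the parity of `b` are
oriented upwards and the others downwards. -/
def next (e : List (Option ℕ)) (b : ℕ) (z : Pt) : Pt :=
  if Even (z.1 + b) then up e z else down e z

/-- Raising `b` by one reverses the orientation. The alternating orientation is consistent because a
turn joins neighbouring strings, which have opposite parity. -/
theorem next_next (e : List (Option ℕ)) (b : ℕ) (z : Pt) : next e (b + 1) (next e b z) = z := by
  obtain ⟨j, s⟩ := z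
  have h1 : Even (j + (b + 1)) ↔ ¬ Even (j + b) := by rw [← add_assoc, Nat.even_add_one]
  by_cases hb : Even (j + b)
  · rw [next.eq_1 e b, if_pos hb]
    unfold up
    dsimp only
    split
    · rename_i h
      simp [next, h1, hb, down, h]
    · rename_i i h
      have hs : s < e.length := (List.getElem?_eq_some_iff.1 h).1
      split_ifs with h2 h3
      · subst h2
        simp [next, up, h, show Even (j + 1 + (b + 1)) ↔ Even (j + b) by
          rw [show j + 1 + (b + 1) = j + b + 2 by ring]; simp [Nat.even_add], hb]
      · subst h3
        simp [next, up, h, show Even (i + (b + 1)) ↔ Even (i + 1 + b) by ring_nf, hb]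
      · simp [next, h1, hb, down, h, h2, h3]
    · rename_i h
      have hs : e.length ≤ s := by simpa using h
      split_ifs with h2
      · simp [next, h1, hb, down, h2]
      · obtain ⟨s, rfl⟩ : ∃ k, s = k + 1 := ⟨s - 1, by omega⟩
        have : e[s]? = none := by simp; omega
        simp [next, h1, hb, down, this]
  · rw [next.eq_1 e b, if_neg hb]
    cases s with
    | zero =>
      simp [next, h1, hb, down, up]
    | succ s =>
      unfold down
      dsimp only
      split
      · rename_i h
        simp [next, h1, hb, up, h]
      · rename_i i h
        split_ifs with h2 h3
        · subst h2
          simp [next, down, h, show Even (j + 1 + (b + 1)) ↔ Even (j + b) by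
            rw [show j + 1 + (b + 1) = j + b + 2 by ring]; simp [Nat.even_add], hb]
        · subst h3
          simp [next, down, h, show Even (i + (b + 1)) ↔ Even (i + 1 + b) by ring_nf, hb]
        · simp [next, h1, hb, up, h, h2, h3]
      · rename_i h
        have hs : e.length ≤ s := by simpa using h
        have : e[s + 1]? = none := by simp; omega
        simp [next, h1, hb, up, this]
        omega

theorem next_add_two (e : List (Option ℕ)) (b : ℕ) (z : Pt) : next e (b + 2) z = next e b z := by
  simp [next, ← add_assoc, Nat.even_add]

/-- The permutation of the points along the oriented circles. -/
def nextPerm (e : List (Option ℕ)) (b : ℕ) : Equiv.Perm Pt where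
  toFun := next e b
  invFun := next e (b + 1)
  left_inv := next_next e b
  right_inv z := by
    have := next_next e (b + 1) z
    rwa [next_add_two] at this

end TransverseKhovanov

/-! ### Circles as cycles of the oriented permutation, and resolution changes as saddles -/

namespace TransverseKhovanov

theorem Resp.up {e : List (Option ℕ)} {f : Pt → Prop} (hf : Resp e f) (z : Pt) :
    f (up e z) ↔ f z := by
  obtain ⟨j, s⟩ := z
  unfold TransverseKhovanov.up
  dsimp only
  split
  · rename_i h
    exact (hf.1 _ _ h j).symm
  · rename_i i h
    obtain ⟨h1, h2, h3⟩ := hf.1 _ _ h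
    split_ifs with h4 h5
    · subst h4; exact h1.symm
    · subst h5; exact h1
    · exact (h3 j h4 h5).symm
  · split_ifs with h2
    · exact (hf.2 j s h2.ge).symm
    · rfl

theorem Resp.down {e : List (Option ℕ)} {f : Pt → Prop} (hf : Resp e f) (z : Pt) :
    f (down e z) ↔ f z := by
  obtain ⟨j, s⟩ := z
  cases s with
  | zero => exact hf.2 j _ le_rfl
  | succ s =>
    unfold TransverseKhovanov.down
    dsimp only
    split
    · rename_i h
      exact hf.1 _ _ h j
    · rename_i i h
      obtain ⟨h1, h2, h3⟩ := hf.1 _ _ h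
      split_ifs with h4 h5
      · subst h4; exact h2.symm
      · subst h5; exact h2
      · exact h3 j h4 h5
    · rfl

theorem Resp.next {e : List (Option ℕ)} {f : Pt → Prop} (hf : Resp e f) (b : ℕ) (z : Pt) :
    f (next e b z) ↔ f z := by
  unfold TransverseKhovanov.next
  split_ifs
  exacts [hf.up z, hf.down z]

/-- The walk fixes all points above the level `e.length`, whereas `Resp` identifies them with level
0; hence the correction of `f` there. -/
theorem resp_of_next {e : List (Option ℕ)} {b : ℕ} {f : Pt → Prop}
    (hf : ∀ z, f (next e b z) ↔ f z) :
    Resp e (fun z => f (if z.2 ≤ e.length then z else (z.1, 0))) := by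
  have hup : ∀ z : Pt, Even (z.1 + b) → (f (up e z) ↔ f z) := fun z hz => by
    rw [← hf z, next, if_pos hz]
  have hdown : ∀ z : Pt, ¬ Even (z.1 + b) → (f (down e z) ↔ f z) := fun z hz => by
    rw [← hf z, next, if_neg hz]
  refine ⟨fun t o ho => ?_, fun j s hs => ?_⟩
  · have ht : t < e.length := (List.getElem?_eq_some_iff.1 ho).1
    cases o with
    | none =>
      intro j
      dsimp only
      rw [if_pos ht.le, if_pos (by omega)]
      by_cases hj : Even (j + b)
      · simpa [up, ho] using (hup (j, t) hj).symm
      · simpa [down, ho] using hdown (j, t + 1) hj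
    | some i =>
      refine ⟨?_, ?_, fun j h1 h2 => ?_⟩ <;> dsimp only <;> simp only [if_pos ht.le, if_pos
          (Nat.succ_le_of_lt ht)]
      · by_cases hj : Even (i + b)
        · simpa [up, ho] using (hup (i, t) hj).symm
        · have : Even (i + 1 + b) := by rw [add_right_comm, Nat.even_add_one]; exact hj
          simpa [up, ho] using hup (i + 1, t) this
      · by_cases hj : Even (i + b)
        · have : ¬ Even (i + 1 + b) := by rw [add_right_comm, Nat.even_add_one]; exact not_not.2 hj
          simpa [down, ho] using hdown (i + 1, t + 1) this
        · simpa [down, ho] using (hdown (i, t + 1) hj).symm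
      · by_cases hj : Even (j + b)
        · simpa [up, ho, h1, h2] using (hup (j, t) hj).symm
        · simpa [down, ho, h1, h2] using hdown (j, t + 1) hj
  · dsimp only
    rw [if_pos (Nat.zero_le _)]
    split_ifs with h
    · obtain rfl : s = e.length := le_antisymm h hs
      by_cases hj : Even (j + b)
      · simpa [up] using (hup (j, e.length) hj).symm
      · simpa [down] using hdown (j, 0) hj
    · rfl

theorem rel_of_sameCycle {e : List (Option ℕ)} {b : ℕ} {x y : Pt}
    (h : (nextPerm e b).SameCycle x y) : rel e x y := by
  intro f hf
  obtain ⟨i, rfl⟩ := h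
  have key : ∀ k : ℕ, ∀ z, f ((nextPerm e b ^ k) z) ↔ f z := by
    intro k
    induction k with
    | zero => simp
    | succ k ih =>
      intro z
      rw [pow_succ, Equiv.Perm.mul_apply, ih]
      exact hf.next b z
  obtain ⟨k, rfl | rfl⟩ := i.eq_nat_or_neg
  · rw [zpow_natCast, key]
  · rw [zpow_neg, zpow_natCast, ← key k (((nextPerm e b) ^ k)⁻¹ x)]
    simp

theorem sameCycle_of_rel {e : List (Option ℕ)} (b : ℕ) {x y : Pt} (hx : x.2 ≤ e.length)
    (hy : y.2 ≤ e.length) (h : rel e x y) : (nextPerm e b).SameCycle x y := by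
  have := h _ (resp_of_next (b := b) (f := (nextPerm e b).SameCycle x) fun z => by
    exact Equiv.Perm.sameCycle_apply_right)
  simp only [hx, hy, if_true] at this
  exact this.1 (Equiv.Perm.SameCycle.refl _ _)

theorem exists_bound (e : List (Option ℕ)) : ∃ N, ∀ (t i : ℕ), e[t]? = some (some i) → i < N := by
  refine ⟨(e.filterMap id).sum + 1, fun t i h => Nat.lt_succ_of_le ?_⟩
  exact List.single_le_sum (fun _ _ => Nat.zero_le _) _
    (by simpa using List.mem_of_getElem? h)

/-- There are infinitely many points, but an orbit stays in a finite box: only strings up to N take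
part in turns, and no step leaves the levels up to `e.length`. Two powers therefore agree at `z`. -/
theorem exists_pow_nextPerm (e : List (Option ℕ)) (b : ℕ) {z : Pt} (hz : z.2 ≤ e.length) :
    ∃ m, 0 < m ∧ (nextPerm e b ^ m) z = z := by
  obtain ⟨N, hN⟩ := exists_bound e
  set S : Set Pt := {y | y.1 ≤ max N z.1 ∧ y.2 ≤ e.length}
  have hS : S.Finite := ((Set.finite_Iic (max N z.1)).prod (Set.finite_Iic e.length)).subset
    fun y hy => ⟨hy.1, hy.2⟩
  have hup : ∀ y ∈ S, up e y ∈ S := by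
    rintro ⟨j, s⟩ ⟨h1, h2⟩
    unfold up
    dsimp only at *
    split
    · rename_i h
      have := (List.getElem?_eq_some_iff.1 h).1
      exact ⟨h1, this⟩
    · rename_i i h
      have := (List.getElem?_eq_some_iff.1 h).1
      have := hN _ _ h
      split_ifs <;> constructor <;> dsimp only <;> omega
    · split_ifs <;> constructor <;> dsimp only <;> omega
  have hdown : ∀ y ∈ S, down e y ∈ S := by
    rintro ⟨j, s⟩ ⟨h1, h2⟩
    dsimp only at *
    cases s with
    | zero => exact ⟨h1, le_rfl⟩
    | succ s =>
      unfold down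
      dsimp only
      split
      · exact ⟨h1, by dsimp only; omega⟩
      · rename_i i h
        have := hN _ _ h
        split_ifs <;> constructor <;> dsimp only <;> omega
      · exact ⟨h1, h2⟩
  have hnext : ∀ y ∈ S, nextPerm e b y ∈ S := by
    intro y hy
    change next e b y ∈ S
    unfold next
    split_ifs
    exacts [hup y hy, hdown y hy]
  have hpow : ∀ k : ℕ, (nextPerm e b ^ k) z ∈ S := by
    intro k
    induction k with
    | zero => exact ⟨le_max_right _ _, hz⟩
    | succ k ih => rw [pow_succ', Equiv.Perm.mul_apply]; exact hnext _ ih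
  have hinj : ¬ Function.Injective fun k : ℕ => (nextPerm e b ^ k) z := fun h =>
    Set.infinite_of_injective_forall_mem h hpow hS
  obtain ⟨k, l, hkl, hne⟩ : ∃ k l : ℕ, (nextPerm e b ^ k) z = (nextPerm e b ^ l) z ∧ k < l := by
    simp only [Function.Injective, not_forall] at hinj
    obtain ⟨k, l, h, hne⟩ := hinj
    rcases Nat.lt_or_gt_of_ne hne with h' | h'
    exacts [⟨k, l, h, h'⟩, ⟨l, k, h.symm, h'⟩]
  refine ⟨l - k, by omega, ?_⟩
  rw [← Nat.add_sub_cancel' hne.le, pow_add, Equiv.Perm.mul_apply] at hkl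
  exact ((nextPerm e b ^ k).injective hkl).symm

/-- Changing the resolution of one crossing either joins two circles or splits one into two. -/
theorem saddle_rel {e e' : List (Option ℕ)} {t i : ℕ} (hlen : e.length = e'.length)
    (ht : e[t]? = some none) (ht' : e'[t]? = some (some i)) (hne : ∀ s, s ≠ t → e[s]? = e'[s]?) :
    Saddle (rel e) (rel e') (i, t) (i + 1, t + 1) := by
  have htl : t < e.length := (List.getElem?_eq_some_iff.1 ht).1
  refine saddle_of_resp (fun f hf => ⟨fun h => ⟨fun s o ho => ?_, fun j s hs => h.2 j s (hlen ▸
      hs)⟩,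
    fun h => ⟨fun s o ho => ?_, fun j s hs => h.2 j s (hlen ▸ hs)⟩⟩) ?_
  · by_cases hs : s = t
    · subst hs
      rw [ht', Option.some_inj] at ho
      subst ho
      have := h.1 s none ht
      have h1 := this i
      have h2 := this (i + 1)
      exact ⟨by tauto, by tauto, fun j _ _ => this j⟩
    · exact h.1 s o (by rw [hne s hs, ho])
  · by_cases hs : s = t
    · subst hs
      rw [ht, Option.some_inj] at ho
      subst ho
      obtain ⟨h1, h2, h3⟩ := h.1 s _ ht'
      intro j
      by_cases hj : j = i
      · subst hj; tauto
      · by_cases hj' : j = i + 1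
        · subst hj'; tauto
        · exact h3 j hj hj'
    · exact h.1 s o (by rw [← hne s hs, ho])
  -- With b = i the string i runs upwards and i + 1 downwards, so the walk enters the crossing
  -- exactly at (i, t) and (i + 1, t + 1). Passing from parallel strings to turns exchanges the two
  -- exits, which is multiplication by a transposition.
  · have hmul : ∀ z, nextPerm e i (Equiv.swap (i, t) (i + 1, t + 1) z) = nextPerm e' i z := by
      have hev : Even (i + i) := ⟨i, rfl⟩
      have hodd : ¬ Even (i + 1 + i) := by rw [add_right_comm, Nat.even_add_one]; exact not_not.2 hev
      intro z
      change next e i _ = next e' i z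
      by_cases h1 : z = (i, t)
      · subst h1
        simp [next, hev, hodd, up, down, ht, ht']
      · by_cases h2 : z = (i + 1, t + 1)
        · subst h2
          simp [next, hev, hodd, up, down, ht, ht']
        · rw [Equiv.swap_apply_of_ne_of_ne h1 h2]
          obtain ⟨j, s⟩ := z
          unfold next
          dsimp only
          split_ifs with h3
          · by_cases hs : s = t
            · subst hs
              have hj : j ≠ i := fun h => h1 (by rw [h])
              have hj' : j ≠ i + 1 := fun h => hodd (h ▸ h3)
              simp [up, ht, ht', hj, hj']
            · simp [up, hne s hs, hlen]
          · cases s with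
            | zero => simp [down, hlen]
            | succ s =>
              by_cases hs : s = t
              · subst hs
                have hj : j ≠ i + 1 := fun h => h2 (by rw [h])
                have hj' : j ≠ i := fun h => h3 (h ▸ hev)
                simp [down, ht, ht', hj, hj']
              · simp [down, hne s hs]
    have hp : (i, t).2 ≤ e.length := htl.le
    have hq : (i + 1, t + 1).2 ≤ e.length := htl
    -- A transposition inside a cycle separates its two points, and one between different cycles
    -- joins them; thus the two points lie on one circle in exactly one of the resolutions.
    constructor
    · intro h h'
      obtain ⟨f, hf, hpq⟩ := exists_separating (by simp) (sameCycle_of_rel i hp hq h)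
      have hf' : ∀ z, f (next e' i z) ↔ f z := fun z => by
        rw [← hf z, hmul z]; rfl
      have := h' _ (resp_of_next hf')
      rw [hlen] at hp hq
      simp only [hp, hq, if_true] at this
      exact hpq this
    · intro h'
      by_contra h
      refine h' fun f hf => ?_
      refine iff_of_not_sameCycle (π := nextPerm e i) (fun h'' => h (rel_of_sameCycle h''))
        (exists_pow_nextPerm e i hp) fun z => ?_
      rw [hmul z]
      exact hf.next i z

end TransverseKhovanov

namespace TransverseKhovanov

/-! ### Local modifications at the end of a resolved diagram -/

/-- The part of `Resp` that concerns the arcs other than the closing ones. -/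
def OpenResp (e : List (Option ℕ)) (f : Pt → Prop) : Prop :=
  ∀ t o, e[t]? = some o → Step t f o

theorem resp_iff {e : List (Option ℕ)} {f : Pt → Prop} :
    Resp e f ↔ OpenResp e f ∧ ∀ j s, e.length ≤ s → (f (j, s) ↔ f (j, 0)) := Iff.rfl

theorem openResp_snoc {e : List (Option ℕ)} {o : Option ℕ} {f : Pt → Prop} :
    OpenResp (e ++ [o]) f ↔ OpenResp e f ∧ Step e.length f o := by
  constructor
  · refine fun h => ⟨fun t o' ho => h t o' ?_, h _ _ (by simp)⟩
    rw [List.getElem?_append_left (List.getElem?_eq_some_iff.1 ho).1, ho]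
  · rintro ⟨h1, h2⟩ t o' ho
    rcases lt_trichotomy t e.length with h | rfl | h
    · rw [List.getElem?_append_left h] at ho
      exact h1 t o' ho
    · simp only [List.getElem?_concat_length, Option.some_inj] at ho
      exact ho ▸ h2
    · rw [List.getElem?_eq_none (by simp; omega)] at ho
      exact absurd ho (by simp)

theorem OpenResp.congr {e : List (Option ℕ)} {f g : Pt → Prop}
    (h : ∀ j s, s ≤ e.length → (f (j, s) ↔ g (j, s))) (hf : OpenResp e f) : OpenResp e g := by
  intro t o ho
  have ht : t < e.length := (List.getElem?_eq_some_iff.1 ho).1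
  have h1 := fun j => h j t ht.le
  have h2 := fun j => h j (t + 1) ht
  have := hf t o ho
  cases o with
  | none => exact fun j => by rw [← h1, ← h2]; exact this j
  | some i =>
    obtain ⟨a, b, c⟩ := this
    exact ⟨by rw [← h1, ← h1]; exact a, by rw [← h2, ← h2]; exact b,
      fun j hj hj' => by rw [← h1, ← h2]; exact c j hj hj'⟩

theorem resp_snoc {e : List (Option ℕ)} {a : Option ℕ} {f : Pt → Prop} :
    Resp (e ++ [a]) f ↔ OpenResp e f ∧ Step e.length f a ∧
      ∀ j s, e.length + 1 ≤ s → (f (j, s) ↔ f (j, 0)) := by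
  rw [resp_iff, openResp_snoc, and_assoc, List.length_append, List.length_singleton]

theorem resp_snoc₂ {e : List (Option ℕ)} {a b : Option ℕ} {f : Pt → Prop} :
    Resp (e ++ [a] ++ [b]) f ↔ OpenResp e f ∧ Step e.length f a ∧ Step (e.length + 1) f b ∧
      ∀ j s, e.length + 2 ≤ s → (f (j, s) ↔ f (j, 0)) := by
  rw [resp_snoc, openResp_snoc, and_assoc, List.length_append, List.length_singleton]

theorem resp_snoc₃ {e : List (Option ℕ)} {a b c : Option ℕ} {f : Pt → Prop} :
    Resp (e ++ [a] ++ [b] ++ [c]) f ↔ OpenResp e f ∧ Step e.length f a ∧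
      Step (e.length + 1) f b ∧ Step (e.length + 2) f c ∧
      ∀ j s, e.length + 3 ≤ s → (f (j, s) ↔ f (j, 0)) := by
  rw [resp_snoc₂, openResp_snoc, and_assoc, List.length_append, List.length_singleton]

/-- This is how planar isotopies are verified: two diagrams induce the same circles on `O` as soon
as each invariant predicate of one has the same restriction to `O` as an invariant predicate of the
other. Below, the witnesses keep `f` up to the level `e.length` and redistribute its values above.
-/
theorem onSet_rel_eq {O : Set Pt} {e e' : List (Option ℕ)}
    (h : ∀ f, Resp e f → ∃ g, Resp e' g ∧ ∀ z ∈ O, (f z ↔ g z))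
    (h' : ∀ f, Resp e' f → ∃ g, Resp e g ∧ ∀ z ∈ O, (f z ↔ g z)) :
    onSet O (rel e) = onSet O (rel e') := by
  have key : ∀ {e e' : List (Option ℕ)}, (∀ f, Resp e f → ∃ g, Resp e' g ∧ ∀ z ∈ O, (f z ↔ g z)) →
      ∀ x y, onSet O (rel e') x y → onSet O (rel e) x y := by
    rintro e e' h x y (h' | ⟨hx, hy, hxy⟩)
    · exact Or.inl h'
    · refine Or.inr ⟨hx, hy, fun f hf => ?_⟩
      obtain ⟨g, hg, hfg⟩ := h f hf
      rw [hfg x hx, hfg y hy]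
      exact hxy g hg
  ext x y
  exact ⟨key h' x y, key h x y⟩

/-- The points up to the level `l`. -/
def Lev (l : ℕ) : Set Pt := {z | z.2 ≤ l}

@[simp] theorem mem_lev {l : ℕ} {z : Pt} : z ∈ Lev l ↔ z.2 ≤ l := Iff.rfl

theorem onSet_mono {O O' : Set Pt} (hO : O ⊆ O') {r r' : Pt → Pt → Prop} (h : onSet O' r = onSet O'
    r') :
    onSet O r = onSet O r' := by
  have : ∀ s : Pt → Pt → Prop, onSet O s = onSet O (onSet O' s) := by
    intro s
    ext x y
    constructor
    · rintro (h | ⟨hx, hy, h⟩)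
      exacts [Or.inl h, Or.inr ⟨hx, hy, Or.inr ⟨hO hx, hO hy, h⟩⟩]
    · rintro (h | ⟨hx, hy, h | ⟨-, -, h⟩⟩)
      exacts [Or.inl h, Or.inl h, Or.inr ⟨hx, hy, h⟩]
  rw [this r, this r', h]

variable (e : List (Option ℕ)) {i j : ℕ}

/-- All levels from the length on are identified with level 0, so a final pair of parallel strings
changes nothing, even at the points of the new level. -/
theorem rel_none : rel (e ++ [none]) = rel e := by
  have : ∀ f, Resp (e ++ [none]) f ↔ Resp e f := by
    intro f
    rw [resp_snoc, resp_iff]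
    refine and_congr_right fun _ => ⟨fun ⟨h1, h2⟩ j s hs => ?_, fun h => ⟨fun j => ?_, fun j s hs
        => ?_⟩⟩
    · rcases hs.lt_or_eq with h | rfl
      · exact h2 j s h
      · rw [h1 j, h2 j _ le_rfl]
    · rw [h j _ le_rfl, h j _ (Nat.le_succ _)]
    · exact h j s (by omega)
  ext x y
  simp only [rel, this]

theorem rel_none_some (o : Option ℕ) :
    onSet (Lev e.length) (rel (e ++ [none] ++ [o])) = onSet (Lev e.length) (rel (e ++ [o])) := by
  apply onSet_rel_eq <;> intro f hf
  · rw [resp_snoc₂] at hf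
    obtain ⟨h1, h2, h3, h4⟩ := hf
    refine ⟨fun z => if z.2 ≤ e.length then f z else f (z.1, 0), ?_, fun z hz => by simp_all⟩
    rw [resp_snoc]
    refine ⟨h1.congr fun j s hs => by simp [hs], ?_, by grind⟩
    cases o <;> simp only [Step] at * <;> grind
  · rw [resp_snoc] at hf
    obtain ⟨h1, h2, h4⟩ := hf
    refine ⟨fun z => if z.2 ≤ e.length then f z else if z.2 = e.length + 1 then f (z.1, e.length)
      else f (z.1, 0), ?_, fun z hz => by simp_all⟩
    rw [resp_snoc₂]
    refine ⟨h1.congr fun j s hs => by simp [hs], ?_, ?_, by grind⟩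
    · simp only [Step] at *
      grind
    · cases o <;> simp only [Step] at * <;> grind

theorem rel_none_some₂ (o o' : Option ℕ) :
    onSet (Lev e.length) (rel (e ++ [none] ++ [o] ++ [o'])) =
      onSet (Lev e.length) (rel (e ++ [o] ++ [o'])) := by
  apply onSet_rel_eq <;> intro f hf
  · rw [resp_snoc₃] at hf
    obtain ⟨h1, h2, h3, h4, h5⟩ := hf
    refine ⟨fun z => if z.2 ≤ e.length then f z else if z.2 = e.length + 1 then f (z.1, e.length +
        2)
      else f (z.1, 0), ?_, fun z hz => by simp_all⟩
    rw [resp_snoc₂]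
    refine ⟨h1.congr fun j s hs => by simp [hs], ?_, ?_, by grind⟩
    · cases o <;> simp only [Step] at * <;> grind
    · cases o' <;> simp only [Step] at * <;> grind
  · rw [resp_snoc₂] at hf
    obtain ⟨h1, h2, h3, h4⟩ := hf
    refine ⟨fun z => if z.2 ≤ e.length then f z else if z.2 = e.length + 1 then f (z.1, e.length)
      else if z.2 = e.length + 2 then f (z.1, e.length + 1)
      else f (z.1, 0), ?_, fun z hz => by simp_all⟩
    rw [resp_snoc₃]
    refine ⟨h1.congr fun j s hs => by simp [hs], ?_, ?_, ?_, by grind⟩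
    · simp only [Step] at *
      grind
    · cases o <;> simp only [Step] at * <;> grind
    · cases o' <;> simp only [Step] at * <;> grind

/-- The Temperley–Lieb relation for the square of a generator: the circle between the two turns has
no point in `Lev e.length`, so the restriction does not see it. -/
theorem rel_turn_turn (i : ℕ) :
    onSet (Lev e.length) (rel (e ++ [some i] ++ [some i])) =
      onSet (Lev e.length) (rel (e ++ [some i])) := by
  apply onSet_rel_eq <;> intro f hf
  · rw [resp_snoc₂] at hf
    obtain ⟨h1, h2, h3, h4⟩ := hf
    refine ⟨fun z => if z.2 ≤ e.length then f z else f (z.1, 0), ?_, fun z hz => by simp_all⟩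
    rw [resp_snoc]
    refine ⟨h1.congr fun j s hs => by simp [hs], ?_, by grind⟩
    simp only [Step] at *
    grind
  · rw [resp_snoc] at hf
    obtain ⟨h1, h2, h4⟩ := hf
    refine ⟨f, ?_, fun z hz => Iff.rfl⟩
    rw [resp_snoc₂]
    refine ⟨h1, h2, ?_, by grind⟩
    simp only [Step] at *
    grind

/-- The Temperley–Lieb relation e_i e_j e_i = e_i: the middle part is a zigzag that can be pulled
straight. -/
theorem rel_turn_turn_turn (hij : i + 1 = j ∨ j + 1 = i) :
    onSet (Lev e.length) (rel (e ++ [some i] ++ [some j] ++ [some i])) =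
      onSet (Lev e.length) (rel (e ++ [some i])) := by
  apply onSet_rel_eq <;> intro f hf
  · rw [resp_snoc₃] at hf
    obtain ⟨h1, h2, h3, h4, h5⟩ := hf
    refine ⟨fun z => if z.2 ≤ e.length then f z else f (z.1, 0), ?_, fun z hz => by simp_all⟩
    rw [resp_snoc]
    refine ⟨h1.congr fun j s hs => by simp [hs], ?_, by grind⟩
    simp only [Step] at *
    rcases hij with rfl | rfl <;> grind
  · rw [resp_snoc] at hf
    obtain ⟨h1, h2, h4⟩ := hf
    -- On the two intermediate levels the three strings involved all belong to the zigzag. It ends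
    -- at the string outside {i, i + 1}, that is j + 1 or j, whose closing value it receives.
    refine ⟨fun z => if z.2 ≤ e.length then f z else if e.length + 3 ≤ z.2 then f (z.1, 0) else
      if z.1 = i ∨ z.1 = i + 1 ∨ z.1 = j ∨ z.1 = j + 1 then
        f (if i + 1 = j then j + 1 else j, 0) else f (z.1, 0), ?_, fun z hz => by simp_all⟩
    rw [resp_snoc₃]
    refine ⟨h1.congr fun j s hs => by simp [hs], ?_, ?_, ?_, by grind⟩ <;>
    simp only [Step] at * <;>
    rcases hij with rfl | rfl <;> grind

theorem rel_far_comm (hij : i + 1 < j ∨ j + 1 < i) :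
    onSet (Lev e.length) (rel (e ++ [some i] ++ [some j])) =
      onSet (Lev e.length) (rel (e ++ [some j] ++ [some i])) := by
  have key : ∀ {i j : ℕ}, (i + 1 < j ∨ j + 1 < i) → ∀ f, Resp (e ++ [some i] ++ [some j]) f →
      ∃ g, Resp (e ++ [some j] ++ [some i]) g ∧ ∀ z ∈ Lev e.length, (f z ↔ g z) := by
    intro i j hij f hf
    rw [resp_snoc₂] at hf
    obtain ⟨h1, h2, h3, h4⟩ := hf
    -- On the intermediate level the strings j and j + 1 are now above their turn and take the
    -- closing value, while the others are continued from below.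
    refine ⟨fun z => if z.2 ≤ e.length then f z else if z.2 = e.length + 1 then
      (if z.1 = j ∨ z.1 = j + 1 then f (z.1, 0) else f (z.1, e.length)) else f (z.1, 0), ?_,
      fun z hz => by simp_all⟩
    rw [resp_snoc₂]
    refine ⟨h1.congr fun j s hs => by simp [hs], ?_, ?_, by grind⟩ <;>
    simp only [Step] at * <;> grind
  exact onSet_rel_eq (key hij) (key hij.symm)

end TransverseKhovanov

namespace TransverseKhovanov
open MvPolynomial

/-! ### Cocycles on the cube of resolutions -/

/-- The resolution `b` of a crossing: `none` for parallel strings. -/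
def resLetter (x : ℕ × Bool) (b : Bool) : Option ℕ := if b = x.2 then some x.1 else none

/-- The resolution `v` of a word. -/
def res (w : List (ℕ × Bool)) (v : List Bool) : List (Option ℕ) := List.zipWith resLetter w v

/-- The oriented resolution. -/
def orient (w : List (ℕ × Bool)) : List Bool := w.map fun x => !x.2

/-- The sign of the edge in direction `t` at `v`. -/
noncomputable def sgn (v : List Bool) (t : ℕ) : PtRing := (-1) ^ (v.take t).count true

/-- The signed sum over the edges at `v` of the cube of a word whose first crossing lies above the
level `l`. -/
noncomputable def edgeSum (l : ℕ) (w : List (ℕ × Bool)) (r : Pt → Pt → Prop) (φ : List Bool → Func)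
    (v : List Bool) : Func :=
  ∑ t ∈ Finset.range w.length, if v[t]? = some false then
    (sgn v t * sad r ((w.getD t (0, true)).1, l + t) ((w.getD t (0, true)).1 + 1, l + t + 1)) •
      φ (v.set t true) else 0

/-- The existence of a cocycle of the dual of the Khovanov complex that takes a unit as value on
`ψ`. -/
def Good (n : ℕ) (w : List (ℕ × Bool)) : Prop :=
  ∃ φ : List Bool → Func, (∀ v, v.length = w.length → Killed (rel (res w v)) (φ v)) ∧
    (∀ v, v.length = w.length → edgeSum 0 w (rel (res w v)) φ v = 0) ∧
    IsUnit (φ (orient w) (∏ j ∈ Finset.range (n + 1), X (j, 0)))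

theorem length_res {w : List (ℕ × Bool)} {v : List Bool} (h : v.length = w.length) :
    (res w v).length = w.length := by simp [res, h]

@[simp] theorem length_orient (w : List (ℕ × Bool)) : (orient w).length = w.length := by
  simp [orient]

theorem res_append {A X : List (ℕ × Bool)} {v u : List Bool} (h : v.length = A.length) :
    res (A ++ X) (v ++ u) = res A v ++ res X u := List.zipWith_append h.symm

section edgeSum

variable {l : ℕ} {w : List (ℕ × Bool)} {r : Pt → Pt → Prop} {φ ψ : List Bool → Func} {v : List Bool}

theorem edgeSum_congr {r' : Pt → Pt → Prop}
    (hr : ∀ p q : Pt, p.2 ≤ l + w.length → q.2 ≤ l + w.length → (r p q ↔ r' p q))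
    (hφ : ∀ t < w.length, v[t]? = some false → φ (v.set t true) = ψ (v.set t true)) :
    edgeSum l w r φ v = edgeSum l w r' ψ v := by
  refine Finset.sum_congr rfl fun t ht => ?_
  have ht := Finset.mem_range.1 ht
  split_ifs with h
  · rw [hφ t ht h, sad_congr (hr _ _ (by dsimp only; omega) (by dsimp only; omega))]
  · rfl

theorem edgeSum_add : edgeSum l w r (fun v => φ v + ψ v) v = edgeSum l w r φ v + edgeSum l w r ψ v
    := by
  rw [edgeSum, edgeSum, edgeSum, ← Finset.sum_add_distrib]
  refine Finset.sum_congr rfl fun t _ => ?_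
  split_ifs <;> simp

theorem edgeSum_smul (c : PtRing) :
    edgeSum l w r (fun v => c • φ v) v = c • edgeSum l w r φ v := by
  rw [edgeSum, edgeSum, Finset.smul_sum]
  refine Finset.sum_congr rfl fun t _ => ?_
  split_ifs
  · rw [smul_comm]
  · simp

theorem edgeSum_neg : edgeSum l w r (fun v => -φ v) v = -edgeSum l w r φ v := by
  simpa using edgeSum_smul (l := l) (w := w) (r := r) (φ := φ) (v := v) (-1)

@[simp] theorem edgeSum_zero : edgeSum l w r (fun _ => 0) v = 0 := by simp [edgeSum]

theorem trunc_sgn (O : Set Pt) (t : ℕ) : trunc O (sgn v t) = sgn v t := by simp [sgn]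

theorem restr_edgeSum {O : Set Pt}
    (hO : ∀ t < w.length, ((w.getD t (0, true)).1, l + t) ∈ O ∧
      ((w.getD t (0, true)).1 + 1, l + t + 1) ∈ O) :
    restr O (edgeSum l w r φ v) = edgeSum l w r (fun v => restr O (φ v)) v := by
  rw [edgeSum, edgeSum, map_sum]
  refine Finset.sum_congr rfl fun t ht => ?_
  obtain ⟨h1, h2⟩ := hO t (Finset.mem_range.1 ht)
  split_ifs
  · rw [restr_smul]
    rw [map_mul, trunc_sgn, trunc_sad h1 h2]
  · simp

theorem edgeSum_append {A X : List (ℕ × Bool)} {u : List Bool} (h : v.length = A.length) :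
    edgeSum l (A ++ X) r φ (v ++ u) = edgeSum l A r (fun v => φ (v ++ u)) v +
      ((-1) ^ v.count true : PtRing) • edgeSum (l + A.length) X r (fun u => φ (v ++ u)) u := by
  rw [edgeSum, List.length_append, Finset.sum_range_add, edgeSum, edgeSum, Finset.smul_sum]
  congr 1
  · refine Finset.sum_congr rfl fun t ht => ?_
    have ht := Finset.mem_range.1 ht
    rw [List.getElem?_append_left (by omega), List.getD_append _ _ _ _ (by omega), sgn, sgn,
      List.take_append_of_le_length (by omega), List.set_append_left _ _ (by omega)]
  · refine Finset.sum_congr rfl fun t ht => ?_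
    rw [List.getElem?_append_right (by omega), List.getD_append_right _ _ _ _ (by omega), sgn, sgn,
      List.take_append, List.take_of_length_le (by omega), List.count_append,
      List.set_append_right _ _ (by omega), h, Nat.add_sub_cancel_left, pow_add]
    split_ifs
    · rw [smul_smul, mul_assoc, ← add_assoc]
    · simp

end edgeSum

theorem exists_append {v : List Bool} {m k : ℕ} (h : v.length = m + k) :
    ∃ v' u, v'.length = m ∧ u.length = k ∧ v = v' ++ u :=
  ⟨v.take m, v.drop m, by simp; omega, by simp; omega, (List.take_append_drop m v).symm⟩

/-- `Good` for a word that is divided into two parts. -/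
theorem good_append {n : ℕ} {A X : List (ℕ × Bool)} :
    Good n (A ++ X) ↔ ∃ Φ : List Bool → List Bool → Func,
      (∀ u v, u.length = X.length → v.length = A.length →
        Killed (rel (res A v ++ res X u)) (Φ u v)) ∧
      (∀ u v, u.length = X.length → v.length = A.length →
        edgeSum 0 A (rel (res A v ++ res X u)) (Φ u) v + ((-1) ^ v.count true : PtRing) •
          edgeSum A.length X (rel (res A v ++ res X u)) (fun u => Φ u v) u = 0) ∧
      IsUnit (Φ (orient X) (orient A) (∏ j ∈ Finset.range (n + 1), MvPolynomial.X (j, 0))) := by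
  constructor
  · rintro ⟨φ, h1, h2, h3⟩
    refine ⟨fun u v => φ (v ++ u), fun u v hu hv => ?_, fun u v hu hv => ?_, ?_⟩
    · rw [← res_append hv]
      exact h1 _ (by simp [hu, hv])
    · have := h2 (v ++ u) (by simp [hu, hv])
      rwa [edgeSum_append hv, res_append hv, zero_add] at this
    · simpa [orient] using h3
  · rintro ⟨Φ, h1, h2, h3⟩
    have key : ∀ u v, v.length = A.length →
        (fun V : List Bool => Φ (V.drop A.length) (V.take A.length)) (v ++ u) = Φ u v :=
      fun u v hv => by simp [← hv]
    refine ⟨fun V => Φ (V.drop A.length) (V.take A.length), fun V hV => ?_, fun V hV => ?_, ?_⟩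
    · obtain ⟨v, u, hv, hu, rfl⟩ := exists_append (hV.trans List.length_append)
      rw [key u v hv, res_append hv]
      exact h1 u v hu hv
    · obtain ⟨v, u, hv, hu, rfl⟩ := exists_append (hV.trans List.length_append)
      rw [edgeSum_append hv, res_append hv, zero_add, ← h2 u v hu hv]
      congr 1
      · exact edgeSum_congr (fun _ _ _ _ => Iff.rfl) fun t ht _ => key _ _ (by simp [hv])
      · congr 1
        exact edgeSum_congr (fun _ _ _ _ => Iff.rfl) fun t ht _ => key _ _ hv
    · have : orient (A ++ X) = orient A ++ orient X := by simp [orient]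
      rw [this]
      exact (congrArg (fun F : Func => IsUnit (F (∏ j ∈ Finset.range (n + 1),
        MvPolynomial.X (j, 0)))) (key (orient X) (orient A) (length_orient A))).mpr h3

/-! ### Families of functionals on the states of an open diagram -/

/-- The relation on the points of an open diagram `A` that is closed up after adding the resolved
crossings `tail`. -/
def St (A : List (ℕ × Bool)) (tail : List (Option ℕ)) (v : List Bool) : Pt → Pt → Prop :=
  onSet (Lev A.length) (rel (res A v ++ tail))

theorem st_equivalence (A : List (ℕ × Bool)) (tail : List (Option ℕ)) (v : List Bool) :
    Equivalence (St A tail v) := onSet_equivalence (rel_equivalence _)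

theorem edgeSum_st {A : List (ℕ × Bool)} {tail : List (Option ℕ)} {v v' : List Bool}
    {φ : List Bool → Func} :
    edgeSum 0 A (St A tail v') φ v = edgeSum 0 A (rel (res A v' ++ tail)) φ v :=
  edgeSum_congr (fun p q hp hq => onSet_iff (rel_equivalence _) (by simpa using hp)
    (by simpa using hq)) fun _ _ _ => rfl

theorem saddle_edge {A : List (ℕ × Bool)} (tail : List (Option ℕ)) {v : List Bool}
    (hv : v.length = A.length) {t : ℕ} (ht : t < A.length) (h : v[t]? = some false) :
    Saddle (rel (res A v ++ tail)) (rel (res A (v.set t true) ++ tail))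
      ((A.getD t (0, true)).1, t) ((A.getD t (0, true)).1 + 1, t + 1) := by
  have e1 : (res A v ++ tail)[t]? = some (resLetter A[t] false) := by
    rw [List.getElem?_append_left (by rw [length_res hv]; exact ht), res, List.getElem?_zipWith]
    simp [h, ht]
  have e2 : (res A (v.set t true) ++ tail)[t]? = some (resLetter A[t] true) := by
    rw [List.getElem?_append_left (by rw [length_res (by simpa using hv)]; exact ht), res,
      List.getElem?_zipWith]
    simp [ht, hv]
  have e3 : ∀ s, s ≠ t → (res A v ++ tail)[s]? = (res A (v.set t true) ++ tail)[s]? := by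
    intro s hs
    rw [List.getElem?_append, List.getElem?_append, length_res hv, length_res (by simpa using hv),
      res, res, List.getElem?_zipWith, List.getElem?_zipWith, List.getElem?_set_ne hs.symm]
  have e4 : (res A v ++ tail).length = (res A (v.set t true) ++ tail).length := by
    rw [List.length_append, List.length_append, length_res hv, length_res (by simpa using hv)]
  have e5 : A.getD t (0, true) = A[t] := by simp [ht]
  rw [e5]
  cases hb : A[t].2
  -- For a negative crossing the 0-resolution is the turn, so the edge is the saddle read backwards.
  · rw [resLetter, hb, if_pos rfl] at e1
    rw [resLetter, hb, if_neg (by simp)] at e2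
    exact (saddle_rel e4.symm e2 e1 fun s hs => (e3 s hs).symm).symm
  · rw [resLetter, hb, if_neg (by simp)] at e1
    rw [resLetter, hb, if_pos rfl] at e2
    exact saddle_rel e4 e1 e2 e3

theorem saddle_edge_st {A : List (ℕ × Bool)} (tail : List (Option ℕ)) {v : List Bool}
    (hv : v.length = A.length) {t : ℕ} (ht : t < A.length) (h : v[t]? = some false) :
    Saddle (St A tail v) (St A tail (v.set t true))
      ((A.getD t (0, true)).1, t) ((A.getD t (0, true)).1 + 1, t + 1) :=
  (saddle_edge tail hv ht h).onSet (rel_equivalence _) (rel_equivalence _) ht.le ht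

/-- The coboundary of a cochain is again a cochain. It can therefore be proved zero by testing it on
a small set of polynomials, as `good_append_of` permits. -/
theorem edgeSum_killed {A : List (ℕ × Bool)} {tail : List (Option ℕ)} {v : List Bool}
    {φ : List Bool → Func} (hv : v.length = A.length)
    (h : ∀ v : List Bool, v.length = A.length → Killed (rel (res A v ++ tail)) (φ v)) :
    Killed (rel (res A v ++ tail)) (edgeSum 0 A (rel (res A v ++ tail)) φ v) := by
  refine Killed.sum fun t ht => ?_
  split_ifs with hf
  · rw [mul_smul]
    refine Killed.smul _ ?_
    rw [zero_add]
    exact (h (v.set t true) (by simpa using hv)).sad_smul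
      (saddle_edge tail hv (Finset.mem_range.1 ht) hf) (rel_equivalence _)
  · exact Killed.zero

/-- Saddles away from `A` commute with the edges of the cube of `A`. -/
theorem edgeSum_sad {A : List (ℕ × Bool)} {tail tail' : List (Option ℕ)} {p q : Pt}
    {φ : List Bool → Func}
    (hs : ∀ v : List Bool, v.length = A.length → Saddle (St A tail v) (St A tail' v) p q)
    (h : ∀ v : List Bool, v.length = A.length → Killed (St A tail' v) (φ v))
    {v : List Bool} (hv : v.length = A.length) :
    edgeSum 0 A (St A tail v) (fun v => sad (St A tail v) p q • φ v) v =
      sad (St A tail v) p q • edgeSum 0 A (St A tail' v) φ v := by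
  rw [edgeSum, edgeSum, Finset.smul_sum]
  refine Finset.sum_congr rfl fun t ht => ?_
  split_ifs with hf
  · have ht := Finset.mem_range.1 ht
    have hv' : (v.set t true).length = A.length := by simpa using hv
    rw [zero_add, mul_smul, mul_smul, smul_comm (sad (St A tail v) p q) (sgn v t)]
    congr 1
    exact sad_square (st_equivalence _ _ _) (st_equivalence _ _ _) (st_equivalence _ _ _)
      (st_equivalence _ _ _) (saddle_edge_st tail hv ht hf) (hs _ hv') (hs _ hv)
      (saddle_edge_st tail' hv ht hf) (h _ hv')
  · simp

theorem restr_edgeSum_lev {A : List (ℕ × Bool)} {r : Pt → Pt → Prop} {φ : List Bool → Func}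
    {v : List Bool} : restr (Lev A.length) (edgeSum 0 A r φ v) =
      edgeSum 0 A r (fun v => restr (Lev A.length) (φ v)) v :=
  restr_edgeSum fun t ht => ⟨by simpa using ht.le, by simpa using ht⟩

/-! ### Changing the end of a word -/

theorem extd_apply_of_trunc {O : Set Pt} {r : Pt → Pt → Prop} (e : Equivalence r) (φ : Func)
    {b : PtRing} (hb : trunc O b = b) : extd O r φ b = φ b := by
  have := DFunLike.congr_fun (restr_extd (O := O) e φ) b
  rwa [restr_apply, restr_apply, hb] at this

theorem trunc_prod {O : Set Pt} {n : ℕ} (h : ∀ j < n, (j, 0) ∈ O) :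
    trunc O (∏ j ∈ Finset.range n, X (j, 0)) = ∏ j ∈ Finset.range n, X (j, 0) := by
  rw [map_prod]
  exact Finset.prod_congr rfl fun j hj => trunc_X (h j (Finset.mem_range.1 hj))

theorem Killed.onSet {O : Set Pt} {r : Pt → Pt → Prop} (e : Equivalence r) {φ : Func}
    (h : Killed r φ) : Killed (onSet O r) φ := h.mono (onSet_le e)

theorem Killed.st {A : List (ℕ × Bool)} {tail : List (Option ℕ)} {v : List Bool} {φ : Func}
    (h : Killed (rel (res A v ++ tail)) φ) : Killed (St A tail v) φ := h.onSet (rel_equivalence _)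

/-- The extension of a functional from the points of an open diagram to those of its closure. -/
noncomputable def ext (A : List (ℕ × Bool)) (tail : List (Option ℕ)) (v : List Bool) (φ : Func) :
    Func :=
  extd (Lev A.length) (rel (res A v ++ tail)) φ

theorem Killed.ext {A : List (ℕ × Bool)} {tail : List (Option ℕ)} {v : List Bool} {φ : Func}
    (h : Killed (St A tail v) φ) : Killed (rel (res A v ++ tail)) (ext A tail v φ) :=
  Killed.extd (rel_equivalence _) h

theorem restr_ext (A : List (ℕ × Bool)) (tail : List (Option ℕ)) (v : List Bool) (φ : Func) :
    restr (Lev A.length) (TransverseKhovanov.ext A tail v φ) = restr (Lev A.length) φ :=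
  restr_extd (rel_equivalence _) φ

theorem ext_apply_prod (A : List (ℕ × Bool)) (tail : List (Option ℕ)) (v : List Bool) (φ : Func)
    (n : ℕ) : TransverseKhovanov.ext A tail v φ (∏ j ∈ Finset.range n, X (j, 0)) =
      φ (∏ j ∈ Finset.range n, X (j, 0)) :=
  extd_apply_of_trunc (rel_equivalence _) φ (trunc_prod fun _ _ => Nat.zero_le _)

/-- A sufficient condition for `Good`: the cocycle condition may use that the values of the
coboundary are again killed. -/
theorem good_append_of {n : ℕ} {A X : List (ℕ × Bool)} (Φ : List Bool → List Bool → Func)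
    (h1 : ∀ u v, u.length = X.length → v.length = A.length →
      Killed (rel (res A v ++ res X u)) (Φ u v))
    (h2 : ∀ u v, u.length = X.length → v.length = A.length →
      ∀ F, F = edgeSum 0 A (rel (res A v ++ res X u)) (Φ u) v + ((-1) ^ v.count true : PtRing) •
        edgeSum A.length X (rel (res A v ++ res X u)) (fun u => Φ u v) u →
      Killed (rel (res A v ++ res X u)) F → F = 0)
    (h3 : IsUnit (Φ (orient X) (orient A) (∏ j ∈ Finset.range (n + 1), MvPolynomial.X (j, 0)))) :
    Good n (A ++ X) := by
  refine good_append.2 ⟨Φ, h1, fun u v hu hv => h2 u v hu hv _ rfl ?_, h3⟩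
  have key : ∀ u v : List Bool, v.length = A.length →
      Φ ((v ++ u).drop A.length) ((v ++ u).take A.length) = Φ u v :=
    fun u v hv => by simp [← hv]
  have H := edgeSum_killed (A := A ++ X) (tail := []) (v := v ++ u)
    (φ := fun V => Φ (V.drop A.length) (V.take A.length)) (by simp [hu, hv]) (by
      intro V hV
      obtain ⟨v, u, hv, hu, rfl⟩ := exists_append (hV.trans List.length_append)
      rw [List.append_nil, res_append hv, key u v hv]
      exact h1 u v hu hv)
  rw [List.append_nil, res_append hv, edgeSum_append hv, zero_add] at H
  convert H using 2
  · exact edgeSum_congr (fun _ _ _ _ => Iff.rfl) fun t ht _ => (key _ _ (by simp [hv])).symm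
  · congr 1
    exact edgeSum_congr (fun _ _ _ _ => Iff.rfl) fun t ht _ => (key _ _ hv).symm

theorem exists_outer (e : List (Option ℕ)) (z : Pt) : ∃ z' ∈ Lev e.length, rel e z z' := by
  by_cases h : z.2 ≤ e.length
  · exact ⟨z, h, (rel_equivalence _).refl z⟩
  · exact ⟨(z.1, 0), Nat.zero_le _, fun f hf => hf.2 z.1 z.2 (by omega)⟩

/-- Without a tail every point is related to one in `Lev A.length`, so functionals that are
controlled only there extend to the closed diagram and the cocycle condition survives. -/
theorem good_of_st {n : ℕ} {A : List (ℕ × Bool)} (φ : List Bool → Func)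
    (h1 : ∀ v : List Bool, v.length = A.length → Killed (St A [] v) (φ v))
    (h2 : ∀ v : List Bool, v.length = A.length → edgeSum 0 A (St A [] v) φ v = 0)
    (h3 : IsUnit (φ (orient A) (∏ j ∈ Finset.range (n + 1), X (j, 0)))) : Good n A := by
  refine ⟨fun v => ext A [] v (φ v), fun v hv => ?_, fun v hv => ?_, ?_⟩
  · simpa using (h1 v hv).ext
  · refine Killed.eq_zero_of_outer (O := Lev A.length) (r := rel (res A v ++ [])) ?_ ?_ ?_
    · have := edgeSum_killed (tail := []) hv (φ := fun v => ext A [] v (φ v))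
        fun v hv => (h1 v hv).ext
      simpa using this
    · have := exists_outer (res A v)
      rw [length_res hv] at this
      simpa using this
    · rw [restr_edgeSum_lev]
      simp only [restr_ext]
      rw [← restr_edgeSum_lev, ← List.append_nil (res A v), ← edgeSum_st, h2 v hv, map_zero]
  · rw [ext_apply_prod]
    exact h3

theorem length_one {u : List Bool} (h : u.length = 1) : ∃ a, u = [a] := List.length_eq_one_iff.1 h

theorem length_two {u : List Bool} (h : u.length = 2) : ∃ a b, u = [a, b] :=
  List.length_eq_two.1 h

theorem length_three {u : List Bool} (h : u.length = 3) : ∃ a b c, u = [a, b, c] :=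
  List.length_eq_three.1 h

theorem edgeSum_singleton (l : ℕ) (x : ℕ × Bool) (r : Pt → Pt → Prop) (Ψ : List Bool → Func)
    (a : Bool) : edgeSum l [x] r Ψ [a] =
      if a = false then sad r (x.1, l) (x.1 + 1, l + 1) • Ψ [true] else 0 := by
  simp [edgeSum, sgn]

theorem edgeSum_pair (l : ℕ) (x y : ℕ × Bool) (r : Pt → Pt → Prop) (Ψ : List Bool → Func)
    (a b : Bool) : edgeSum l [x, y] r Ψ [a, b] =
      (if a = false then sad r (x.1, l) (x.1 + 1, l + 1) • Ψ [true, b] else 0) +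
      if b = false then (if a then -1 else 1 : PtRing) •
        sad r (y.1, l + 1) (y.1 + 1, l + 2) • Ψ [a, true] else 0 := by
  cases a <;> cases b <;> simp [edgeSum, sgn, Finset.sum_range_succ]

theorem edgeSum_triple (l : ℕ) (x y z : ℕ × Bool) (r : Pt → Pt → Prop) (Ψ : List Bool → Func)
    (a b c : Bool) : edgeSum l [x, y, z] r Ψ [a, b, c] =
      (if a = false then sad r (x.1, l) (x.1 + 1, l + 1) • Ψ [true, b, c] else 0) +
      (if b = false then (if a then -1 else 1 : PtRing) •
        sad r (y.1, l + 1) (y.1 + 1, l + 2) • Ψ [a, true, c] else 0) +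
      if c = false then (if a = b then 1 else -1 : PtRing) •
        sad r (z.1, l + 2) (z.1 + 1, l + 3) • Ψ [a, b, true] else 0 := by
  cases a <;> cases b <;> cases c <;> simp [edgeSum, sgn, Finset.sum_range_succ]

/-- The 0-resolution of the new positive crossing is the old diagram, and the 1-resolutions span a
subcomplex. The cocycle is pulled back from the quotient, that is, extended by zero; the oriented
resolution lies over the 0-resolution, so the value on ψ is unchanged. -/
theorem good_append_positive {n : ℕ} {A : List (ℕ × Bool)} (i : ℕ) (h : Good n A) :
    Good n (A ++ [(i, true)]) := by
  obtain ⟨φ, h1, h2, h3⟩ := h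
  refine good_append_of (fun u v => if u = [false] then ext A [none] v (φ v) else 0) ?_ ?_ ?_
  · intro u v hu hv
    obtain ⟨a, rfl⟩ := length_one hu
    cases a
    · refine Killed.ext (tail := [none]) (Killed.st ?_)
      rw [rel_none]
      exact h1 v hv
    · exact Killed.zero
  · rintro u v hu hv F rfl hF
    obtain ⟨a, rfl⟩ := length_one hu
    cases a
    · have hrel : res A v ++ res [(i, true)] [false] = res A v ++ [none] := by simp [res, resLetter]
      rw [hrel] at hF ⊢
      refine hF.eq_zero_of_outer (O := Lev A.length) ?_ ?_
      · rw [rel_none, ← length_res hv]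
        exact exists_outer _
      · rw [map_add, restr_edgeSum_lev, edgeSum_singleton]
        simp only [if_true, restr_ext, List.cons.injEq, Bool.true_eq_false, false_and, if_false,
          smul_zero, map_zero, add_zero]
        rw [← restr_edgeSum_lev, rel_none, h2 v hv, map_zero]
    · simp [edgeSum_singleton]
  · simpa [orient, ext_apply_prod] using h3

/-- In the 0-resolution of the new crossing the string n + 1 is a separate circle. The new cocycle
is φ ⊗ u₋* there and zero on the 1-resolution; the factor X of the extra circle in ψ is matched by
u₋*. -/
theorem good_stabilize {n : ℕ} {A : List (ℕ × Bool)} (hA : ∀ x ∈ A, x.1 < n) (h : Good n A) :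
    Good (n + 1) (A ++ [(n, true)]) := by
  obtain ⟨φ, h1, h2, h3⟩ := h
  set O : Set Pt := {z | z.2 ≤ A.length ∧ z.1 ≠ n + 1}
  have hget : ∀ t < A.length, (A.getD t (0, true)).1 < n := by
    intro t ht
    rw [List.getD_eq_getElem _ _ ht]
    exact hA _ (List.getElem_mem ht)
  have hO : ∀ t < A.length, ((A.getD t (0, true)).1, 0 + t) ∈ O ∧
      ((A.getD t (0, true)).1 + 1, 0 + t + 1) ∈ O := by
    intro t ht
    have := hget t ht
    refine ⟨⟨?_, ?_⟩, ⟨?_, ?_⟩⟩ <;> dsimp only <;> omega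
  have hres : ∀ v (t i : ℕ), (res A v)[t]? = some (some i) → i < n := by
    intro v t i ht
    rw [res, List.getElem?_zipWith] at ht
    split at ht
    · rename_i x b hx hb
      simp only [resLetter, Option.some.injEq, ite_eq_iff, reduceCtorEq, and_false, or_false] at ht
      exact ht.2 ▸ hA x (List.mem_of_getElem? hx)
    · simp at ht
  -- The letters of `A` only touch strings up to n, so the string n + 1 is its own circle; it is the
  -- test predicate.
  have hinner : ∀ v, Inner O (rel (res A v)) (n + 1, 0) := by
    rintro v ⟨z, hz, hr⟩
    refine hz.2 ((hr (fun z => z.1 = n + 1) ⟨fun t o ho => ?_, fun j s hs => Iff.rfl⟩).1 rfl)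
    cases o with
    | none => exact fun j => Iff.rfl
    | some i =>
      have := hres v t i ho
      refine ⟨?_, ?_, fun j _ _ => Iff.rfl⟩ <;> dsimp only <;> omega
  have hstring : ∀ v : List Bool, v.length = A.length → ∀ s, rel (res A v) (n + 1, s) (n + 1, 0) :=
      by
    intro v hv s f hf
    induction s with
    | zero => rfl
    | succ s ih =>
      rw [← ih]
      rcases lt_or_ge s A.length with hs | hs
      · rcases ho : (res A v)[s]? with _ | o
        · simp [length_res hv] at ho
          omega
        · have := hf.1 s o ho
          cases o with
          | none => exact (this _).symm
          | some i =>
            have := hres v s i ho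
            exact (‹Step s f (some i)›.2.2 (n + 1) (by omega) (by omega)).symm
      · rw [hf.2 _ s (by rw [length_res hv]; exact hs), hf.2 _ (s + 1) (by rw [length_res hv]; omega)]
  refine good_append_of (fun u v => if u = [false] then circ O (rel (res A v)) (φ v) else 0) ?_ ?_
      ?_
  · intro u v hu hv
    obtain ⟨a, rfl⟩ := length_one hu
    cases a
    · have : res A v ++ res [(n, true)] [false] = res A v ++ [none] := by simp [res, resLetter]
      rw [this, rel_none]
      exact ((h1 v hv).onSet (rel_equivalence _)).circ (rel_equivalence _)
    · exact Killed.zero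
  · rintro u v hu hv F rfl hF
    obtain ⟨a, rfl⟩ := length_one hu
    cases a
    · have : res A v ++ res [(n, true)] [false] = res A v ++ [none] := by simp [res, resLetter]
      rw [this, rel_none] at hF ⊢
      refine hF.eq_zero (O := O) (n + 1, 0) ?_ ?_ ?_
      · rintro ⟨j, s⟩
        by_cases hj : j = n + 1
        · subst hj
          exact Or.inr (hstring v hv s)
        · left
          by_cases hs : s ≤ A.length
          · exact ⟨(j, s), ⟨hs, hj⟩, (rel_equivalence _).refl _⟩
          · exact ⟨(j, 0), ⟨Nat.zero_le _, hj⟩, fun f hf => hf.2 j s (by rw [length_res hv]; omega)⟩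
      · rw [map_add, restr_edgeSum hO, edgeSum_singleton]
        simp [restr_circ (rel_equivalence _)]
      · rw [smul_add, map_add, ← edgeSum_smul, edgeSum_singleton]
        simp only [if_true, List.cons.injEq, Bool.true_eq_false, false_and, if_false,
          smul_zero, map_zero, add_zero, smul_circ_of_inner (hinner _)]
        rw [restr_edgeSum hO]
        simp only [restr_extd (rel_equivalence _)]
        rw [← restr_edgeSum hO, h2 v hv, map_zero]
    · simp [edgeSum_singleton]
  · have : orient [(n, true)] = [false] := rfl
    rw [this, if_pos rfl, Finset.prod_range_succ, mul_comm, ← Func.smul_apply,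
      smul_circ_of_inner (hinner _), extd_apply_of_trunc (rel_equivalence _)]
    · exact h3
    · exact trunc_prod fun j hj => ⟨Nat.zero_le _, by dsimp only; omega⟩

/-- Multiplication by X_{n+1} - X_n kills the functionals of the 1-resolution, where the two strings
are joined, and so removes that term from the cocycle condition. On ψ the factor X_{n+1} restores
the product over all strings, and X_n produces a square. -/
theorem good_of_stabilize {n : ℕ} {A : List (ℕ × Bool)} (h : Good (n + 1) (A ++ [(n, true)])) :
    Good n A := by
  obtain ⟨Φ, h1, h2, h3⟩ := good_append.1 h
  have e0 : ∀ v, res A v ++ res [(n, true)] [false] = res A v ++ [none] := by simp [res, resLetter]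
  have e1 : ∀ v, res A v ++ res [(n, true)] [true] = res A v ++ [some n] := by simp [res, resLetter]
  have hk : ∀ v : List Bool, v.length = A.length → Killed (rel (res A v)) (Φ [false] v) := by
    intro v hv
    have := h1 [false] v rfl hv
    rwa [e0, rel_none] at this
  refine ⟨fun v => (X (n + 1, 0) - X (n, 0) : PtRing) • Φ [false] v, fun v hv => (hk v hv).smul _,
    fun v hv => ?_, ?_⟩
  · have H := h2 [false] v rfl hv
    have hk1 : (X (n + 1, 0) - X (n, 0) : PtRing) • Φ [true] v = 0 := by
      have := h1 [true] v rfl hv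
      rw [e1] at this
      rw [sub_smul, sub_eq_zero]
      refine this.eq _ _ fun f hf => ?_
      rw [resp_snoc] at hf
      rw [← hf.2.2 n _ le_rfl, ← hf.2.2 (n + 1) _ le_rfl]
      exact hf.2.1.2.1.symm
    rw [e0, rel_none, edgeSum_singleton] at H
    have := congrArg (fun F => (X (n + 1, 0) - X (n, 0) : PtRing) • F) H
    simp only [if_true, smul_add, smul_zero] at this
    rw [edgeSum_smul, ← this, smul_comm _ ((-1) ^ v.count true : PtRing), smul_comm _ (sad _ _ _),
        hk1]
    simp
  · have hsq := (hk (orient A) (length_orient A)).sq (n, 0)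
    have : Φ [false] (orient A) (X (n, 0) * ∏ j ∈ Finset.range (n + 1), X (j, 0)) = 0 := by
      rw [Finset.prod_range_succ]
      have := DFunLike.congr_fun hsq (∏ j ∈ Finset.range n, X (j, 0))
      simpa [mul_comm, mul_left_comm] using this
    have h3' : IsUnit (Φ [false] (orient A) (∏ j ∈ Finset.range (n + 1 + 1), X (j, 0))) := h3
    rw [Finset.prod_range_succ, mul_comm] at h3'
    rw [Func.smul_apply, sub_mul, map_sub, this, sub_zero]
    exact h3'

/-! ### Commutation of distant crossings -/

theorem resp_one {e : List (Option ℕ)} {l : ℕ} (hl : e.length = l) {a : Option ℕ} {f : Pt → Prop} :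
    Resp (e ++ [a]) f ↔ OpenResp e f ∧ Step l f a ∧ ∀ j s, l + 1 ≤ s → (f (j, s) ↔ f (j, 0)) := by
  subst hl
  exact resp_snoc

theorem resp_two {e : List (Option ℕ)} {l : ℕ} (hl : e.length = l) {a b : Option ℕ} {f : Pt → Prop}
    :
    Resp (e ++ [a, b]) f ↔ OpenResp e f ∧ Step l f a ∧ Step (l + 1) f b ∧
      ∀ j s, l + 2 ≤ s → (f (j, s) ↔ f (j, 0)) := by
  subst hl
  rw [← resp_snoc₂, List.append_assoc]
  rfl

theorem resp_three {e : List (Option ℕ)} {l : ℕ} (hl : e.length = l) {a b c : Option ℕ}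
    {f : Pt → Prop} :
    Resp (e ++ [a, b, c]) f ↔ OpenResp e f ∧ Step l f a ∧ Step (l + 1) f b ∧ Step (l + 2) f c ∧
      ∀ j s, l + 3 ≤ s → (f (j, s) ↔ f (j, 0)) := by
  subst hl
  rw [← resp_snoc₃, List.append_assoc, List.append_assoc]
  rfl

section

variable {A : List (ℕ × Bool)} {v : List Bool} (hv : v.length = A.length)

include hv in
theorem st_eq {tail tail' : List (Option ℕ)}
    (h : ∀ e : List (Option ℕ), onSet (Lev e.length) (rel (e ++ tail)) =
      onSet (Lev e.length) (rel (e ++ tail'))) : St A tail v = St A tail' v := by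
  have := h (res A v)
  rwa [length_res hv] at this

theorem st_none : St A [none] v = St A [] v := by
  rw [St, St, rel_none, List.append_nil]

theorem st_snoc_none (o : Option ℕ) : St A [o, none] v = St A [o] v := by
  rw [St, St, List.append_cons, rel_none]

theorem st_snoc_none₂ (o o' : Option ℕ) : St A [o, o', none] v = St A [o, o'] v := by
  rw [St, St, List.append_cons, List.append_cons, rel_none, List.append_assoc]
  rfl

include hv in
theorem st_none_cons (o : Option ℕ) : St A [none, o] v = St A [o] v :=
  st_eq hv fun e => by simpa using rel_none_some e o

include hv in
theorem st_none_cons₂ (o o' : Option ℕ) : St A [none, o, o'] v = St A [o, o'] v :=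
  st_eq hv fun e => by simpa using rel_none_some₂ e o o'

include hv in
theorem st_turn_turn (i : ℕ) : St A [some i, some i] v = St A [some i] v :=
  st_eq hv fun e => by simpa using rel_turn_turn e i

include hv in
theorem st_turn_none_turn (i : ℕ) : St A [some i, none, some i] v = St A [some i] v := by
  rw [← st_turn_turn hv]
  refine st_eq hv fun e => onSet_mono (O' := Lev (e ++ [some i]).length) (fun z hz => ?_) ?_
  · simp only [mem_lev, List.length_append] at hz ⊢
    omega
  · simpa using rel_none_some (e ++ [some i]) (some i)

include hv in
theorem st_turn_turn_turn {i j : ℕ} (hij : i + 1 = j ∨ j + 1 = i) :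
    St A [some i, some j, some i] v = St A [some i] v :=
  st_eq hv fun e => by simpa using rel_turn_turn_turn e hij

include hv in
theorem st_far_comm {i j : ℕ} (hij : i + 1 < j ∨ j + 1 < i) :
    St A [some i, some j] v = St A [some j, some i] v :=
  st_eq hv fun e => by simpa using rel_far_comm e hij

/-- The ends of a saddle slide along arcs to points of the open diagram `A`, which are common to all
tails. The slide must be possible in `tail`, which determines the scalar, and in `tail'`, whose
functional it acts on. -/
theorem sad_smul_outer {tail tail' : List (Option ℕ)} {p q p' q' : Pt} {F : Func}
    (hF : Killed (rel (res A v ++ tail')) F)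
    (hp : rel (res A v ++ tail) p p') (hq : rel (res A v ++ tail) q q')
    (hp2 : rel (res A v ++ tail') p p') (hq2 : rel (res A v ++ tail') q q')
    (hp' : p'.2 ≤ A.length) (hq' : q'.2 ≤ A.length) :
    sad (rel (res A v ++ tail)) p q • F = sad (St A tail v) p' q' • F := by
  rw [sad_smul_congr (rel_equivalence _) hp hq hp2 hq2 hF]
  congr 1
  exact sad_congr (onSet_iff (rel_equivalence _) hp' hq').symm

theorem restr_sad {r : Pt → Pt → Prop} {p q : Pt} (hp : p.2 ≤ A.length) (hq : q.2 ≤ A.length)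
    (F : Func) : restr (Lev A.length) (sad r p q • F) = sad r p q • restr (Lev A.length) F :=
  restr_smul (trunc_sad hp hq r) F

theorem restr_neg_one_pow (O : Set Pt) (k : ℕ) (F : Func) :
    restr O (((-1) ^ k : PtRing) • F) = ((-1) ^ k : PtRing) • restr O F :=
  restr_smul (by simp) F

end

/-- Only two equal turns enclose a circle that misses the levels up to `l`; this case is excluded.
-/
theorem exists_outer_two {e : List (Option ℕ)} {l : ℕ} (hl : e.length = l) {a b : Option ℕ}
    (h : a = none ∨ b = none ∨ ∃ i j, a = some i ∧ b = some j ∧ i ≠ j) (z : Pt) :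
    ∃ z' ∈ Lev l, rel (e ++ [a, b]) z z' := by
  obtain ⟨k, s⟩ := z
  rcases le_or_gt s l with hs | hs
  · exact ⟨(k, s), hs, (rel_equivalence _).refl _⟩
  rcases eq_or_ne s (l + 1) with rfl | hs'
  · have top : ∀ k', rel (e ++ [a, b]) (k, l + 1) (k', l + 2) →
        ∃ z' ∈ Lev l, rel (e ++ [a, b]) (k, l + 1) z' := fun k' h =>
      ⟨(k', 0), Nat.zero_le _, fun f hf => (h f hf).trans (((resp_two hl).1 hf).2.2.2 k' _ le_rfl)⟩
    have bot : ∀ k', rel (e ++ [a, b]) (k, l + 1) (k', l) →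
        ∃ z' ∈ Lev l, rel (e ++ [a, b]) (k, l + 1) z' := fun k' h => ⟨(k', l), le_refl l, h⟩
    rcases h with rfl | rfl | ⟨i, j, rfl, rfl, hij⟩
    · exact bot k fun f hf => (((resp_two hl).1 hf).2.1 k).symm
    · exact top k fun f hf => (((resp_two hl).1 hf).2.2.1 k)
    · by_cases hk : k = i ∨ k = i + 1
      · by_cases hk' : k = j ∨ k = j + 1
        · refine top (if k = i then i + 1 else i) fun f hf => ?_
          obtain ⟨-, h1, h2, h3⟩ := (resp_two hl).1 hf
          simp only [Step] at h1 h2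
          grind
        · refine top k fun f hf => ?_
          obtain ⟨-, h1, h2, h3⟩ := (resp_two hl).1 hf
          simp only [Step] at h1 h2
          grind
      · refine bot k fun f hf => ?_
        obtain ⟨-, h1, h2, h3⟩ := (resp_two hl).1 hf
        simp only [Step] at h1 h2
        grind
  · exact ⟨(k, 0), Nat.zero_le _, fun f hf => ((resp_two hl).1 hf).2.2.2 k s (by omega)⟩

/-- The possible resolutions of a positive crossing. -/
theorem resLetter_cases (x : ℕ × Bool) (b : Bool) :
    resLetter x b = none ∨ resLetter x b = some x.1 := by
  unfold resLetter
  split_ifs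
  exacts [Or.inr rfl, Or.inl rfl]

/-- The two cubes differ by exchanging their last two directions, and corresponding states have the
same circles on the points of `A`. Only the edge signs need a correction. -/
theorem good_far_comm {n : ℕ} {A : List (ℕ × Bool)} {x y : ℕ × Bool}
    (hxy : x.1 + 1 < y.1 ∨ y.1 + 1 < x.1) (h : Good n (A ++ [x, y])) : Good n (A ++ [y, x]) := by
  obtain ⟨Φ, h1, h2, h3⟩ := good_append.1 h
  have hst : ∀ a b v, v.length = A.length → St A (res [y, x] [b, a]) v = St A (res [x, y] [a, b]) v
      := by
    intro a b v hv
    simp only [res, List.zipWith_cons_cons, List.zipWith_nil_left]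
    rcases resLetter_cases x a with ha | ha <;> rcases resLetter_cases y b with hb | hb <;>
      rw [ha, hb]
    · rw [st_none_cons hv, st_snoc_none]
    · rw [st_none_cons hv, st_snoc_none]
    · exact (st_far_comm hv hxy).symm
  -- These relations slide the ends of both saddles to levels 0 and `A.length`, where the two orders
  -- of the crossings can be compared.
  have hr1 : ∀ a b v, v.length = A.length → ∀ k, k = y.1 ∨ k = y.1 + 1 →
      rel (res A v ++ res [x, y] [a, b]) (k, A.length + 1) (k, A.length) ∧
      rel (res A v ++ res [x, y] [a, b]) (k, A.length + 2) (k, 0) := by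
    intro a b v hv k hk
    constructor <;> intro f hf <;> obtain ⟨-, hs1, hs2, hs3⟩ := (resp_two (length_res hv)).1 hf
    · rcases resLetter_cases x a with ha | ha <;> rw [ha] at hs1 <;> simp only [Step] at hs1 <;>
          grind
    · exact hs3 k _ le_rfl
  have hr2 : ∀ a b v, v.length = A.length → ∀ k, k = x.1 ∨ k = x.1 + 1 →
      rel (res A v ++ res [x, y] [a, b]) (k, A.length + 1) (k, 0) := by
    intro a b v hv k hk f hf
    obtain ⟨-, hs1, hs2, hs3⟩ := (resp_two (length_res hv)).1 hf
    rw [← hs3 k _ le_rfl]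
    rcases resLetter_cases y b with ha | ha <;> rw [ha] at hs2 <;> simp only [Step] at hs2 <;> grind
  have hr1' : ∀ a b v, v.length = A.length → ∀ k, k = x.1 ∨ k = x.1 + 1 →
      rel (res A v ++ res [y, x] [b, a]) (k, A.length + 1) (k, A.length) ∧
      rel (res A v ++ res [y, x] [b, a]) (k, A.length + 2) (k, 0) := by
    intro a b v hv k hk
    constructor <;> intro f hf <;> obtain ⟨-, hs1, hs2, hs3⟩ := (resp_two (length_res hv)).1 hf
    · rcases resLetter_cases y b with ha | ha <;> rw [ha] at hs1 <;> simp only [Step] at hs1 <;>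
          grind
    · exact hs3 k _ le_rfl
  have hr2' : ∀ a b v, v.length = A.length → ∀ k, k = y.1 ∨ k = y.1 + 1 →
      rel (res A v ++ res [y, x] [b, a]) (k, A.length + 1) (k, 0) := by
    intro a b v hv k hk f hf
    obtain ⟨-, hs1, hs2, hs3⟩ := (resp_two (length_res hv)).1 hf
    rw [← hs3 k _ le_rfl]
    rcases resLetter_cases x a with ha | ha <;> rw [ha] at hs2 <;> simp only [Step] at hs2 <;> grind
  -- The two edges into the vertex [true, true] carry opposite signs, which are exchanged with the
  -- directions; the sign at that vertex compensates this.
  set Ψ : List Bool → List Bool → Func := fun u v =>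
    (if u = [true, true] then -1 else 1 : PtRing) • ext A (res [y, x] u) v (Φ u.reverse v) with hΨ
  have hΨk : ∀ u v, u.length = [y, x].length → v.length = A.length →
      Killed (rel (res A v ++ res [y, x] u)) (Ψ u v) := by
    intro u v hu hv
    obtain ⟨b, a, rfl⟩ := length_two hu
    refine Killed.smul _ (Killed.ext ?_)
    rw [hst a b v hv]
    exact (h1 [a, b] v rfl hv).st
  refine good_append_of Ψ hΨk ?_ ?_
  · rintro u v hu hv F rfl hF
    obtain ⟨b, a, rfl⟩ := length_two hu
    refine hF.eq_zero_of_outer (O := Lev A.length) ?_ ?_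
    · refine exists_outer_two (length_res hv) ?_
      rcases resLetter_cases x a with ha | ha <;> rcases resLetter_cases y b with hb | hb <;>
        rw [ha, hb] <;> simp
      omega
    · have H := h2 [a, b] v rfl hv
      rw [← edgeSum_st, edgeSum_pair] at H
      rw [← edgeSum_st, edgeSum_pair, map_add, restr_edgeSum_lev, restr_neg_one_pow, map_add,
        hst a b v hv]
      have k1 := h1 [true, b] v rfl hv
      have k2 := h1 [a, true] v rfl hv
      have k1' := hΨk [b, true] v rfl hv
      have k2' := hΨk [true, a] v rfl hv
      have E := rel_equivalence
      rw [sad_smul_outer (p' := (x.1, A.length)) (q' := (x.1 + 1, 0)) k1 ((E _).refl _)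
        (hr2 a b v hv _ (Or.inr rfl)) ((E _).refl _) (hr2 true b v hv _ (Or.inr rfl)) le_rfl
        (Nat.zero_le _), sad_smul_outer (p' := (y.1, A.length)) (q' := (y.1 + 1, 0)) k2
        (hr1 a b v hv _ (Or.inl rfl)).1 (hr1 a b v hv _ (Or.inr rfl)).2
        (hr1 a true v hv _ (Or.inl rfl)).1 (hr1 a true v hv _ (Or.inr rfl)).2 le_rfl
        (Nat.zero_le _)] at H
      rw [sad_smul_outer (p' := (y.1, A.length)) (q' := (y.1 + 1, 0)) k2' ((E _).refl _)
        (hr2' a b v hv _ (Or.inr rfl)) ((E _).refl _) (hr2' a true v hv _ (Or.inr rfl)) le_rfl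
        (Nat.zero_le _), sad_smul_outer (p' := (x.1, A.length)) (q' := (x.1 + 1, 0)) k1'
        (hr1' a b v hv _ (Or.inl rfl)).1 (hr1' a b v hv _ (Or.inr rfl)).2
        (hr1' true b v hv _ (Or.inl rfl)).1 (hr1' true b v hv _ (Or.inr rfl)).2 le_rfl
        (Nat.zero_le _), hst a b v hv]
      have H' := congrArg (restr (Lev A.length)) H
      rw [map_add, restr_edgeSum_lev, restr_neg_one_pow, map_add, map_zero] at H'
      cases a <;> cases b <;>
      simp [hΨ, restr_sad, restr_ext, edgeSum_neg] at H' ⊢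
      · rw [← H']
        congr 1
        exact add_comm _ _
      · exact H'
      · exact H'
      · exact H'
  · simp only [hΨ]
    have : orient [y, x] = (orient [x, y]).reverse := by simp [orient]
    rw [Func.smul_apply, this, List.reverse_reverse]
    split_ifs
    · rw [neg_one_mul, map_neg, ext_apply_prod, IsUnit.neg_iff]
      exact h3
    · rw [one_mul, ext_apply_prod]
      exact h3

/-! ### Cancellation of a crossing with its inverse -/

theorem Join.congr {r : Pt → Pt → Prop} (e : Equivalence r) {p q p' q' : Pt} (hp : r p p')
    (hq : r q q') (x y : Pt) : Join r p q x y ↔ Join r p' q' x y := by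
  have h1 : r x p ↔ r x p' := ⟨fun h => e.trans h hp, fun h => e.trans h (e.symm hp)⟩
  have h2 : r x q ↔ r x q' := ⟨fun h => e.trans h hq, fun h => e.trans h (e.symm hq)⟩
  have h3 : r p y ↔ r p' y := ⟨fun h => e.trans (e.symm hp) h, fun h => e.trans hp h⟩
  have h4 : r q y ↔ r q' y := ⟨fun h => e.trans (e.symm hq) h, fun h => e.trans hq h⟩
  rw [Join, Join, h1, h2, h3, h4]

theorem Saddle.congr {r r' : Pt → Pt → Prop} {p q p' q' : Pt} (e : Equivalence r)
    (e' : Equivalence r') (hp : r p p') (hq : r q q') (hp' : r' p p') (hq' : r' q q')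
    (h : Saddle r r' p q) : Saddle r r' p' q' := by
  rcases h with ⟨h1, h2⟩ | ⟨h1, h2⟩
  · exact Or.inl ⟨fun h => h1 (e.trans hp (e.trans h (e.symm hq))),
      fun x y => (h2 x y).trans (Join.congr e hp hq x y)⟩
  · exact Or.inr ⟨fun h => h1 (e'.trans hp' (e'.trans h (e'.symm hq'))),
      fun x y => (h2 x y).trans (Join.congr e' hp' hq' x y)⟩

/-- A saddle at the crossing `k` of the tail. -/
theorem saddle_tail {A : List (ℕ × Bool)} {v : List Bool} (hv : v.length = A.length)
    {tail tail' : List (Option ℕ)} {k i : ℕ} (hlen : tail.length = tail'.length)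
    (hk : tail[k]? = some none) (hk' : tail'[k]? = some (some i))
    (hne : ∀ s, s ≠ k → tail[s]? = tail'[s]?) :
    Saddle (rel (res A v ++ tail)) (rel (res A v ++ tail')) (i, A.length + k)
      (i + 1, A.length + k + 1) := by
  have key : ∀ (s : ℕ) (tail : List (Option ℕ)), (res A v ++ tail)[A.length + s]? = tail[s]? := by
    intro s tail
    rw [List.getElem?_append_right (by rw [length_res hv]; omega), length_res hv,
      Nat.add_sub_cancel_left]
  refine saddle_rel (by simp [hlen]) ?_ ?_ ?_
  · rw [key, hk]
  · rw [key, hk']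
  · intro s hs
    rcases lt_or_ge s A.length with h | h
    · rw [List.getElem?_append_left (by rw [length_res hv]; exact h),
        List.getElem?_append_left (by rw [length_res hv]; exact h)]
    · obtain ⟨s, rfl⟩ := Nat.exists_eq_add_of_le h
      rw [key, key]
      exact hne s fun h => hs (by rw [h])

theorem saddle_st {A : List (ℕ × Bool)} {v : List Bool} (hv : v.length = A.length)
    {tail tail' : List (Option ℕ)} {k i : ℕ} {p' q' : Pt} (hlen : tail.length = tail'.length)
    (hk : tail[k]? = some none) (hk' : tail'[k]? = some (some i))
    (hne : ∀ s, s ≠ k → tail[s]? = tail'[s]?)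
    (hp1 : rel (res A v ++ tail) (i, A.length + k) p')
    (hq1 : rel (res A v ++ tail) (i + 1, A.length + k + 1) q')
    (hp2 : rel (res A v ++ tail') (i, A.length + k) p')
    (hq2 : rel (res A v ++ tail') (i + 1, A.length + k + 1) q')
    (hp' : p'.2 ≤ A.length) (hq' : q'.2 ≤ A.length) : Saddle (St A tail v) (St A tail' v) p' q' :=
  Saddle.onSet (rel_equivalence _) (rel_equivalence _) hp' hq' (Saddle.congr (rel_equivalence _)
    (rel_equivalence _) hp1 hq1 hp2 hq2 (saddle_tail hv hlen hk hk' hne))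

theorem saddle_st_one {A : List (ℕ × Bool)} {v : List Bool} (hv : v.length = A.length) (i : ℕ) :
    Saddle (St A [] v) (St A [some i] v) (i, A.length) (i + 1, 0) := by
  have hcl : ∀ a, rel (res A v ++ [a]) (i + 1, A.length + 1) (i + 1, 0) := fun a f hf =>
    ((resp_one (length_res hv)).1 hf).2.2 _ _ le_rfl
  rw [← st_none]
  refine saddle_st hv (k := 0) (i := i) rfl rfl rfl (fun s hs => ?_) ((rel_equivalence _).refl _)
    (hcl _) ((rel_equivalence _).refl _) (hcl _) le_rfl (Nat.zero_le _)
  obtain ⟨s, rfl⟩ : ∃ k, s = k + 1 := ⟨s - 1, by omega⟩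
  rfl

/-- The extension of a functional that takes the coefficient of the variable of an inner circle. -/
noncomputable def cir (A : List (ℕ × Bool)) (tail : List (Option ℕ)) (v : List Bool) (φ : Func) :
    Func :=
  circ (Lev A.length) (rel (res A v ++ tail)) φ

theorem Killed.cir {A : List (ℕ × Bool)} {tail : List (Option ℕ)} {v : List Bool} {φ : Func}
    (h : Killed (St A tail v) φ) : Killed (rel (res A v ++ tail)) (cir A tail v φ) :=
  Killed.circ (rel_equivalence _) h

theorem restr_cir (A : List (ℕ × Bool)) (tail : List (Option ℕ)) (v : List Bool) (φ : Func) :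
    restr (Lev A.length) (TransverseKhovanov.cir A tail v φ) = 0 :=
  restr_circ (rel_equivalence _) φ

theorem restr_smul_cir_of_inner {A : List (ℕ × Bool)} {tail : List (Option ℕ)} {v : List Bool} {c :
    Pt}
    (hc : Inner (Lev A.length) (rel (res A v ++ tail)) c) (φ : Func) :
    restr (Lev A.length) ((X c : PtRing) • cir A tail v φ) = restr (Lev A.length) φ := by
  rw [cir, smul_circ_of_inner hc, restr_extd (rel_equivalence _)]

theorem restr_smul_cir_of_mem {A : List (ℕ × Bool)} {tail : List (Option ℕ)} {v : List Bool} {c :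
    Pt}
    (hc : c.2 ≤ A.length) (φ : Func) :
    restr (Lev A.length) ((X c : PtRing) • cir A tail v φ) = 0 := by
  rw [restr_smul (trunc_X hc), restr_cir, smul_zero]

section

variable {A : List (ℕ × Bool)} {v : List Bool}

theorem inner_turn_turn (hv : v.length = A.length) (i : ℕ) :
    Inner (Lev A.length) (rel (res A v ++ [some i, some i])) (i, A.length + 1) := by
  rintro ⟨z, hz, hr⟩
  have := hr (fun z => z.2 = A.length + 1 ∧ (z.1 = i ∨ z.1 = i + 1)) ?_
  · simp only [mem_lev] at hz
    simp only [true_or, and_self, true_iff] at this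
    omega
  · rw [resp_two (length_res hv)]
    refine ⟨?_, ?_, ?_, fun j s hs => ?_⟩
    · intro t o ho
      have ht : t < A.length := by rw [← length_res hv]; exact (List.getElem?_eq_some_iff.1 ho).1
      cases o <;> simp only [Step] <;> grind
    · simp only [Step]; grind
    · simp only [Step]; grind
    · dsimp only; omega

/-- The cocycle condition for functionals that take the coefficient of an inner variable. -/
theorem edgeSum_cir {tail : List (Option ℕ)} {χ : List Bool → Func} {c : Pt} (hv : v.length =
    A.length)
    (hF : Killed (rel (res A v ++ tail)) (edgeSum 0 A (St A tail v) (fun v => cir A tail v (χ v))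
        v))
    (hc : ∀ z, (∃ z' ∈ Lev A.length, rel (res A v ++ tail) z z') ∨ rel (res A v ++ tail) z c)
    (hin : ∀ v : List Bool, v.length = A.length → Inner (Lev A.length) (rel (res A v ++ tail)) c)
    (h : edgeSum 0 A (St A tail v) χ v = 0) :
    edgeSum 0 A (St A tail v) (fun v => cir A tail v (χ v)) v = 0 := by
  refine hF.eq_zero (O := Lev A.length) c hc ?_ ?_
  · rw [restr_edgeSum_lev]
    simp only [restr_cir, edgeSum_zero]
  · rw [← edgeSum_smul, restr_edgeSum_lev,
      edgeSum_congr (φ := fun v => restr (Lev A.length) ((X c : PtRing) • cir A tail v (χ v)))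
        (ψ := fun v => restr (Lev A.length) (χ v)) (r' := St A tail v) (fun _ _ _ _ => Iff.rfl)
        (fun t ht _ => restr_smul_cir_of_inner (hin _ (by simpa using hv)) _),
      ← restr_edgeSum_lev, h, map_zero]

theorem outer_or_turn_turn (hv : v.length = A.length) (i : ℕ) (z : Pt) :
    (∃ z' ∈ Lev A.length, rel (res A v ++ [some i, some i]) z z') ∨
      rel (res A v ++ [some i, some i]) z (i, A.length + 1) := by
  obtain ⟨k, s⟩ := z
  rcases le_or_gt s A.length with hs | hs
  · exact Or.inl ⟨(k, s), hs, (rel_equivalence _).refl _⟩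
  rcases eq_or_ne s (A.length + 1) with rfl | hs'
  · by_cases hk : k = i ∨ k = i + 1
    · right
      intro f hf
      obtain ⟨-, hs1, -⟩ := (resp_two (length_res hv)).1 hf
      simp only [Step] at hs1
      grind
    · refine Or.inl ⟨(k, A.length), le_refl A.length, fun f hf => ?_⟩
      obtain ⟨-, hs1, -⟩ := (resp_two (length_res hv)).1 hf
      simp only [Step] at hs1
      grind
  · exact Or.inl ⟨(k, 0), Nat.zero_le _, fun f hf =>
      ((resp_two (length_res hv)).1 hf).2.2.2 k s (by omega)⟩

-- Second Reidemeister move. The state `[!ε, ε]` has parallel strings and `[ε, !ε]` has two turns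
-- enclosing a circle. The cocycle is φ on the first, -χ ⊗ u₋* on the second, with χ the pull-back
-- of φ along the saddle, and zero on the other two states.
set_option maxHeartbeats 400000 in
theorem good_insert {n : ℕ} (i : ℕ) (ε : Bool) (h : Good n A) : Good n (A ++ [(i, ε), (i, !ε)]) :=
    by
  obtain ⟨φ, h1, h2, h3⟩ := h
  have hφ : ∀ v : List Bool, v.length = A.length → Killed (St A [] v) (φ v) := fun v hv =>
    Killed.st (by rw [List.append_nil]; exact h1 v hv)
  obtain ⟨χ, hχ⟩ : ∃ χ : List Bool → Func, χ = fun v =>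
      sad (St A [some i] v) (i, A.length) (i + 1, 0) • φ v := ⟨_, rfl⟩
  have hs : ∀ v : List Bool, v.length = A.length →
      Saddle (St A [some i] v) (St A [] v) (i, A.length) (i + 1, 0) :=
    fun v hv => (saddle_st_one hv i).symm
  have hχk : ∀ v : List Bool, v.length = A.length → Killed (St A [some i] v) (χ v) := fun v hv => by
    rw [hχ]
    exact Killed.sad_smul (hs v hv) (st_equivalence _ _ _) (hφ v hv)
  have hφe : ∀ v : List Bool, v.length = A.length → edgeSum 0 A (St A [] v) φ v = 0 := fun v hv =>
      by
    rw [edgeSum_st, List.append_nil, h2 v hv]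
  have hχe : ∀ v : List Bool, v.length = A.length → edgeSum 0 A (St A [some i] v) χ v = 0 := fun v
      hv => by
    rw [hχ, edgeSum_sad hs hφ hv, hφe v hv, smul_zero]
  have hrPP : res [(i, ε), (i, !ε)] [!ε, ε] = [none, none] := by cases ε <;> rfl
  have hrTT : res [(i, ε), (i, !ε)] [ε, !ε] = [some i, some i] := by cases ε <;> rfl
  have hout : ∀ u v, v.length = A.length → u.length = 2 → u ≠ [ε, !ε] →
      ∀ z, ∃ z' ∈ Lev A.length, rel (res A v ++ res [(i, ε), (i, !ε)] u) z z' := by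
    intro u v hv hu hne
    obtain ⟨a, b, rfl⟩ := length_two hu
    refine exists_outer_two (length_res hv) ?_
    cases a <;> cases b <;> cases ε <;> simp_all [resLetter]
  obtain ⟨Ψ, hΨ⟩ : ∃ Ψ : List Bool → List Bool → Func, Ψ = fun u v =>
      if u = [!ε, ε] then ext A [none, none] v (φ v) else
      if u = [ε, !ε] then -cir A [some i, some i] v (χ v) else 0 := ⟨_, rfl⟩
  have hΨk : ∀ u v, u.length = [(i, ε), (i, !ε)].length → v.length = A.length →
      Killed (rel (res A v ++ res [(i, ε), (i, !ε)] u)) (Ψ u v) := by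
    intro u v hu hv
    simp only [hΨ]
    split_ifs with hu1 hu2
    · rw [hu1, hrPP]
      refine Killed.ext ?_
      rw [st_snoc_none, st_none]
      exact hφ v hv
    · rw [hu2, hrTT]
      refine (Killed.cir ?_).neg
      rw [st_turn_turn hv]
      exact hχk v hv
    · exact Killed.zero
  have hΨPP : Ψ [!ε, ε] = fun v => ext A [none, none] v (φ v) := by simp [hΨ]
  have hΨTT : Ψ [ε, !ε] = fun v => -cir A [some i, some i] v (χ v) := by cases ε <;> simp [hΨ]
  have hΨ00 : Ψ [false, false] = fun _ => 0 := by cases ε <;> simp [hΨ]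
  have hΨ11 : Ψ [true, true] = fun _ => 0 := by cases ε <;> simp [hΨ]
  refine good_append_of Ψ hΨk ?_ ?_
  · rintro u v hu hv F hFeq hF
    have hu' : u = [!ε, ε] ∨ u = [ε, !ε] ∨ u = [false, false] ∨ u = [true, true] := by
      obtain ⟨a, b, rfl⟩ := length_two hu
      cases a <;> cases b <;> cases ε <;> simp
    rcases hu' with rfl | rfl | rfl | rfl
    · have hF' : F = edgeSum 0 A (St A [] v) (Ψ [!ε, ε]) v := by
        rw [hFeq, hrPP, ← edgeSum_st, st_snoc_none, st_none, edgeSum_pair]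
        cases ε <;> simp [hΨ11]
      refine hF.eq_zero_of_outer (hout _ v hv rfl (by cases ε <;> simp)) ?_
      rw [hF', hΨPP, restr_edgeSum_lev]
      simp only [restr_ext]
      rw [← restr_edgeSum_lev, hφe v hv, map_zero]
    · have hF' : F = edgeSum 0 A (St A [some i, some i] v) (Ψ [ε, !ε]) v := by
        rw [hFeq, hrTT, ← edgeSum_st, edgeSum_pair]
        cases ε <;> simp [hΨ11]
      rw [hrTT] at hF
      rw [hF', hΨTT, edgeSum_neg] at hF ⊢
      rw [edgeSum_cir (χ := χ) (c := (i, A.length + 1)) hv (by simpa using hF.neg)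
          (outer_or_turn_turn hv i)
        (fun v hv => inner_turn_turn hv i)
        (by rw [st_turn_turn hv]; exact hχe v hv), neg_zero]
    -- The state with a single turn and edges to both non-zero states. The edge to the parallel
    -- state contributes χ; the edge that splits off the circle contributes, on outer polynomials,
    -- -χ, because X of the circle takes u₋* to u₊* and the outer variable leaves u₋*.
    · refine hF.eq_zero_of_outer (hout _ v hv rfl (by cases ε <;> simp)) ?_
      have kPP := hΨk [!ε, ε] v rfl hv
      have kTT := hΨk [ε, !ε] v rfl hv
      rw [hrPP, hΨPP] at kPP
      rw [hrTT, hΨTT] at kTT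
      have hin := inner_turn_turn hv i
      have E := rel_equivalence
      have hl := length_res hv
      rw [hFeq, edgeSum_pair, hΨ00, edgeSum_zero, zero_add, restr_neg_one_pow]
      cases ε
      · have e1 : res [(i, false), (i, !false)] [false, false] = [some i, none] := rfl
        simp only [if_true, Bool.false_eq_true, if_false, one_smul]
        have hpq : rel (res A v ++ [some i, none]) (i, A.length + 1) (i + 1, A.length + 2) := by
          intro f hf
          obtain ⟨-, hs1, hs2, hs3⟩ := (resp_two hl).1 hf
          simp only [Step] at hs1 hs2
          grind
        have hq : ∀ a b, rel (res A v ++ [a, b]) (i + 1, A.length + 2) (i + 1, 0) := fun a b f hf =>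
          ((resp_two hl).1 hf).2.2.2 _ _ le_rfl
        rw [e1, show Ψ [true, false] = _ from hΨPP, show Ψ [false, true] = _ from hΨTT,
          sad_of hpq, sad_smul_outer (p' := (i, A.length)) (q' := (i + 1, 0)) kPP, add_smul,
          kTT.eq _ _ (hq _ _), map_add, restr_sad, restr_ext, smul_neg, smul_neg,
          map_add, map_neg, map_neg, restr_smul_cir_of_inner hin, restr_smul_cir_of_mem,
              st_snoc_none]
        · simp only [hχ]
          rw [restr_sad le_rfl (Nat.zero_le _)]
          simp
        · exact Nat.zero_le _
        · exact le_rfl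
        · exact Nat.zero_le _
        · exact (E _).refl _
        · intro f hf
          obtain ⟨-, hs1, hs2, hs3⟩ := (resp_two hl).1 hf
          simp only [Step] at hs1 hs2
          grind
        · exact (E _).refl _
        · intro f hf
          obtain ⟨-, hs1, hs2, hs3⟩ := (resp_two hl).1 hf
          simp only [Step] at hs1 hs2
          grind
        · exact le_rfl
        · exact Nat.zero_le _
      · have e1 : res [(i, true), (i, !true)] [false, false] = [none, some i] := rfl
        simp only [if_true, Bool.false_eq_true, if_false, one_smul]
        have hpq : rel (res A v ++ [none, some i]) (i, A.length) (i + 1, A.length + 1) := by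
          intro f hf
          obtain ⟨-, hs1, hs2, hs3⟩ := (resp_two hl).1 hf
          simp only [Step] at hs1 hs2
          grind
        have hq : rel (res A v ++ [some i, some i]) (i + 1, A.length + 1) (i, A.length + 1) := by
          intro f hf
          obtain ⟨-, hs1, hs2, hs3⟩ := (resp_two hl).1 hf
          simp only [Step] at hs1 hs2
          grind
        rw [e1, show Ψ [false, true] = _ from hΨPP, show Ψ [true, false] = _ from hΨTT,
          sad_of hpq, sad_smul_outer (p' := (i, A.length)) (q' := (i + 1, 0)) kPP, add_smul,
          kTT.eq _ _ hq, map_add, restr_sad, restr_ext, smul_neg, smul_neg,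
          map_add, map_neg, map_neg, restr_smul_cir_of_inner hin, restr_smul_cir_of_mem,
          st_none_cons hv]
        · simp only [hχ]
          rw [restr_sad le_rfl (Nat.zero_le _)]
          simp
        · exact le_rfl
        · exact le_rfl
        · exact Nat.zero_le _
        · intro f hf
          obtain ⟨-, hs1, hs2, hs3⟩ := (resp_two hl).1 hf
          simp only [Step] at hs1 hs2
          grind
        · exact fun f hf => ((resp_two hl).1 hf).2.2.2 _ _ le_rfl
        · intro f hf
          obtain ⟨-, hs1, hs2, hs3⟩ := (resp_two hl).1 hf
          simp only [Step] at hs1 hs2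
          grind
        · exact fun f hf => ((resp_two hl).1 hf).2.2.2 _ _ le_rfl
        · exact le_rfl
        · exact Nat.zero_le _
    · rw [hFeq, edgeSum_pair, hΨ11]
      simp
  · have : orient [(i, ε), (i, !ε)] = [!ε, ε] := by simp [orient]
    rw [this, hΨPP, ext_apply_prod]
    exact h3

theorem Killed.prod_smul {r : Pt → Pt → Prop} {φ : Func} (h : Killed r φ) {n a b : ℕ}
    (hr : r (a, 0) (b, 0)) (hab : a ≠ b) (ha : a < n) (hb : b < n) :
    (∏ j ∈ Finset.range n, X (j, 0) : PtRing) • φ = 0 := by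
  rw [← Finset.mul_prod_erase _ _ (Finset.mem_range.2 ha),
    ← Finset.mul_prod_erase _ _ (Finset.mem_erase.2 ⟨hab.symm, Finset.mem_range.2 hb⟩), ← mul_assoc,
    mul_comm, mul_smul, mul_smul, ← h.eq _ _ hr, h.sq, smul_zero]

-- The transpose of a chain map sends φ to its parallel component plus the pull-back, along the
-- saddle creating a turn, of its component on the state with two turns. Both coboundaries involve
-- the state [true, true]: the edge that merges the circle has scalar 1 and the opposite sign, so
-- the contributions cancel.
set_option maxHeartbeats 400000 in
theorem good_of_insert {n : ℕ} {i : ℕ} {ε : Bool} (hi : i < n) (h : Good n (A ++ [(i, ε), (i,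
    !ε)])) : Good n A := by
  obtain ⟨Φ, h1, h2, h3⟩ := good_append.1 h
  have hrPP : res [(i, ε), (i, !ε)] [!ε, ε] = [none, none] := by cases ε <;> rfl
  have hrTT : res [(i, ε), (i, !ε)] [ε, !ε] = [some i, some i] := by cases ε <;> rfl
  have hkPP : ∀ v : List Bool, v.length = A.length → Killed (St A [] v) (Φ [!ε, ε] v) := by
    intro v hv
    have := (h1 [!ε, ε] v rfl hv).st
    rwa [hrPP, st_snoc_none, st_none] at this
  have hkTT : ∀ v : List Bool, v.length = A.length → Killed (St A [some i] v) (Φ [ε, !ε] v) := by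
    intro v hv
    have := (h1 [ε, !ε] v rfl hv).st
    rwa [hrTT, st_turn_turn hv] at this
  have hs : ∀ v : List Bool, v.length = A.length →
      Saddle (St A [] v) (St A [some i] v) (i, A.length) (i + 1, 0) := fun v hv => saddle_st_one hv
          i
  refine good_of_st (fun v => Φ [!ε, ε] v + sad (St A [] v) (i, A.length) (i + 1, 0) • Φ [ε, !ε] v)
    (fun v hv => (hkPP v hv).add ((hkTT v hv).sad_smul (hs v hv) (st_equivalence _ _ _))) ?_ ?_
  · intro v hv
    have hin := inner_turn_turn hv i
    have hl := length_res hv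
    have E := rel_equivalence
    have HPP := h2 [!ε, ε] v rfl hv
    have HTT := h2 [ε, !ε] v rfl hv
    have k := h1 [true, true] v rfl hv
    rw [← edgeSum_st, hrPP, edgeSum_pair] at HPP
    rw [← edgeSum_st, hrTT, edgeSum_pair] at HTT
    rw [edgeSum_add, edgeSum_sad hs hkTT hv]
    have hcl : ∀ a b k, rel (res A v ++ [a, b]) (k, A.length + 2) (k, 0) := fun a b k f hf =>
      ((resp_two hl).1 hf).2.2.2 _ _ le_rfl
    cases ε
    · have e1 : res [(i, false), (i, !false)] [true, true] = [none, some i] := rfl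
      have hn : ¬ rel (res A v ++ [some i, some i]) (i, A.length) (i + 1, A.length + 1) := by
        intro hr
        refine hin ⟨(i, A.length), le_refl A.length, (E _).symm ((E _).trans hr fun f hf => ?_)⟩
        obtain ⟨-, hs1, hs2, hs3⟩ := (resp_two hl).1 hf
        simp only [Step] at hs1 hs2
        grind
      rw [e1] at k
      simp only [Bool.not_false, Bool.true_eq_false, Bool.false_eq_true, if_false,
        if_true, zero_add, add_zero, one_smul] at HPP HTT ⊢
      rw [st_snoc_none, st_none, sad_smul_outer (p' := (i, A.length)) (q' := (i + 1, 0)) k,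
        st_snoc_none, st_none] at HPP
      · rw [st_turn_turn hv, sad_of_not hn] at HTT
        rw [eq_neg_of_add_eq_zero_left HPP, eq_neg_of_add_eq_zero_left HTT, smul_neg,
          smul_comm (sad _ _ _)]
        simp
      · intro f hf
        obtain ⟨-, hs1, hs2, hs3⟩ := (resp_two hl).1 hf
        simp only [Step] at hs1 hs2
        grind
      · exact hcl _ _ _
      · intro f hf
        obtain ⟨-, hs1, hs2, hs3⟩ := (resp_two hl).1 hf
        simp only [Step] at hs1 hs2
        grind
      · exact hcl _ _ _
      · exact le_rfl
      · exact Nat.zero_le _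
    · have e1 : res [(i, true), (i, !true)] [true, true] = [some i, none] := rfl
      have hn : ¬ rel (res A v ++ [some i, some i]) (i, A.length + 1) (i + 1, A.length + 2) :=
        fun hr => hin ⟨(i + 1, 0), Nat.zero_le _, (E _).trans hr (hcl _ _ _)⟩
      rw [e1] at k
      simp only [Bool.not_true, Bool.true_eq_false, Bool.false_eq_true, if_false,
        if_true, zero_add, add_zero, one_smul] at HPP HTT ⊢
      rw [st_snoc_none, st_none, sad_smul_outer (p' := (i, A.length)) (q' := (i + 1, 0)) k,
        st_snoc_none, st_none] at HPP
      · rw [st_turn_turn hv, sad_of_not hn] at HTT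
        rw [eq_neg_of_add_eq_zero_left HPP, eq_neg_of_add_eq_zero_left HTT, smul_neg,
          smul_comm (sad _ _ _)]
        simp
      · exact (E _).refl _
      · intro f hf
        obtain ⟨-, hs1, hs2, hs3⟩ := (resp_two hl).1 hf
        simp only [Step] at hs1 hs2
        grind
      · exact (E _).refl _
      · intro f hf
        obtain ⟨-, hs1, hs2, hs3⟩ := (resp_two hl).1 hf
        simp only [Step] at hs1 hs2
        grind
      · exact le_rfl
      · exact Nat.zero_le _
  · have h3' : IsUnit (Φ [!ε, ε] (orient A) (∏ j ∈ Finset.range (n + 1), X (j, 0))) := by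
      simpa [orient] using h3
    -- The correction term does not see ψ: in the state with a turn the strings i and i + 1 are
    -- joined at level 0, and the product over all strings contains a square.
    have hz : (∏ j ∈ Finset.range (n + 1), X (j, 0) : PtRing) • Φ [ε, !ε] (orient A) = 0 := by
      refine (hkTT _ (length_orient A)).prod_smul (a := i) (b := i + 1) ?_ (by omega) (by omega)
        (by omega)
      refine Or.inr ⟨Nat.zero_le _, Nat.zero_le _, fun f hf => ?_⟩
      obtain ⟨-, hs1, hs2⟩ := (resp_one (length_res (length_orient A))).1 hf
      rw [← hs2 i _ le_rfl, ← hs2 (i + 1) _ le_rfl]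
      exact hs1.2.1
    have := DFunLike.congr_fun hz (sad (St A [] (orient A)) (i, A.length) (i + 1, 0))
    rw [Func.add_apply, Func.smul_apply, mul_comm, ← Func.smul_apply, this]
    simpa using h3'

end

/-! ### The braid relation -/

theorem sad_comm {r : Pt → Pt → Prop} (e : Equivalence r) (p q : Pt) : sad r p q = sad r q p := by
  by_cases h : r p q
  · rw [sad_of h, sad_of (e.symm h), add_comm]
  · rw [sad_of_not h, sad_of_not fun h' => h (e.symm h')]

/-- Variant for the last saddle that completes e_i e_j e_i: the third turn exchanges the outer
points reached by the two ends. The scalar X_p + X_q is symmetric, so it does not change. -/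
theorem sad_smul_outer_swap {A : List (ℕ × Bool)} {v : List Bool} {tail tail' : List (Option ℕ)}
    {p q p' q' : Pt} {F : Func} (hF : Killed (rel (res A v ++ tail')) F)
    (hp : rel (res A v ++ tail) p p') (hq : rel (res A v ++ tail) q q')
    (hp2 : rel (res A v ++ tail') p q') (hq2 : rel (res A v ++ tail') q p')
    (hp' : p'.2 ≤ A.length) (hq' : q'.2 ≤ A.length) :
    sad (rel (res A v ++ tail)) p q • F = sad (St A tail v) p' q' • F := by
  have E := rel_equivalence (res A v ++ tail)
  rw [show sad (St A tail v) p' q' = sad (rel (res A v ++ tail)) p' q' from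
    sad_congr (onSet_iff E hp' hq')]
  by_cases h : rel (res A v ++ tail) p q
  · rw [sad_of h, sad_of (E.trans (E.symm hp) (E.trans h hq)), add_smul, add_smul, hF.eq _ _ hp2,
      hF.eq _ _ hq2, add_comm]
  · rw [sad_of_not h, sad_of_not fun h' => h (E.trans hp (E.trans h' (E.symm hq)))]

theorem rel_two {A : List (ℕ × Bool)} {v : List Bool} (hv : v.length = A.length) {a b : Option ℕ}
    {x y : Pt} (h : ∀ f : Pt → Prop, Step A.length f a → Step (A.length + 1) f b →
      (∀ j s, A.length + 2 ≤ s → (f (j, s) ↔ f (j, 0))) → (f x ↔ f y)) :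
    rel (res A v ++ [a, b]) x y := fun f hf => by
  obtain ⟨-, h1, h2, h3⟩ := (resp_two (length_res hv)).1 hf
  exact h f h1 h2 h3

theorem rel_three {A : List (ℕ × Bool)} {v : List Bool} (hv : v.length = A.length)
    {a b c : Option ℕ} {x y : Pt} (h : ∀ f : Pt → Prop, Step A.length f a → Step (A.length + 1) f b
        →
      Step (A.length + 2) f c → (∀ j s, A.length + 3 ≤ s → (f (j, s) ↔ f (j, 0))) → (f x ↔ f y)) :
    rel (res A v ++ [a, b, c]) x y := fun f hf => by
  obtain ⟨-, h1, h2, h3, h4⟩ := (resp_three (length_res hv)).1 hf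
  exact h f h1 h2 h3 h4

/-- The first point of the saddle that adds the arcs of `j` above those of `i`. -/
def topP (l i j : ℕ) : Pt := if i < j then (i, 0) else (j, l)

/-- The second point of the saddle that adds the arcs of `j` below those of `i`. -/
def botQ (l i j : ℕ) : Pt := if i < j then (j + 1, 0) else (i + 1, l)

theorem topP_snd (l i j : ℕ) : (topP l i j).2 ≤ l := by
  unfold topP
  split_ifs
  exacts [Nat.zero_le _, le_rfl]

theorem botQ_snd (l i j : ℕ) : (botQ l i j).2 ≤ l := by
  unfold botQ
  split_ifs
  exacts [Nat.zero_le _, le_rfl]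

section

variable {A : List (ℕ × Bool)} {v : List Bool} (hv : v.length = A.length) {i j : ℕ}
  (hij : i + 1 = j ∨ j + 1 = i)

include hv

theorem saddle_top (hij : i + 1 = j ∨ j + 1 = i) :
    Saddle (St A [some i] v) (St A [some i, some j] v) (topP A.length i j) (j + 1, 0) := by
  rw [← st_snoc_none]
  refine saddle_st hv (k := 1) (i := j) rfl rfl rfl (fun s hs => ?_) ?_ ?_ ?_ ?_ (topP_snd _ _ _)
    (Nat.zero_le _)
  · rcases s with _ | _ | s
    · rfl
    · exact absurd rfl hs
    · rfl
  all_goals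
    refine rel_two hv fun f h1 h2 h3 => ?_
    simp only [Step, topP] at *
    rcases hij with rfl | rfl <;> grind

theorem saddle_bot (hij : i + 1 = j ∨ j + 1 = i) :
    Saddle (St A [some i] v) (St A [some j, some i] v) (j, A.length) (botQ A.length i j) := by
  rw [← st_none_cons hv]
  refine saddle_st hv (k := 0) (i := j) rfl rfl rfl (fun s hs => ?_) ?_ ?_ ?_ ?_ le_rfl
    (botQ_snd _ _ _)
  · rcases s with _ | s
    · exact absurd rfl hs
    · rfl
  all_goals
    refine rel_two hv fun f h1 h2 h3 => ?_
    simp only [Step, botQ] at *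
    rcases hij with rfl | rfl <;> grind

/-- This lemma and those up to `sad_last_first` express the edges needed from the cube of σ_i σ_j
σ_i by saddles between points of `Lev A.length`. The hypothesis names the target state of the edge;
the left side names the source. -/
theorem sad_first {F : Func} (hF : Killed (rel (res A v ++ [some i, none, none])) F) :
    sad (rel (res A v ++ [none, none, none])) (i, A.length) (i + 1, A.length + 1) • F =
      sad (St A [] v) (i, A.length) (i + 1, 0) • F := by
  rw [sad_smul_outer (p' := (i, A.length)) (q' := (i + 1, 0)) hF, st_snoc_none₂, st_snoc_none,
      st_none]
  case hp' => exact le_rfl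
  case hq' => exact Nat.zero_le _
  all_goals
    refine rel_three hv fun f h1 h2 h3 h4 => ?_
    simp only [Step] at h1 h2 h3
    grind

theorem sad_second {F : Func} (hF : Killed (rel (res A v ++ [none, some i, none])) F) :
    sad (rel (res A v ++ [none, none, none])) (i, A.length + 1) (i + 1, A.length + 2) • F =
      sad (St A [] v) (i, A.length) (i + 1, 0) • F := by
  rw [sad_smul_outer (p' := (i, A.length)) (q' := (i + 1, 0)) hF, st_snoc_none₂, st_snoc_none,
      st_none]
  case hp' => exact le_rfl
  case hq' => exact Nat.zero_le _
  all_goals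
    refine rel_three hv fun f h1 h2 h3 h4 => ?_
    simp only [Step] at *
    grind

theorem sad_third {F : Func} (hF : Killed (rel (res A v ++ [none, none, some i])) F) :
    sad (rel (res A v ++ [none, none, none])) (i, A.length + 2) (i + 1, A.length + 3) • F =
      sad (St A [] v) (i, A.length) (i + 1, 0) • F := by
  rw [sad_smul_outer (p' := (i, A.length)) (q' := (i + 1, 0)) hF, st_snoc_none₂, st_snoc_none,
      st_none]
  case hp' => exact le_rfl
  case hq' => exact Nat.zero_le _
  all_goals
    refine rel_three hv fun f h1 h2 h3 h4 => ?_
    simp only [Step] at *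
    grind

include hij

theorem sad_first_second {F : Func} (hF : Killed (rel (res A v ++ [some i, some j, none])) F) :
    sad (rel (res A v ++ [some i, none, none])) (j, A.length + 1) (j + 1, A.length + 2) • F =
      sad (St A [some i] v) (topP A.length i j) (j + 1, 0) • F := by
  rw [sad_smul_outer (p' := topP A.length i j) (q' := (j + 1, 0)) hF, st_snoc_none₂, st_snoc_none]
  case hp' => exact topP_snd _ _ _
  case hq' => exact Nat.zero_le _
  all_goals
    refine rel_three hv fun f h1 h2 h3 h4 => ?_
    simp only [Step, topP] at *
    rcases hij with rfl | rfl <;> grind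

theorem sad_second_first {F : Func} (hF : Killed (rel (res A v ++ [some i, some j, none])) F) :
    sad (rel (res A v ++ [none, some j, none])) (i, A.length) (i + 1, A.length + 1) • F =
      sad (St A [some j] v) (i, A.length) (botQ A.length j i) • F := by
  rw [sad_smul_outer (p' := (i, A.length)) (q' := botQ A.length j i) hF, st_snoc_none₂,
      st_none_cons hv]
  case hp' => exact le_rfl
  case hq' => exact botQ_snd _ _ _
  all_goals
    refine rel_three hv fun f h1 h2 h3 h4 => ?_
    simp only [Step] at h1 h2 h3
    rcases hij with rfl | rfl <;> grind [botQ]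

theorem sad_second_third {F : Func} (hF : Killed (rel (res A v ++ [none, some j, some i])) F) :
    sad (rel (res A v ++ [none, some j, none])) (i, A.length + 2) (i + 1, A.length + 3) • F =
      sad (St A [some j] v) (topP A.length j i) (i + 1, 0) • F := by
  rw [sad_smul_outer (p' := topP A.length j i) (q' := (i + 1, 0)) hF, st_snoc_none₂, st_none_cons
      hv]
  case hp' => exact topP_snd _ _ _
  case hq' => exact Nat.zero_le _
  all_goals
    refine rel_three hv fun f h1 h2 h3 h4 => ?_
    simp only [Step, topP] at *
    rcases hij with rfl | rfl <;> grind

theorem sad_third_second {F : Func} (hF : Killed (rel (res A v ++ [none, some j, some i])) F) :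
    sad (rel (res A v ++ [none, none, some i])) (j, A.length + 1) (j + 1, A.length + 2) • F =
      sad (St A [some i] v) (j, A.length) (botQ A.length i j) • F := by
  rw [sad_smul_outer (p' := (j, A.length)) (q' := botQ A.length i j) hF, st_none_cons₂ hv,
    st_none_cons hv]
  case hp' => exact le_rfl
  case hq' => exact botQ_snd _ _ _
  all_goals
    refine rel_three hv fun f h1 h2 h3 h4 => ?_
    simp only [Step, botQ] at *
    rcases hij with rfl | rfl <;> grind

theorem sad_last_third {F : Func} (hF : Killed (rel (res A v ++ [some i, some j, some i])) F) :
    sad (rel (res A v ++ [some i, some j, none])) (i, A.length + 2) (i + 1, A.length + 3) • F =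
      sad (St A [some i, some j] v) (topP A.length i j) (j + 1, 0) • F := by
  have E := st_equivalence A [some i, some j] v
  rcases hij with rfl | rfl
  · rw [sad_smul_outer_swap (p' := topP A.length i (i + 1)) (q' := (i + 1 + 1, 0)) hF,
        st_snoc_none₂]
    case hp' => exact topP_snd _ _ _
    case hq' => exact Nat.zero_le _
    all_goals
      refine rel_three hv fun f h1 h2 h3 h4 => ?_
      simp only [Step, topP] at *
      grind
  · rw [sad_comm E, sad_smul_outer_swap (q' := topP A.length (j + 1) j) (p' := (j + 1, 0)) hF,
      st_snoc_none₂]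
    case hq' => exact topP_snd _ _ _
    case hp' => exact Nat.zero_le _
    all_goals
      refine rel_three hv fun f h1 h2 h3 h4 => ?_
      simp only [Step, topP] at *
      grind

theorem sad_last_first {F : Func} (hF : Killed (rel (res A v ++ [some i, some j, some i])) F) :
    sad (rel (res A v ++ [none, some j, some i])) (i, A.length) (i + 1, A.length + 1) • F =
      sad (St A [some j, some i] v) (j, A.length) (botQ A.length i j) • F := by
  have E := st_equivalence A [some j, some i] v
  rcases hij with rfl | rfl
  · rw [sad_comm E, sad_smul_outer_swap (q' := (i + 1, A.length)) (p' := botQ A.length i (i + 1))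
        hF,
      st_none_cons₂ hv]
    case hp' => exact botQ_snd _ _ _
    case hq' => exact le_rfl
    all_goals
      refine rel_three hv fun f h1 h2 h3 h4 => ?_
      simp only [Step, botQ] at *
      grind
  · rw [sad_smul_outer_swap (p' := (j, A.length)) (q' := botQ A.length (j + 1) j) hF,
      st_none_cons₂ hv]
    case hp' => exact le_rfl
    case hq' => exact botQ_snd _ _ _
    all_goals
      refine rel_three hv fun f h1 h2 h3 h4 => ?_
      simp only [Step, botQ] at *
      grind

end

/-! ### Elimination in the cube of the braid relation -/

section

variable {A : List (ℕ × Bool)} {n i j : ℕ}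

/-- The condition on cocycles for `σ_i σ_j σ_i` and `σ_j σ_i σ_j` at the state with the arcs of
`i`. -/
def TurnEq (A : List (ℕ × Bool)) (i j : ℕ) (φi φij φji : List Bool → Func) : Prop :=
  ∀ v : List Bool, v.length = A.length → restr (Lev A.length) (edgeSum 0 A (St A [some i] v) φi v +
    ((-1) ^ v.count true : PtRing) •
      (sad (St A [some i] v) (topP A.length i j) (j + 1, 0) • φij v -
        sad (St A [some i] v) (j, A.length) (botQ A.length i j) • φji v)) = 0

/-- Reduced cocycles for `σ_i σ_j σ_i` and `σ_j σ_i σ_j` placed after the word `A`. -/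
structure Reduced (n : ℕ) (A : List (ℕ × Bool)) (i j : ℕ) (φ φi φj φij φji : List Bool → Func) :
    Prop where
  killed : ∀ v : List Bool, v.length = A.length → Killed (St A [] v) (φ v)
  killed₁ : ∀ v : List Bool, v.length = A.length → Killed (St A [some i] v) (φi v)
  killed₂ : ∀ v : List Bool, v.length = A.length → Killed (St A [some j] v) (φj v)
  killed₁₂ : ∀ v : List Bool, v.length = A.length → Killed (St A [some i, some j] v) (φij v)
  killed₂₁ : ∀ v : List Bool, v.length = A.length → Killed (St A [some j, some i] v) (φji v)
  eq : ∀ v : List Bool, v.length = A.length → restr (Lev A.length) (edgeSum 0 A (St A [] v) φ v +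
    ((-1) ^ v.count true : PtRing) • (sad (St A [] v) (i, A.length) (i + 1, 0) • φi v +
      sad (St A [] v) (j, A.length) (j + 1, 0) • φj v)) = 0
  eq₁ : TurnEq A i j φi φij φji
  eq₂ : TurnEq A j i φj φji φij
  eq₁₂ : ∀ v : List Bool, v.length = A.length → edgeSum 0 A (St A [some i, some j] v) φij v = 0
  eq₂₁ : ∀ v : List Bool, v.length = A.length → edgeSum 0 A (St A [some j, some i] v) φji v = 0
  unit : IsUnit (φ (orient A) (∏ j ∈ Finset.range (n + 1), X (j, 0)))

/-- The heart of the braid relation. The cube of σ_i σ_j σ_i has the states 1, e_j, e_i e_j, e_j e_i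
once and four more of type e_i (two plain ones, one with a circle and e_i e_j e_i). After
elimination a single e_i remains, and the data are symmetric in i and j. -/
theorem Reduced.symm {φ φi φj φij φji : List Bool → Func} (h : Reduced n A i j φ φi φj φij φji) :
    Reduced n A j i φ φj φi φji φij where
  killed := h.killed
  killed₁ := h.killed₂
  killed₂ := h.killed₁
  killed₁₂ := h.killed₂₁
  killed₂₁ := h.killed₁₂
  eq v hv := by rw [add_comm (_ • φj v)]; exact h.eq v hv
  eq₁ := h.eq₂
  eq₂ := h.eq₁
  eq₁₂ := h.eq₂₁
  eq₂₁ := h.eq₁₂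
  unit := h.unit

variable {v : List Bool} (hv : v.length = A.length)

include hv

theorem inner_turn_none_turn (i : ℕ) :
    Inner (Lev A.length) (rel (res A v ++ [some i, none, some i])) (i, A.length + 1) := by
  rintro ⟨z, hz, hr⟩
  have := hr (fun z => (z.2 = A.length + 1 ∨ z.2 = A.length + 2) ∧ (z.1 = i ∨ z.1 = i + 1)) ?_
  · simp only [mem_lev] at hz
    simp only [true_or, and_self, true_iff] at this
    omega
  · rw [resp_three (length_res hv)]
    refine ⟨?_, ?_, ?_, ?_, fun j s hs => ?_⟩
    · intro t o ho
      have ht : t < A.length := by rw [← length_res hv]; exact (List.getElem?_eq_some_iff.1 ho).1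
      cases o <;> simp only [Step] <;> grind
    · simp only [Step]; grind
    · simp only [Step]; grind
    · simp only [Step]; grind
    · dsimp only; omega

theorem outer_or_turn_none_turn (i : ℕ) (z : Pt) :
    (∃ z' ∈ Lev A.length, rel (res A v ++ [some i, none, some i]) z z') ∨
      rel (res A v ++ [some i, none, some i]) z (i, A.length + 1) := by
  obtain ⟨k, s⟩ := z
  rcases le_or_gt s A.length with hs | hs
  · exact Or.inl ⟨(k, s), hs, (rel_equivalence _).refl _⟩
  by_cases hs' : s = A.length + 1 ∨ s = A.length + 2
  · by_cases hk : k = i ∨ k = i + 1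
    · right
      refine rel_three hv fun f h1 h2 h3 _ => ?_
      simp only [Step] at h1 h2 h3
      rcases hs' with rfl | rfl <;> grind
    · refine Or.inl ⟨(k, A.length), le_refl A.length, rel_three hv fun f h1 h2 h3 _ => ?_⟩
      simp only [Step] at h1 h2 h3
      rcases hs' with rfl | rfl <;> grind
  · exact Or.inl ⟨(k, 0), Nat.zero_le _, rel_three hv fun f _ _ _ h => h k s (by omega)⟩

/-- Every component of a resolution of `σ_i σ_j σ_i` other than the one with a circle is
outer. -/
theorem exists_outer_three {a b c : Option ℕ} {i j : ℕ} (hij : i ≠ j) (ha : a = none ∨ a = some i)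
    (hb : b = none ∨ b = some j) (hc : c = none ∨ c = some i)
    (h : a = none ∨ c = none) (z : Pt) :
    ∃ z' ∈ Lev A.length, rel (res A v ++ [a, b, c]) z z' := by
  rcases h with rfl | rfl
  · have hl := length_res hv
    obtain ⟨z', hz', hr⟩ := exists_outer_two (e := res A v ++ [none]) (l := A.length + 1)
      (by simp [hl]) (a := b) (b := c) (by grind) z
    rw [List.append_assoc] at hr
    rcases eq_or_ne z'.2 (A.length + 1) with hz | hz
    · obtain ⟨k, s⟩ := z'
      obtain rfl : s = A.length + 1 := hz
      exact ⟨(k, A.length), le_refl A.length, (rel_equivalence _).trans hr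
        (rel_three hv fun f h1 _ _ _ => (h1 k).symm)⟩
    · refine ⟨z', ?_, hr⟩
      simp only [mem_lev] at hz' ⊢
      omega
  · have : res A v ++ [a, b, none] = res A v ++ [a, b] ++ [none] := by simp
    rw [this, rel_none]
    exact exists_outer_two (length_res hv) (by grind) z

/-- The circle of the resolution of `σ_i σ_j σ_i` merges with the string next to it. -/
theorem not_rel_second (hij : i + 1 = j ∨ j + 1 = i) :
    ¬ rel (res A v ++ [some i, none, some i]) (j, A.length + 1) (j + 1, A.length + 2) := by
  intro hr
  have E := rel_equivalence (res A v ++ [some i, none, some i])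
  rcases hij with rfl | rfl
  · refine inner_turn_none_turn hv i ⟨(i + 1 + 1, A.length), le_refl A.length, E.trans ?_ (E.trans
        hr ?_)⟩
    all_goals
      refine rel_three hv fun f h1 h2 h3 h4 => ?_
      simp only [Step] at h1 h2 h3
      grind
  · refine inner_turn_none_turn hv (j + 1) ⟨(j, A.length), le_refl A.length,
      E.trans ?_ (E.trans (E.symm hr) ?_)⟩
    all_goals
      refine rel_three hv fun f h1 h2 h3 h4 => ?_
      simp only [Step] at h1 h2 h3
      grind

end

section

variable {A : List (ℕ × Bool)} {n i j : ℕ} (hij : i + 1 = j ∨ j + 1 = i)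

include hij

/-- The two ways to remove the arcs of `j` around those of `i`. -/
theorem turn_exchange {v : List Bool} (hv : v.length = A.length) {F : Func}
    (hF : Killed (rel (res A v ++ [some i, none, some i])) F) :
    sad (St A [some i] v) (j, A.length) (botQ A.length i j) •
        sad (St A [some j, some i] v) (j, A.length) (botQ A.length i j) • F +
      (X (i + 1, 0) : PtRing) • F =
      sad (St A [some i] v) (topP A.length i j) (j + 1, 0) •
        sad (St A [some i, some j] v) (topP A.length i j) (j + 1, 0) • F +
      (X (i, A.length) : PtRing) • F := by
  -- A saddle followed by its reverse consists of one merge and one split, so it acts as X_p + X_q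
  -- in either order.
  have key : ∀ {r r' : Pt → Pt → Prop} {p q : Pt}, Equivalence r →
      Equivalence r' → Saddle r r' p q →
      sad r p q • sad r' p q • F = (X p + X q : PtRing) • F := by
    intro r r' p q e e' h
    by_cases hr : r p q
    · rw [sad_of hr, sad_of_not (h.of_rel hr).1, one_smul]
    · rw [sad_of_not hr, sad_of (h.of_not_rel e e' hr).1, one_smul]
  rw [key (st_equivalence _ _ _) (st_equivalence _ _ _) (saddle_bot hv hij),
    key (st_equivalence _ _ _) (st_equivalence _ _ _)
      (saddle_top hv hij),
    add_smul, add_smul]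
  rcases hij with rfl | rfl
  · have e1 : topP A.length i (i + 1) = (i, 0) := if_pos (by omega)
    have e2 : botQ A.length i (i + 1) = (i + 1 + 1, 0) := if_pos (by omega)
    rw [e1, e2, hF.eq (i, 0) (i + 1, 0), hF.eq (i + 1, A.length) (i, A.length)]
    · abel
    all_goals
      refine rel_three hv fun f h1 h2 h3 h4 => ?_
      simp only [Step] at h1 h2 h3
      grind
  · have e1 : topP A.length (j + 1) j = (j, A.length) := if_neg (by omega)
    have e2 : botQ A.length (j + 1) j = (j + 1 + 1, A.length) := if_neg (by omega)
    rw [e1, e2, hF.eq (j + 1 + 1, 0) (j + 1, 0), hF.eq (j + 1 + 1, A.length) (j + 1, A.length)]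
    · abel
    all_goals
      refine rel_three hv fun f h1 h2 h3 h4 => ?_
      simp only [Step] at h1 h2 h3
      grind

/-- The two ways from the arcs of `j` to those of `i`. -/
theorem turn_exchange' {v : List Bool} (hv : v.length = A.length) {F : Func}
    (hF : Killed (St A [some i] v) F) :
    restr (Lev A.length) (sad (St A [some j] v) (topP A.length j i) (i + 1, 0) •
        sad (St A [some j, some i] v) (j, A.length) (botQ A.length i j) • F) =
      restr (Lev A.length) (sad (St A [some j] v) (i, A.length) (botQ A.length j i) •
        sad (St A [some i, some j] v) (topP A.length i j) (j + 1, 0) • F) := by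
  -- The functional is transported to the isotopic state e_i e_j e_i. There the two routes are the
  -- sides of the square that adds the first and the third turn to the state e_j.
  have hG : Killed (rel (res A v ++ [some i, some j, some i])) (ext A [some i, some j, some i] v F)
      := by
    refine Killed.ext ?_
    rwa [st_turn_turn_turn hv hij]
  obtain ⟨G, hGF⟩ : ∃ G, G = ext A [some i, some j, some i] v F := ⟨_, rfl⟩
  have hr : restr (Lev A.length) F = restr (Lev A.length) G := by rw [hGF, restr_ext]
  rw [← hGF] at hG
  have s1 : Saddle (rel (res A v ++ [none, some j, none])) (rel (res A v ++ [some i, some j, none]))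
      (i, A.length) (i + 1, A.length + 1) :=
    saddle_tail hv (k := 0) rfl rfl rfl fun s hs => by rcases s with _ | s <;> simp at hs ⊢
  have s2 : Saddle (rel (res A v ++ [some i, some j, none]))
      (rel (res A v ++ [some i, some j, some i])) (i, A.length + 2) (i + 1, A.length + 3) :=
    saddle_tail hv (k := 2) rfl rfl rfl fun s hs => by rcases s with _ | _ | _ | s <;> simp at hs ⊢
  have s3 : Saddle (rel (res A v ++ [none, some j, none])) (rel (res A v ++ [none, some j, some i]))
      (i, A.length + 2) (i + 1, A.length + 3) :=
    saddle_tail hv (k := 2) rfl rfl rfl fun s hs => by rcases s with _ | _ | _ | s <;> simp at hs ⊢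
  have s4 : Saddle (rel (res A v ++ [none, some j, some i]))
      (rel (res A v ++ [some i, some j, some i])) (i, A.length) (i + 1, A.length + 1) :=
    saddle_tail hv (k := 0) rfl rfl rfl fun s hs => by rcases s with _ | s <;> simp at hs ⊢
  have E := rel_equivalence
  have H := sad_square (E _) (E _) (E _) (E _) s1 s2 s3 s4 hG
  have k1 := hG.sad_smul s2 (E _)
  have k2 := hG.sad_smul s4 (E _)
  rw [sad_second_first hv hij k1, sad_second_third hv hij k2, sad_last_third hv hij hG,
    sad_last_first hv hij hG] at H
  have H' := congrArg (restr (Lev A.length)) H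
  rw [restr_sad (topP_snd _ _ _) (Nat.zero_le _), restr_sad le_rfl (botQ_snd _ _ _),
    restr_sad le_rfl (botQ_snd _ _ _), restr_sad (topP_snd _ _ _) (Nat.zero_le _), hr]
  rw [restr_sad (topP_snd _ _ _) (Nat.zero_le _), restr_sad le_rfl (botQ_snd _ _ _),
    restr_sad le_rfl (botQ_snd _ _ _), restr_sad (topP_snd _ _ _) (Nat.zero_le _)] at H'
  exact H'.symm

end

section

variable {A : List (ℕ × Bool)} {n i j : ℕ} (hij : i + 1 = j ∨ j + 1 = i)

include hij

-- Transposed elimination. The two plain states e_i are added. The components on e_i e_j and e_j e_i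
-- are corrected by the component on e_i with a circle, pulled back along a saddle, so that the
-- component on e_i e_j e_i cancels: the edge from the state with the circle to that one is a merge.
set_option maxHeartbeats 400000 in
theorem exists_reduced_of_good (h : Good n (A ++ [(i, true), (j, true), (i, true)])) :
    ∃ φ φi φj φij φji, Reduced n A i j φ φi φj φij φji := by
  obtain ⟨Φ, h1, h2, h3⟩ := good_append.1 h
  obtain ⟨φij, hφij⟩ : ∃ φij : List Bool → Func, φij = fun v => -Φ [true, true, false] v -
    sad (St A [some i, some j] v) (topP A.length i j) (j + 1, 0) • Φ [true, false, true] v := ⟨_,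
        rfl⟩
  obtain ⟨φji, hφji⟩ : ∃ φji : List Bool → Func, φji = fun v => -Φ [false, true, true] v -
    sad (St A [some j, some i] v) (j, A.length) (botQ A.length i j) • Φ [true, false, true] v :=
    ⟨_, rfl⟩
  have K0 : ∀ v : List Bool, v.length = A.length →
      Killed (rel (res A v ++ [none, none, none])) (Φ [false, false, false] v) := fun v hv => h1
          [false, false, false] v rfl hv
  have Ka : ∀ v : List Bool, v.length = A.length →
      Killed (rel (res A v ++ [some i, none, none])) (Φ [true, false, false] v) := fun v hv => h1
          [true, false, false] v rfl hv
  have Kb : ∀ v : List Bool, v.length = A.length →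
      Killed (rel (res A v ++ [none, some j, none])) (Φ [false, true, false] v) := fun v hv => h1
          [false, true, false] v rfl hv
  have Kc : ∀ v : List Bool, v.length = A.length →
      Killed (rel (res A v ++ [none, none, some i])) (Φ [false, false, true] v) := fun v hv => h1
          [false, false, true] v rfl hv
  have Kab : ∀ v : List Bool, v.length = A.length →
      Killed (rel (res A v ++ [some i, some j, none])) (Φ [true, true, false] v) := fun v hv => h1
          [true, true, false] v rfl hv
  have Kac : ∀ v : List Bool, v.length = A.length →
      Killed (rel (res A v ++ [some i, none, some i])) (Φ [true, false, true] v) := fun v hv => h1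
          [true, false, true] v rfl hv
  have Kbc : ∀ v : List Bool, v.length = A.length →
      Killed (rel (res A v ++ [none, some j, some i])) (Φ [false, true, true] v) := fun v hv => h1
          [false, true, true] v rfl hv
  have Kabc : ∀ v : List Bool, v.length = A.length →
      Killed (rel (res A v ++ [some i, some j, some i])) (Φ [true, true, true] v) := fun v hv => h1
          [true, true, true] v rfl hv
  have kac : ∀ v : List Bool, v.length = A.length → Killed (St A [some i] v) (Φ [true, false, true]
      v) := by
    intro v hv
    have := (Kac v hv).st
    rwa [st_turn_none_turn hv] at this
  have hres : ∀ a b c, res [(i, true), (j, true), (i, true)] [a, b, c] =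
    [resLetter (i, true) a, resLetter (j, true) b, resLetter (i, true) c] := fun _ _ _ => rfl
  have H : ∀ (u : List Bool) (v : List Bool), v.length = A.length → u.length = 3 →
      edgeSum 0 A (St A (res [(i, true), (j, true), (i, true)] u) v) (Φ u) v +
        ((-1) ^ v.count true : PtRing) • edgeSum A.length [(i, true), (j, true), (i, true)]
          (rel (res A v ++ res [(i, true), (j, true), (i, true)] u)) (fun u => Φ u v) u = 0 := by
    intro u v hv hu
    rw [edgeSum_st]
    exact h2 u v hu hv
  have H0 := fun v (hv : v.length = A.length) => H [false, false, false] v hv rfl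
  have Ha := fun v (hv : v.length = A.length) => H [true, false, false] v hv rfl
  have Hb := fun v (hv : v.length = A.length) => H [false, true, false] v hv rfl
  have Hc := fun v (hv : v.length = A.length) => H [false, false, true] v hv rfl
  have Hab := fun v (hv : v.length = A.length) => H [true, true, false] v hv rfl
  have Hac := fun v (hv : v.length = A.length) => H [true, false, true] v hv rfl
  have Hbc := fun v (hv : v.length = A.length) => H [false, true, true] v hv rfl
  simp only [edgeSum_triple, hres, resLetter, if_true,
    Bool.false_eq_true, Bool.true_eq_false, if_false, one_smul, add_zero, zero_add, neg_smul]
    at H0 Ha Hb Hc Hab Hac Hbc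
  refine ⟨Φ [false, false, false], fun v => Φ [true, false, false] v + Φ [false, false, true] v,
    Φ [false, true, false], φij, φji, ?_⟩
  have kab : ∀ v : List Bool, v.length = A.length → Killed (St A [some i, some j] v) (Φ [true,
      true, false] v) := by
    intro v hv
    have := (Kab v hv).st
    rwa [st_snoc_none₂] at this
  have kbc : ∀ v : List Bool, v.length = A.length → Killed (St A [some j, some i] v) (Φ [false,
      true, true] v) := by
    intro v hv
    have := (Kbc v hv).st
    rwa [st_none_cons₂ hv] at this
  refine ⟨?_, ?_, ?_, ?_, ?_, ?_, ?_, ?_, ?_, ?_, ?_⟩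
  · intro v hv
    have := (K0 v hv).st
    rwa [st_snoc_none₂, st_snoc_none, st_none] at this
  · intro v hv
    have ka := (Ka v hv).st
    have kc := (Kc v hv).st
    rw [st_snoc_none₂, st_snoc_none] at ka
    rw [st_none_cons₂ hv, st_none_cons hv] at kc
    exact ka.add kc
  · intro v hv
    have := (Kb v hv).st
    rwa [st_snoc_none₂, st_none_cons hv] at this
  · intro v hv
    rw [hφij]
    simp only [sub_eq_add_neg]
    exact (kab v hv).neg.add ((kac v hv).sad_smul (saddle_top hv hij).symm (st_equivalence _ _
        _)).neg
  · intro v hv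
    rw [hφji]
    simp only [sub_eq_add_neg]
    exact (kbc v hv).neg.add ((kac v hv).sad_smul (saddle_bot hv hij).symm (st_equivalence _ _
        _)).neg
  · intro v hv
    have := H0 v hv
    rw [sad_first hv (Ka v hv), sad_second hv (Kb v hv), sad_third hv (Kc v hv), st_snoc_none₂,
      st_snoc_none, st_none] at this
    rw [← map_zero (restr (Lev A.length)), ← this, smul_add (sad _ _ _)]
    congr 3
    abel
  · intro v hv
    have e1 := Ha v hv
    have e2 := Hc v hv
    have hp : rel (res A v ++ [some i, none, none]) (i, A.length + 2) (i + 1, A.length + 3) := by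
      refine rel_three hv fun f h1 h2 h3 h4 => ?_
      simp only [Step] at h1 h2 h3
      grind
    have hq : rel (res A v ++ [none, none, some i]) (i, A.length) (i + 1, A.length + 1) := by
      refine rel_three hv fun f h1 h2 h3 h4 => ?_
      simp only [Step] at h1 h2 h3
      grind
    have hc : rel (res A v ++ [some i, none, some i]) (i, A.length + 2) (i + 1, A.length + 1) := by
      refine rel_three hv fun f h1 h2 h3 h4 => ?_
      simp only [Step] at h1 h2 h3
      grind
    have hd : rel (res A v ++ [some i, none, some i]) (i + 1, A.length + 3) (i + 1, 0) :=
      rel_three hv fun f h1 h2 h3 h4 => h4 _ _ le_rfl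
    -- The split edges of the two plain states into the state with the circle leave two single
    -- variables; this identity balances them against the correction terms.
    have X := turn_exchange hij hv (Kac v hv)
    rw [sad_first_second hv hij (Kab v hv), sad_of hp, st_snoc_none₂, st_snoc_none, add_smul,
      (Kac v hv).eq _ _ hc, (Kac v hv).eq _ _ hd] at e1
    rw [sad_third_second hv hij (Kbc v hv), sad_of hq, st_none_cons₂ hv, st_none_cons hv, add_smul]
        at e2
    rw [edgeSum_add, eq_neg_of_add_eq_zero_left e1, eq_neg_of_add_eq_zero_left e2, hφij, hφji]
    simp only [smul_sub, smul_neg]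
    rw [eq_sub_of_add_eq X, ← map_zero (restr (Lev A.length))]
    congr 1
    simp only [smul_add, smul_sub, smul_neg]
    abel
  · intro v hv
    have e1 := Hb v hv
    rw [sad_second_first hv hij (Kab v hv), sad_second_third hv hij (Kbc v hv), st_snoc_none₂,
      st_none_cons hv] at e1
    have X := turn_exchange' hij hv (kac v hv)
    have e3 := congrArg (restr (Lev A.length)) e1
    rw [map_add, restr_neg_one_pow, map_zero, ← sub_eq_add_neg, map_sub] at e3
    rw [map_add, eq_neg_of_add_eq_zero_left e3, hφij, hφji, restr_neg_one_pow]
    simp only [smul_sub, smul_neg, map_sub, map_neg, X]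
    abel
  · intro v hv
    have e1 := Hab v hv
    have e2 := Hac v hv
    rw [sad_last_third hv hij (Kabc v hv), st_snoc_none₂] at e1
    rw [sad_of_not (not_rel_second hv hij), st_turn_none_turn hv, one_smul] at e2
    have e3 := edgeSum_sad (fun v hv => (saddle_top hv hij).symm) kac hv
    rw [hφij]
    simp only [sub_eq_add_neg]
    rw [edgeSum_add, edgeSum_neg, edgeSum_neg, e3, eq_neg_of_add_eq_zero_left e1,
      eq_neg_of_add_eq_zero_left e2, smul_neg, neg_neg, neg_neg, smul_neg, smul_neg, smul_comm]
    abel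
  · intro v hv
    have e1 := Hbc v hv
    have e2 := Hac v hv
    rw [sad_last_first hv hij (Kabc v hv), st_none_cons₂ hv] at e1
    rw [sad_of_not (not_rel_second hv hij), st_turn_none_turn hv, one_smul] at e2
    have e3 := edgeSum_sad (fun v hv => (saddle_bot hv hij).symm) kac hv
    rw [hφji]
    simp only [sub_eq_add_neg]
    rw [edgeSum_add, edgeSum_neg, edgeSum_neg, e3, eq_neg_of_add_eq_zero_left e1,
      eq_neg_of_add_eq_zero_left e2, smul_neg, neg_neg, neg_neg, smul_neg, smul_neg, smul_comm]
    abel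
  · exact h3

end

section

variable {A : List (ℕ × Bool)} {n i j : ℕ} (hij : i + 1 = j ∨ j + 1 = i)
  {φ φi φj φij φji : List Bool → Func}

include hij

-- Converse of the elimination: the reduced data are put on one copy of each state. The third
-- crossing's plain e_i and e_i e_j e_i receive zero, and e_i with a circle receives χ ⊗ u₋*.
set_option maxHeartbeats 800000 in
theorem Reduced.good (h : Reduced n A i j φ φi φj φij φji) :
    Good n (A ++ [(i, true), (j, true), (i, true)]) := by
  -- This choice is forced by the cocycle condition at [false, false, true], where splitting off the
  -- circle must cancel the saddle to e_j e_i.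
  obtain ⟨χ, hχ⟩ : ∃ χ : List Bool → Func, χ = fun v =>
    sad (St A [some i] v) (j, A.length) (botQ A.length i j) • φji v := ⟨_, rfl⟩
  have hχk : ∀ v : List Bool, v.length = A.length → Killed (St A [some i] v) (χ v) := fun v hv => by
    rw [hχ]
    exact (h.killed₂₁ v hv).sad_smul (saddle_bot hv hij) (st_equivalence _ _ _)
  have hχe : ∀ v : List Bool, v.length = A.length → edgeSum 0 A (St A [some i] v) χ v = 0 :=
    fun v hv => by
      rw [hχ, edgeSum_sad (fun v hv => saddle_bot hv hij) h.killed₂₁ hv, h.eq₂₁ v hv, smul_zero]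
  have hres : ∀ a b c, res [(i, true), (j, true), (i, true)] [a, b, c] =
    [resLetter (i, true) a, resLetter (j, true) b, resLetter (i, true) c] := fun _ _ _ => rfl
  obtain ⟨Φ, hΦ⟩ : ∃ Φ : List Bool → List Bool → Func, Φ = fun u v =>
      if u = [false, false, false] then ext A [none, none, none] v (φ v) else
      if u = [true, false, false] then ext A [some i, none, none] v (φi v) else
      if u = [false, true, false] then ext A [none, some j, none] v (φj v) else
      if u = [true, true, false] then -ext A [some i, some j, none] v (φij v) else
      if u = [false, true, true] then -ext A [none, some j, some i] v (φji v) else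
      if u = [true, false, true] then cir A [some i, none, some i] v (χ v) else 0 := ⟨_, rfl⟩
  have Φ0 : Φ [false, false, false] = fun v => ext A [none, none, none] v (φ v) := by simp [hΦ]
  have Φa : Φ [true, false, false] = fun v => ext A [some i, none, none] v (φi v) := by simp [hΦ]
  have Φb : Φ [false, true, false] = fun v => ext A [none, some j, none] v (φj v) := by simp [hΦ]
  have Φab : Φ [true, true, false] = fun v => -ext A [some i, some j, none] v (φij v) := by simp
      [hΦ]
  have Φbc : Φ [false, true, true] = fun v => -ext A [none, some j, some i] v (φji v) := by simp
      [hΦ]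
  have Φac : Φ [true, false, true] = fun v => cir A [some i, none, some i] v (χ v) := by simp [hΦ]
  have Φc : Φ [false, false, true] = fun _ => 0 := by simp [hΦ]
  have Φabc : Φ [true, true, true] = fun _ => 0 := by simp [hΦ]
  have K0 : ∀ v : List Bool, v.length = A.length →
      Killed (rel (res A v ++ [none, none, none])) (ext A [none, none, none] v (φ v)) := fun v hv =>
    Killed.ext (by rw [st_snoc_none₂, st_snoc_none, st_none]; exact h.killed v hv)
  have Ka : ∀ v : List Bool, v.length = A.length →
      Killed (rel (res A v ++ [some i, none, none])) (ext A [some i, none, none] v (φi v)) := fun v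
          hv =>
    Killed.ext (by rw [st_snoc_none₂, st_snoc_none]; exact h.killed₁ v hv)
  have Kb : ∀ v : List Bool, v.length = A.length →
      Killed (rel (res A v ++ [none, some j, none])) (ext A [none, some j, none] v (φj v)) := fun v
          hv =>
    Killed.ext (by rw [st_snoc_none₂, st_none_cons hv]; exact h.killed₂ v hv)
  have Kab : ∀ v : List Bool, v.length = A.length →
      Killed (rel (res A v ++ [some i, some j, none])) (ext A [some i, some j, none] v (φij v)) :=
    fun v hv => Killed.ext (by rw [st_snoc_none₂]; exact h.killed₁₂ v hv)
  have Kbc : ∀ v : List Bool, v.length = A.length →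
      Killed (rel (res A v ++ [none, some j, some i])) (ext A [none, some j, some i] v (φji v)) :=
    fun v hv => Killed.ext (by rw [st_none_cons₂ hv]; exact h.killed₂₁ v hv)
  have Kac : ∀ v : List Bool, v.length = A.length →
      Killed (rel (res A v ++ [some i, none, some i])) (cir A [some i, none, some i] v (χ v)) :=
    fun v hv => Killed.cir (by rw [st_turn_none_turn hv]; exact hχk v hv)
  refine good_append_of Φ ?_ ?_ ?_
  · intro u v hu hv
    obtain ⟨a, b, c, rfl⟩ := length_three hu
    rw [hres]
    cases a <;> cases b <;> cases c <;>
      simp only [resLetter, if_true, Bool.false_eq_true, if_false, Φ0, Φa, Φb, Φab, Φbc, Φac, Φc,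
          Φabc]
    exacts [K0 v hv, Killed.zero, Kb v hv, (Kbc v hv).neg, Ka v hv, Kac v hv, (Kab v hv).neg,
        Killed.zero]
  · rintro u v hu hv F hFeq hF
    obtain ⟨a, b, c, rfl⟩ := length_three hu
    have out : (a = false ∨ c = false) → restr (Lev A.length) F = 0 → F = 0 := by
      intro hac hr
      refine hF.eq_zero_of_outer (O := Lev A.length) ?_ hr
      rw [hres]
      refine exists_outer_three (i := i) (j := j) hv (by omega) (resLetter_cases (i, true) _)
          (resLetter_cases (j, true) _)
        (resLetter_cases (i, true) _) ?_
      rcases hac with rfl | rfl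
      exacts [Or.inl rfl, Or.inr rfl]
    rw [hres] at hF hFeq
    rw [← edgeSum_st] at hFeq
    cases a <;> cases b <;> cases c <;>
      simp only [edgeSum_triple, resLetter, if_true, Bool.false_eq_true, Bool.true_eq_false,
          if_false,
        one_smul, add_zero, zero_add, neg_smul, Φ0, Φa, Φb, Φab, Φbc, Φac, Φc, Φabc, smul_zero,
        edgeSum_zero] at hF hFeq
    · refine out (Or.inl rfl) ?_
      have := h.eq v hv
      rw [map_add, restr_edgeSum_lev, restr_neg_one_pow, map_add, restr_sad le_rfl (Nat.zero_le _),
        restr_sad le_rfl (Nat.zero_le _)] at this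
      rw [hFeq, sad_first hv (Ka v hv), sad_second hv (Kb v hv), st_snoc_none₂, st_snoc_none,
          st_none,
        map_add, restr_edgeSum_lev, restr_neg_one_pow, map_add, restr_sad le_rfl (Nat.zero_le _),
        restr_sad le_rfl (Nat.zero_le _)]
      simpa only [restr_ext] using this
    · refine out (Or.inl rfl) ?_
      have hq : rel (res A v ++ [none, none, some i]) (i, A.length) (i + 1, A.length + 1) := by
        refine rel_three hv fun f h1 h2 h3 h4 => ?_
        simp only [Step] at h1 h2 h3
        grind
      have hc : rel (res A v ++ [some i, none, some i]) (i + 1, A.length + 1) (i, A.length + 1) :=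
          by
        refine rel_three hv fun f h1 h2 h3 h4 => ?_
        simp only [Step] at h1 h2 h3
        grind
      rw [hFeq, smul_neg, sad_third_second hv hij (Kbc v hv), sad_of hq,
        add_smul, (Kac v hv).eq _ _ hc, restr_neg_one_pow, map_add, map_neg, map_add,
        restr_smul_cir_of_mem le_rfl, restr_smul_cir_of_inner (inner_turn_none_turn hv i),
        restr_sad le_rfl (botQ_snd _ _ _), restr_ext, hχ, restr_sad le_rfl (botQ_snd _ _ _)]
      simp
    · refine out (Or.inl rfl) ?_
      have := h.eq₂ v hv
      rw [map_add, restr_edgeSum_lev, restr_neg_one_pow, map_sub,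
        restr_sad (topP_snd _ _ _) (Nat.zero_le _), restr_sad le_rfl (botQ_snd _ _ _)] at this
      rw [hFeq, smul_neg, smul_neg, sad_second_first hv hij (Kab v hv), sad_second_third hv hij
          (Kbc v hv),
        st_snoc_none₂, st_none_cons hv, neg_neg, neg_add_eq_sub, map_add, restr_edgeSum_lev,
        restr_neg_one_pow, map_sub, restr_sad (topP_snd _ _ _) (Nat.zero_le _),
        restr_sad le_rfl (botQ_snd _ _ _)]
      simpa only [restr_ext] using this
    · refine out (Or.inl rfl) ?_
      rw [hFeq, st_none_cons₂ hv, edgeSum_neg, map_neg, restr_edgeSum_lev]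
      simp only [restr_ext]
      rw [← restr_edgeSum_lev, h.eq₂₁ v hv, map_zero, neg_zero]
    · refine out (Or.inr rfl) ?_
      have := h.eq₁ v hv
      rw [map_add, restr_edgeSum_lev, restr_neg_one_pow, map_sub,
        restr_sad (topP_snd _ _ _) (Nat.zero_le _), restr_sad le_rfl (botQ_snd _ _ _)] at this
      have hp : rel (res A v ++ [some i, none, none]) (i, A.length + 2) (i + 1, A.length + 3) := by
        refine rel_three hv fun f h1 h2 h3 h4 => ?_
        simp only [Step] at h1 h2 h3
        grind
      have hc : rel (res A v ++ [some i, none, some i]) (i, A.length + 2) (i, A.length + 1) := by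
        refine rel_three hv fun f h1 h2 h3 h4 => ?_
        simp only [Step] at h1 h2 h3
        grind
      have hd : rel (res A v ++ [some i, none, some i]) (i + 1, A.length + 3) (i + 1, 0) :=
        rel_three hv fun f h1 h2 h3 h4 => h4 _ _ le_rfl
      rw [hFeq, smul_neg, sad_first_second hv hij (Kab v hv), sad_of hp, st_snoc_none₂,
          st_snoc_none, neg_neg,
        add_smul, (Kac v hv).eq _ _ hc, (Kac v hv).eq _ _ hd, ← sub_eq_add_neg, map_add,
        restr_edgeSum_lev, restr_neg_one_pow, map_sub, map_add, restr_smul_cir_of_inner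
            (inner_turn_none_turn hv i),
        restr_smul_cir_of_mem (c := (i + 1, 0)) (Nat.zero_le _),
        restr_sad (topP_snd _ _ _) (Nat.zero_le _), add_zero, hχ, restr_sad le_rfl (botQ_snd _ _ _)]
      simpa only [restr_ext] using this
    · rw [hFeq] at hF ⊢
      exact edgeSum_cir (χ := χ) (c := (i, A.length + 1)) hv hF (outer_or_turn_none_turn hv i)
        (fun v hv => inner_turn_none_turn hv i) (by rw [st_turn_none_turn hv]; exact hχe v hv)
    · refine out (Or.inr rfl) ?_
      rw [hFeq, st_snoc_none₂, edgeSum_neg, map_neg, restr_edgeSum_lev]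
      simp only [restr_ext]
      rw [← restr_edgeSum_lev, h.eq₁₂ v hv, map_zero, neg_zero]
    · exact hFeq
  · have : orient [(i, true), (j, true), (i, true)] = [false, false, false] := rfl
    rw [this, Φ0, ext_apply_prod]
    exact h.unit

theorem good_braid (h : Good n (A ++ [(i, true), (j, true), (i, true)])) :
    Good n (A ++ [(j, true), (i, true), (j, true)]) := by
  obtain ⟨φ, φi, φj, φij, φji, h⟩ := exists_reduced_of_good hij h
  exact h.symm.good hij.symm

end

/-! ### Rotation of a closed word -/

theorem Step.congr {s s' : ℕ} {f g : Pt → Prop} {o : Option ℕ} (h : Step s f o)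
    (h0 : ∀ j, g (j, s') ↔ f (j, s)) (h1 : ∀ j, g (j, s' + 1) ↔ f (j, s + 1)) : Step s' g o := by
  cases o with
  | none => exact fun j => (h0 j).trans ((h j).trans (h1 j).symm)
  | some i =>
    simp only [Step, h0, h1] at h ⊢
    exact h

/-- The points of the closure of `E ++ [o]` that correspond to those of the closure of `o :: E`. -/
def rotPt (l : ℕ) (x : Pt) : Pt := (x.1, if x.2 = 0 then l else if x.2 ≤ l then x.2 - 1 else l)

theorem resp_cons {o : Option ℕ} {E : List (Option ℕ)} {f : Pt → Prop} :
    Resp (o :: E) f ↔ Step 0 f o ∧ (∀ t o', E[t]? = some o' → Step (t + 1) f o') ∧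
      ∀ j s, E.length + 1 ≤ s → (f (j, s) ↔ f (j, 0)) := by
  constructor
  · rintro ⟨h1, h2⟩
    exact ⟨h1 0 o rfl, fun t o' h => h1 (t + 1) o' (by simpa using h), fun j s hs => h2 j s (by
        simpa using hs)⟩
  · rintro ⟨h0, h1, h2⟩
    refine ⟨fun t o' h => ?_, fun j s hs => h2 j s (by simpa using hs)⟩
    rcases t with _ | t
    · obtain rfl : o = o' := by simpa using h
      exact h0
    · exact h1 t o' (by simpa using h)

theorem resp_concat {o : Option ℕ} {E : List (Option ℕ)} {f : Pt → Prop} :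
    Resp (E ++ [o]) f ↔ (∀ t o', E[t]? = some o' → Step t f o') ∧ Step E.length f o ∧
      ∀ j s, E.length + 1 ≤ s → (f (j, s) ↔ f (j, 0)) := by
  constructor
  · rintro ⟨h1, h2⟩
    refine ⟨fun t o' h => h1 t o' ?_, h1 E.length o (by simp), fun j s hs => h2 j s (by simpa using
        hs)⟩
    rw [List.getElem?_append_left (List.getElem?_eq_some_iff.1 h).1, h]
  · rintro ⟨h0, h1, h2⟩
    refine ⟨fun t o' h => ?_, fun j s hs => h2 j s (by simpa using hs)⟩
    rcases lt_trichotomy t E.length with ht | rfl | ht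
    · exact h0 t o' (by rwa [List.getElem?_append_left ht] at h)
    · obtain rfl : o = o' := by simpa using h
      exact h1
    · rw [List.getElem?_append_right ht.le] at h
      have := (List.getElem?_eq_some_iff.1 h).1
      simp at this
      omega

theorem rel_cons {o : Option ℕ} {E : List (Option ℕ)} (x y : Pt) :
    rel (o :: E) x y ↔ rel (E ++ [o]) (rotPt E.length x) (rotPt E.length y) := by
  constructor
  · intro h f hf
    refine h (fun z => f (rotPt E.length z)) ?_
    obtain ⟨h0, h1, h2⟩ := resp_concat.1 hf
    refine resp_cons.2 ⟨h1.congr (fun j => by simp [rotPt]) (fun j => ?_), fun t o' ht => ?_, fun j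
        s hs => ?_⟩
    · rw [h2 j _ le_rfl]
      rcases Nat.eq_zero_or_pos E.length with h3 | h3
      · simp [rotPt, h3]
      · have : 1 ≤ E.length := h3
        simp [rotPt, this]
    · have := (List.getElem?_eq_some_iff.1 ht).1
      refine (h0 t o' ht).congr (fun j => ?_) (fun j => ?_) <;> simp only [rotPt]
      · rw [if_neg (by omega), if_pos (by omega), Nat.add_sub_cancel]
      · rw [if_neg (by omega)]
        split_ifs with h3
        · rfl
        · rw [show E.length = t + 1 by omega]
    · have h3 : s ≠ 0 := by omega
      have h4 : ¬ s ≤ E.length := by omega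
      simp [rotPt, h3, h4]
  · intro h g hg
    obtain ⟨h0, h1, h2⟩ := resp_cons.1 hg
    -- The inverse shift of levels. Levels above `E.length` are identified with level 0 of the
    -- rotated word, which is level 1 of the original one.
    have key : ∀ z, g z ↔ (fun z : Pt => g (z.1, if z.2 ≤ E.length then z.2 + 1 else 1)) (rotPt
        E.length z) := by
      rintro ⟨j, s⟩
      dsimp only [rotPt]
      split_ifs with h3 h4 h5 h6
      · rw [h3, h2 j _ le_rfl]
      · omega
      · rw [show s - 1 + 1 = s by omega]
      · omega
      · rw [h2 j _ le_rfl, h2 j s (by omega)]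
      · omega
    rw [key x, key y]
    refine h (fun z : Pt => g (z.1, if z.2 ≤ E.length then z.2 + 1 else 1)) (resp_concat.2 ⟨fun t
        o' ht => ?_, h0.congr (fun j => ?_) (fun j => ?_), fun j s hs => ?_⟩)
    · have := (List.getElem?_eq_some_iff.1 ht).1
      refine (h1 t o' ht).congr (fun j => ?_) (fun j => ?_) <;> dsimp only
      · rw [if_pos (by omega)]
      · rw [if_pos (by omega)]
    · dsimp only
      rw [if_pos le_rfl, h2 j _ le_rfl]
    · dsimp only
      rw [if_neg (by omega)]
    · dsimp only
      rw [if_neg (by omega), if_pos (by omega)]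

/-- The functional that substitutes variables along `h`. -/
noncomputable def pull (h : Pt → Pt) (φ : Func) : Func :=
  LinearMap.comp (show PtRing →ₗ[ℤ] ℤ from φ) (rename (R := ℤ) h).toLinearMap

theorem pull_apply (h : Pt → Pt) (φ : Func) (a : PtRing) : pull h φ a = φ (rename h a) := rfl

theorem smul_pull (h : Pt → Pt) (φ : Func) (a : PtRing) : a • pull h φ = pull h (rename h a • φ) :=
    by
  ext b
  simp [pull_apply]

theorem pull_add (h : Pt → Pt) (φ ψ : Func) : pull h (φ + ψ) = pull h φ + pull h ψ := rfl

theorem pull_zero (h : Pt → Pt) : pull h 0 = 0 := rfl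

theorem pull_sum {ι : Type*} (h : Pt → Pt) (s : Finset ι) (f : ι → Func) :
    pull h (∑ i ∈ s, f i) = ∑ i ∈ s, pull h (f i) := by
  classical
  induction s using Finset.induction_on with
  | empty => simp [pull_zero]
  | insert a s ha ih => rw [Finset.sum_insert ha, Finset.sum_insert ha, pull_add, ih]

section

variable {h : Pt → Pt} {r r' : Pt → Pt → Prop} (hr : ∀ x y, r x y ↔ r' (h x) (h y))

include hr

theorem Killed.pull {φ : Func} (hφ : Killed r' φ) : Killed r (pull h φ) := by
  refine ⟨fun x y hxy => ?_, fun x => ?_⟩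
  · rw [smul_pull, smul_pull, rename_X, rename_X, hφ.eq _ _ ((hr x y).1 hxy)]
  · rw [smul_pull, smul_pull, rename_X, hφ.sq, pull_zero]

theorem rename_sad (p q : Pt) : rename h (sad r p q) = sad r' (h p) (h q) := by
  by_cases hpq : r p q
  · rw [sad_of hpq, sad_of ((hr p q).1 hpq), map_add, rename_X, rename_X]
  · rw [sad_of_not hpq, sad_of_not fun h' => hpq ((hr p q).2 h'), map_one]

end

theorem Killed.prod_smul_eq {r : Pt → Pt → Prop} {φ : Func} (h : Killed r φ) (s : Finset ℕ)
    {f g : ℕ → Pt} (hfg : ∀ j, r (f j) (g j)) :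
    (∏ j ∈ s, X (f j) : PtRing) • φ = (∏ j ∈ s, X (g j) : PtRing) • φ := by
  classical
  induction s using Finset.induction_on with
  | empty => simp
  | insert a s ha ih =>
    rw [Finset.prod_insert ha, Finset.prod_insert ha, mul_smul, mul_smul, ih, smul_comm, h.eq _ _
        (hfg a),
      smul_comm]

theorem rel_orient (w : List (ℕ × Bool)) (j s : ℕ) : rel (res w (orient w)) (j, s) (j, 0) := by
  intro f hf
  induction s with
  | zero => rfl
  | succ s ih =>
    rw [← ih]
    rcases lt_or_ge s w.length with hs | hs
    · have := hf.1 s none (by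
        rw [res, orient, List.getElem?_zipWith, List.getElem?_map, List.getElem?_eq_getElem hs]
        simp [resLetter])
      exact (this j).symm
    · rw [hf.2 j s (by simpa [length_res] using hs), hf.2 j (s + 1) (by simp [length_res]; omega)]

theorem edgeSum_pull {h : Pt → Pt} {r r' : Pt → Pt → Prop} (hr : ∀ x y, r x y ↔ r' (h x) (h y))
    {l l' : ℕ} {w : List (ℕ × Bool)} (hh : ∀ j s, s ≤ w.length → h (j, l + s) = (j, l' + s))
    (φ : List Bool → Func) (v : List Bool) :
    edgeSum l w r (fun v => pull h (φ v)) v = pull h (edgeSum l' w r' φ v) := by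
  rw [edgeSum, edgeSum, pull_sum]
  refine Finset.sum_congr rfl fun t ht => ?_
  have ht := Finset.mem_range.1 ht
  split_ifs
  · rw [smul_pull, map_mul, rename_sad hr, hh _ _ ht.le, add_assoc, hh _ _ ht]
    simp [sgn, add_assoc]
  · rw [pull_zero]

theorem edgeSum_count {l : ℕ} {w : List (ℕ × Bool)} {r : Pt → Pt → Prop} (φ : List Bool → Func)
    {v : List Bool} : edgeSum l w r (fun v => ((-1) ^ v.count true : PtRing) • φ v) v =
      -((-1) ^ v.count true : PtRing) • edgeSum l w r φ v := by
  rw [← edgeSum_smul]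
  refine edgeSum_congr (φ := fun v => ((-1) ^ v.count true : PtRing) • φ v)
    (ψ := fun v' => -((-1) ^ v.count true : PtRing) • φ v') (fun _ _ _ _ => Iff.rfl) fun t ht hv =>
        ?_
  obtain ⟨htv, hv⟩ := List.getElem?_eq_some_iff.1 hv
  have : (v.set t true).count true = v.count true + 1 := by
    rw [List.count_set htv, hv]
    simp
  rw [this, pow_succ, mul_neg_one]

/-- When the last direction of the cube becomes the first, its edge at `v` loses the sign
(-1)^(number of ones of `v`), and the other edges gain a sign where the new first coordinate is 1.
Multiplying the functionals there by the former sign compensates both. -/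
theorem good_rotate {n : ℕ} {A : List (ℕ × Bool)} {a : ℕ × Bool} (h : Good n (A ++ [a])) :
    Good n (a :: A) := by
  obtain ⟨Φ, h1, h2, h3⟩ := good_append.1 h
  have hrel : ∀ b v, v.length = A.length → ∀ x y : Pt, rel (res (a :: A) (b :: v)) x y ↔
      rel (res A v ++ res [a] [b]) (rotPt A.length x) (rotPt A.length y) := by
    intro b v hv x y
    rw [← length_res hv]
    exact rel_cons x y
  refine (good_append (A := [a]) (X := A)).2 ⟨fun v u => if u = [true] then
    ((-1) ^ v.count true : PtRing) • pull (rotPt A.length) (Φ u v) else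
    pull (rotPt A.length) (Φ u v), ?_, ?_, ?_⟩
  · intro v u hv hu
    obtain ⟨b, rfl⟩ := length_one hu
    have := (h1 [b] v rfl hv).pull (hrel b v hv)
    dsimp only
    split_ifs
    exacts [this.smul _, this]
  · intro v u hv hu
    obtain ⟨b, rfl⟩ := length_one hu
    have hr : ∀ x y : Pt, rel (res [a] [b] ++ res A v) x y ↔
      rel (res A v ++ res [a] [b]) (rotPt A.length x) (rotPt A.length y) := hrel b v hv
    have hh : ∀ j s, s ≤ A.length → rotPt A.length (j, [a].length + s) = (j, 0 + s) := by
      intro j s hs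
      have h0 : ¬ 1 + s = 0 := by omega
      simp only [rotPt, List.length_singleton, h0, if_false, zero_add]
      split_ifs
      · rw [Nat.add_sub_cancel_left]
      · rw [show A.length = s by omega]
    have H := h2 [b] v rfl hv
    have P := congrArg (pull (rotPt A.length)) H
    rw [pull_add, pull_zero, ← edgeSum_pull hr hh] at P
    cases b
    · simp only [edgeSum_singleton, if_true, List.cons.injEq, Bool.false_eq_true, false_and,
          if_false] at P ⊢
      rw [smul_comm, smul_pull, rename_sad hr]
      have hE := rel_equivalence (res A v ++ res [a] [false])
      have hE' := rel_equivalence (res A v ++ res [a] [true])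
      have hp : rotPt A.length (a.1, 0) = (a.1, A.length) := rfl
      have hq : ∀ b, rel (res A v ++ res [a] [b]) (rotPt A.length (a.1 + 1, 0 + 1))
          (a.1 + 1, A.length + 1) := by
        intro b f hf
        have hl := length_res hv
        have := ((resp_one hl).1 hf).2.2 (a.1 + 1)
        rw [this _ le_rfl]
        simp only [rotPt]
        rcases Nat.eq_zero_or_pos A.length with h3 | h3
        · simp [h3]
        · have : 1 ≤ A.length := h3
          simp [this]
      rw [sad_smul_congr hE (hE.refl _) (hq _) (hE'.refl _) (hq _) (h1 [true] v rfl hv), hp]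
      rw [← P, add_comm]
      congr 1
      · simp
      · have := smul_pull (rotPt A.length) (sad (rel (res A v ++ res [a] [false])) (a.1, A.length)
          (a.1 + 1, A.length + 1) • Φ [true] v) ((-1) ^ v.count true)
        rw [this]
        simp
    · simp only [edgeSum_singleton, if_true, Bool.true_eq_false, if_false, smul_zero, pull_zero,
          add_zero] at P ⊢
      rw [edgeSum_count, P]
      simp
  -- The product over level 0 becomes the product over the level `A.length`; in the oriented
  -- resolution these points lie on the same vertical strings.
  · have hu : IsUnit (pull (rotPt A.length) (Φ (orient [a]) (orient A))
        (∏ j ∈ Finset.range (n + 1), X (j, 0))) := by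
      have hk := h1 (orient [a]) (orient A) (by simp) (by simp)
      have he : res A (orient A) ++ res [a] (orient [a]) = res (A ++ [a]) (orient (A ++ [a])) := by
        rw [← res_append (by simp)]
        simp [orient]
      rw [he] at hk
      have := hk.prod_smul_eq (Finset.range (n + 1)) (f := fun j => (j, A.length)) (g := fun j =>
          (j, 0))
        fun j => rel_orient _ _ _
      have := DFunLike.congr_fun this 1
      rw [Func.smul_apply, Func.smul_apply, mul_one, mul_one] at this
      rw [pull_apply, map_prod]
      simp only [rename_X]
      exact this ▸ h3
    dsimp only
    split_ifs
    · rw [Func.smul_apply]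
      rcases neg_one_pow_eq_or PtRing ((orient A).count true) with h | h <;> rw [h]
      · rwa [one_mul]
      · rw [neg_one_mul, map_neg]
        exact hu.neg
    · exact hu

/-! ### Invariance under the transverse Markov moves -/

theorem good_append_comm {n : ℕ} {A B : List (ℕ × Bool)} : Good n (A ++ B) ↔ Good n (B ++ A) := by
  have key : ∀ B A : List (ℕ × Bool), Good n (A ++ B) → Good n (B ++ A) := by
    intro B
    induction B using List.reverseRecOn with
    | nil => intro A h; simpa using h
    | append_singleton B b ih =>
      intro A h
      rw [← List.append_assoc] at h
      have := ih (b :: A) (good_rotate h)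
      simpa using this
  exact ⟨key B A, key A B⟩

/-- The letters of a braid word without the bound on the number of strings. -/
def BraidWord.letters {n : ℕ} (w : BraidWord n) : List (ℕ × Bool) := w.map fun l => (l.1.val, l.2)

theorem BraidWord.letters_append {n : ℕ} (w w' : BraidWord n) :
    BraidWord.letters (w ++ w') = w.letters ++ w'.letters := List.map_append

theorem BraidWord.toBraid_append {n : ℕ} (w w' : BraidWord n) :
    BraidWord.toBraid (w ++ w') = w.toBraid * w'.toBraid := by simp [BraidWord.toBraid]

/-- Two braid words are interchangeable in words for which `Good` holds. -/
def goodCon (n : ℕ) : Con (FreeMonoid (Fin n × Bool)) where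
  r x y := ∀ A, Good n (A ++ BraidWord.letters x.toList) ↔ Good n (A ++ BraidWord.letters y.toList)
  iseqv := ⟨fun _ _ => Iff.rfl, fun h A => (h A).symm, fun h h' A => (h A).trans (h' A)⟩
  -- Contexts on the left suffice for a two-sided congruence, because `Good` is invariant under
  -- rotation.
  mul' := by
    intro x y x' y' h h' A
    rw [FreeMonoid.toList_mul, FreeMonoid.toList_mul, BraidWord.letters_append,
        BraidWord.letters_append,
      ← List.append_assoc, h', good_append_comm, ← List.append_assoc, h, List.append_assoc,
      good_append_comm, List.append_assoc]

theorem goodCon_mk_eq {n : ℕ} {x y : BraidWord n} :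
    ((FreeMonoid.ofList x : FreeMonoid (Fin n × Bool)) : (goodCon n).Quotient) =
      (FreeMonoid.ofList y : FreeMonoid (Fin n × Bool)) ↔
    ∀ A, Good n (A ++ x.letters) ↔ Good n (A ++ y.letters) := Con.eq _

theorem goodCon_inverse {n : ℕ} (i : Fin n) (ε : Bool) :
    ((FreeMonoid.ofList [(i, ε), (i, !ε)] : FreeMonoid (Fin n × Bool)) : (goodCon n).Quotient) = 1
        :=
  goodCon_mk_eq (y := []).2 fun A => by
    simp only [BraidWord.letters, List.map_cons, List.map_nil, List.append_nil]
    exact ⟨good_of_insert i.2, good_insert _ _⟩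

/-- The class of a generator. -/
def goodUnit {n : ℕ} (i : Fin n) : (goodCon n).Quotientˣ where
  val := (FreeMonoid.ofList [(i, true)] : FreeMonoid (Fin n × Bool))
  inv := (FreeMonoid.ofList [(i, false)] : FreeMonoid (Fin n × Bool))
  val_inv := goodCon_inverse i true
  inv_val := goodCon_inverse i false

/-- Commutation and the braid relation are exactly Artin's relators, so the universal property of
the presentation maps the braid group to the units of the quotient monoid. Hence words of one braid
are congruent. -/
theorem goodUnit_rels {n : ℕ} : ∀ r ∈ artinRels n, FreeGroup.lift (goodUnit (n := n)) r = 1 := by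
  rintro r (⟨i, j, hij, rfl⟩ | ⟨i, j, hij, rfl⟩)
  · rw [map_mul, map_inv, mul_inv_eq_one]
    simp only [map_mul, FreeGroup.lift_apply_of]
    refine Units.ext (goodCon_mk_eq (x := [(i, true), (j, true)]) (y := [(j, true), (i, true)]).2
        fun A => ?_)
    exact ⟨good_far_comm (Or.inl hij), good_far_comm (Or.inr hij)⟩
  · rw [map_mul, map_inv, mul_inv_eq_one]
    simp only [map_mul, FreeGroup.lift_apply_of]
    refine Units.ext (goodCon_mk_eq (x := [(i, true), (j, true), (i, true)])
      (y := [(j, true), (i, true), (j, true)]).2 fun A => ?_)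
    exact ⟨good_braid (Or.inl hij), good_braid (Or.inr hij)⟩

theorem goodCon_of_toBraid {n : ℕ} (w : BraidWord n) :
    ((PresentedGroup.toGroup goodUnit_rels w.toBraid : (goodCon n).Quotientˣ) : (goodCon
        n).Quotient) =
      (FreeMonoid.ofList w : FreeMonoid (Fin n × Bool)) := by
  induction w with
  | nil => simp [BraidWord.toBraid]
  | cons a w ih =>
    have h1 : BraidWord.toBraid (a :: w) = BraidWord.toBraid [a] * BraidWord.toBraid w :=
      BraidWord.toBraid_append [a] w
    rw [h1, map_mul, Units.val_mul, ih, FreeMonoid.ofList_cons, Con.coe_mul]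
    congr 1
    obtain ⟨i, b⟩ := a
    cases b <;> simp [BraidWord.toBraid, sigma, PresentedGroup.toGroup.of] <;> rfl

/-- `Good` depends only on the braid. -/
theorem good_congr {n : ℕ} {w w' : BraidWord n} (h : w.toBraid = w'.toBraid) (A : List (ℕ × Bool)) :
    Good n (A ++ w.letters) ↔ Good n (A ++ w'.letters) := by
  refine goodCon_mk_eq.1 ?_ A
  rw [← goodCon_of_toBraid, h, goodCon_of_toBraid]

theorem exists_toBraid_eq {n : ℕ} (β : BraidGroup n) : ∃ w : BraidWord n, w.toBraid = β := by
  induction β using PresentedGroup.induction_on with | _ x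
  induction x using FreeGroup.induction_on with
  | C1 => exact ⟨[], rfl⟩
  | of i => exact ⟨[(i, true)], by simp [BraidWord.toBraid]; rfl⟩
  | inv_of i _ => exact ⟨[(i, false)], by simp [BraidWord.toBraid]; rfl⟩
  | mul x y hx hy =>
    obtain ⟨u, hu⟩ := hx
    obtain ⟨v, hv⟩ := hy
    exact ⟨u ++ v, by rw [BraidWord.toBraid_append, hu, hv, map_mul]⟩

/-- A word x w y for the conjugate rotates to one in which y x, a word of the trivial braid, can be
deleted. -/
theorem good_of_isConj {n : ℕ} {w w' : BraidWord n} (h : IsConj w.toBraid w'.toBraid) :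
    Good n w.letters ↔ Good n w'.letters := by
  obtain ⟨c, hc⟩ := isConj_iff.1 h
  obtain ⟨x, hx⟩ := exists_toBraid_eq c
  obtain ⟨y, hy⟩ := exists_toBraid_eq c⁻¹
  have h1 := good_congr (w := x ++ w ++ y) (w' := w')
    (by rw [BraidWord.toBraid_append, BraidWord.toBraid_append, hx, hy, hc]) []
  have h2 := good_congr (w := y ++ x) (w' := []) (by
    rw [BraidWord.toBraid_append, hx, hy, inv_mul_cancel]; rfl) w.letters
  simp only [List.nil_append, BraidWord.letters_append] at h1 h2
  rw [← h1, good_append_comm, ← List.append_assoc, good_append_comm, h2]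
  simp [BraidWord.letters]

theorem BraidWord.letters_stabilize {n : ℕ} (w : BraidWord n) :
    w.stabilize.letters = w.letters ++ [(n, true)] := by
  simp [BraidWord.letters, BraidWord.stabilize]

theorem good_stabilize_iff {n : ℕ} (w : BraidWord n) :
    Good n w.letters ↔ Good (n + 1) w.stabilize.letters := by
  rw [BraidWord.letters_stabilize]
  refine ⟨good_stabilize fun x hx => ?_, good_of_stabilize⟩
  simp only [BraidWord.letters, List.mem_map] at hx
  obtain ⟨l, -, rfl⟩ := hx
  exact l.1.2

theorem good_of_sameTransverseLink {x y : Σ n, BraidWord n} (h : SameTransverseLink x y) :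
    Good x.1 x.2.letters ↔ Good y.1 y.2.letters := by
  induction h with
  | rel x y h =>
    cases h with
    | conj w w' h => exact good_of_isConj h
    | stab w => exact good_stabilize_iff w
  | refl => exact Iff.rfl
  | symm _ _ _ ih => exact ih.symm
  | trans _ _ _ _ _ ih ih' => exact ih.trans ih'

/-! ### Quasipositive braids -/

/-- The circles are the vertical strings, and the functional takes the coefficient of the product of
their variables: the dual basis vector of ψ. It vanishes on squares because that monomial is
squarefree. -/
theorem good_nil (n : ℕ) : Good n [] := by
  obtain ⟨m, hm⟩ : ∃ m : Pt →₀ ℕ, m = ∑ j ∈ Finset.range (n + 1), Finsupp.single (j, 0) 1 := ⟨_,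
      rfl⟩
  refine ⟨fun _ => pull (fun x => (x.1, 0)) (show Func from lcoeff ℤ m), fun v _ => ⟨fun x y hxy =>
      ?_,
    fun x => ?_⟩, fun v _ => rfl, ?_⟩
  · have : x.1 = y.1 := by
      have := hxy (fun z => z.1 = x.1) ⟨fun t o h => by simp [res] at h, fun _ _ _ => Iff.rfl⟩
      exact (this.1 rfl).symm
    rw [smul_pull, smul_pull, rename_X, rename_X, this]
  · rw [smul_pull, smul_pull, rename_X]
    ext a
    have : m (x.1, 0) ≤ 1 := by
      rw [hm, Finsupp.finsetSum_apply]
      simp only [Finsupp.single_apply, Prod.mk.injEq, and_true, Finset.sum_ite_eq']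
      split_ifs <;> omega
    change coeff m (X _ * (X _ * rename _ a)) = 0
    rw [coeff_X_mul', coeff_X_mul']
    split_ifs with h1 h2
    · simp at h2
      omega
    · rfl
    · rfl
  · change IsUnit (coeff m (rename _ (∏ j ∈ Finset.range (n + 1), X (j, 0))))
    have : (∏ j ∈ Finset.range (n + 1), X (j, 0) : PtRing) = monomial m 1 := by
      rw [hm, monomial_sum_one]
      rfl
    rw [map_prod]
    simp only [rename_X]
    rw [this, coeff_monomial, if_pos rfl]
    exact isUnit_one

/-- Appending a word of a quasipositive braid preserves `Good`. For one conjugate, the trivial word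
x y is inserted, the word is rotated so that x stands at the end, and the generator is added there.
-/
theorem good_of_isQuasipositive {n : ℕ} {w : BraidWord n} (h : IsQuasipositive w.toBraid) :
    Good n w.letters := by
  have key : ∀ (β : BraidGroup n), IsQuasipositive β → ∀ (A : List (ℕ × Bool)) (u : BraidWord n),
      u.toBraid = β → Good n A → Good n (A ++ u.letters) := by
    intro β h
    refine Submonoid.closure_induction (motive := fun β _ => ∀ (A : List (ℕ × Bool)) (u : BraidWord
        n),
      u.toBraid = β → Good n A → Good n (A ++ u.letters)) ?_ ?_ ?_ h
    · rintro _ ⟨g, i, rfl⟩ A u hu hA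
      obtain ⟨x, hx⟩ := exists_toBraid_eq g
      obtain ⟨y, hy⟩ := exists_toBraid_eq g⁻¹
      have h1 := good_congr (w := x ++ y) (w' := []) (by
        rw [BraidWord.toBraid_append, hx, hy, mul_inv_cancel]; rfl) A
      have h2 := good_congr (w := x ++ [(i, true)] ++ y) (w' := u) (by
        rw [BraidWord.toBraid_append, BraidWord.toBraid_append, hx, hy, hu]
        simp [BraidWord.toBraid]) A
      rw [← h2]
      have h3 : Good n ((A ++ x.letters) ++ y.letters) := by
        rw [List.append_assoc, ← BraidWord.letters_append, h1]
        simpa [BraidWord.letters] using hA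
      have := good_append_positive (i : ℕ) (good_append_comm.1 h3)
      rw [List.append_assoc, good_append_comm] at this
      simpa [BraidWord.letters] using this
    · intro A u hu hA
      rw [good_congr (w' := []) hu]
      simpa [BraidWord.letters] using hA
    · intro a b _ _ ha hb A u hu hA
      obtain ⟨x, hx⟩ := exists_toBraid_eq a
      obtain ⟨y, hy⟩ := exists_toBraid_eq b
      rw [good_congr (w' := x ++ y) (by rw [hu, BraidWord.toBraid_append, hx, hy]),
        BraidWord.letters_append, ← List.append_assoc]
      exact hb _ y hy (ha _ x hx hA)
  simpa using key _ h [] w rfl (good_nil n)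

/-! ### Circles of the diagram as classes of points -/

section

variable {n : ℕ} {w : BraidWord n}

/-- The point of the plane that underlies a point of a diagram. -/
def toPt (x : Point w) : Pt := (x.1, x.2)

/-- The circles at a vertex of the cube, as a relation on points. -/
def circleRel (v : Vertex w) : Pt → Pt → Prop := rel (res w.letters (List.ofFn v))

theorem length_letters (w : BraidWord n) : w.letters.length = w.length := by simp
    [BraidWord.letters]

theorem getElem?_res (v : Vertex w) (t : Fin w.length) :
    (res w.letters (List.ofFn v))[(t : ℕ)]? = some (resLetter ((w.get t).1.val, (w.get t).2) (v t))
        := by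
  rw [res, List.getElem?_zipWith]
  simp [BraidWord.letters]

theorem step_res (v : Vertex w) {f : Pt → Prop} (hf : Resp (res w.letters (List.ofFn v)) f)
    (t : Fin w.length) : Step t f (resLetter ((w.get t).1.val, (w.get t).2) (v t)) :=
  hf.1 t _ (getElem?_res v t)

theorem resLetter_of_isParallel {v : Vertex w} {t : Fin w.length} (h : IsParallel w v t) :
    resLetter ((w.get t).1.val, (w.get t).2) (v t) = none := by
  refine if_neg fun h' => ?_
  simp only [IsParallel, IsPos] at h
  rw [h'] at h
  revert h
  cases (w.get t).2 <;> simp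

theorem resLetter_of_not_isParallel {v : Vertex w} {t : Fin w.length} (h : ¬ IsParallel w v t) :
    resLetter ((w.get t).1.val, (w.get t).2) (v t) = some (w.get t).1.val := by
  refine if_pos ?_
  simp only [IsParallel, IsPos] at h
  revert h
  cases (w.get t).2 <;> cases v t <;> simp

theorem length_res_letters (v : Vertex w) : (res w.letters (List.ofFn v)).length = w.length := by
  rw [length_res (by simp [length_letters]), length_letters]

theorem Joined.circleRel {v : Vertex w} {x y : Point w} (h : Joined w v x y) :
    circleRel v (toPt x) (toPt y) := by
  intro f hf
  have hs := step_res v hf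
  cases h with
  | away t j hl hr =>
    have h1 : (j : ℕ) ≠ (w.get t).1.val := fun h => hl (Fin.ext h)
    have h2 : (j : ℕ) ≠ (w.get t).1.val + 1 := fun h => hr (Fin.ext h)
    have := hs t
    by_cases hp : IsParallel w v t
    · rw [resLetter_of_isParallel hp] at this
      exact this j
    · rw [resLetter_of_not_isParallel hp] at this
      exact this.2.2 j h1 h2
  | parallelLeft t hp =>
    have := hs t
    rw [resLetter_of_isParallel hp] at this
    exact this _
  | parallelRight t hp =>
    have := hs t
    rw [resLetter_of_isParallel hp] at this
    exact this _
  | turnBefore t hp =>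
    have := hs t
    rw [resLetter_of_not_isParallel hp] at this
    exact this.1
  | turnAfter t hp =>
    have := hs t
    rw [resLetter_of_not_isParallel hp] at this
    exact this.2.1
  | closing j => exact hf.2 j _ (length_res_letters v).le

/-- Circles are defined by generating arcs and `rel` by invariant predicates. Each arc is respected
by every invariant predicate; conversely the circle through `x` yields such a predicate. -/
theorem circle_eq_iff {v : Vertex w} {x y : Point w} :
    circle w v x = circle w v y ↔ circleRel v (toPt x) (toPt y) := by
  constructor
  · intro h f hf
    have := congrArg (Quot.lift (fun z : Point w => f (toPt z)) fun a b hab => propext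
        (hab.circleRel f hf)) h
    exact iff_of_eq this
  · intro h
    -- The circle of `x` as a predicate on all of ℕ × ℕ: levels beyond the word are read at level 0,
    -- and strings outside the braid get the value false.
    obtain ⟨f, hf⟩ : ∃ f : Pt → Prop, f = fun z => ∃ a : Point w, toPt a = (z.1, if z.2 ≤ w.length
        then z.2 else 0) ∧
      circle w v a = circle w v x := ⟨_, rfl⟩
    have hpt : ∀ a : Point w, f (toPt a) ↔ circle w v a = circle w v x := by
      intro a
      have h1 : (a.2 : ℕ) ≤ w.length := Nat.lt_succ_iff.1 a.2.2
      simp only [hf, toPt, h1, if_true]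
      constructor
      · rintro ⟨b, hb, hbx⟩
        have : b = a := by
          simp only [Prod.mk.injEq, Fin.val_inj] at hb
          exact Prod.ext hb.1 hb.2
        rwa [← this]
      · exact fun h => ⟨a, rfl, h⟩
    have hne : ∀ j s, n + 1 ≤ j → ¬ f (j, s) := by
      intro j s hj
      simp only [hf, toPt]
      rintro ⟨a, ha, -⟩
      have := a.1.2
      simp only [Prod.mk.injEq] at ha
      omega
    have hJ : ∀ a b : Point w, Joined w v a b → (f (toPt a) ↔ f (toPt b)) := by
      intro a b hab
      rw [hpt, hpt, show circle w v a = circle w v b from Quot.sound hab]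
    have hresp : Resp (res w.letters (List.ofFn v)) f := by
      refine ⟨fun t o ho => ?_, fun j s hs => ?_⟩
      · have ht : t < w.length := by
          rw [← length_res_letters v]
          exact (List.getElem?_eq_some_iff.1 ho).1
        obtain ⟨t, rfl⟩ : ∃ t' : Fin w.length, t = t' := ⟨⟨t, ht⟩, rfl⟩
        rw [getElem?_res, Option.some.injEq] at ho
        rw [← ho]
        have haway : ∀ j, j ≠ (w.get t).1.val → j ≠ (w.get t).1.val + 1 →
            (f (j, (t : ℕ)) ↔ f (j, (t : ℕ) + 1)) := by
          intro j h1 h2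
          rcases lt_or_ge j (n + 1) with hj | hj
          · exact hJ _ _ (Joined.away t ⟨j, hj⟩ (fun h => h1 (congrArg Fin.val h))
              fun h => h2 (congrArg Fin.val h))
          · exact iff_of_false (hne _ _ hj) (hne _ _ hj)
        by_cases hp : IsParallel w v t
        · rw [resLetter_of_isParallel hp]
          intro j
          by_cases h1 : j = (w.get t).1.val
          · subst h1
            exact hJ _ _ (Joined.parallelLeft t hp)
          by_cases h2 : j = (w.get t).1.val + 1
          · subst h2
            exact hJ _ _ (Joined.parallelRight t hp)
          exact haway j h1 h2
        · rw [resLetter_of_not_isParallel hp]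
          exact ⟨hJ _ _ (Joined.turnBefore t hp), hJ _ _ (Joined.turnAfter t hp), haway⟩
      · rw [length_res_letters] at hs
        rcases hs.eq_or_lt with rfl | hs
        · rcases lt_or_ge j (n + 1) with hj | hj
          · exact hJ _ _ (Joined.closing ⟨j, hj⟩)
          · exact iff_of_false (hne _ _ hj) (hne _ _ hj)
        · simp [hf, hs.not_ge]
    exact ((hpt y).1 ((h f hresp).1 ((hpt x).2 rfl))).symm

theorem toPt_out {v : Vertex w} (x : Point w) :
    circleRel v (toPt (Quot.out (circle w v x) : Point w)) (toPt x) :=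
  circle_eq_iff.1 (Quot.out_eq _)

/-! ### The cocycle on the Khovanov complex -/

noncomputable instance (v : Vertex w) : Fintype (Circle w v) := Fintype.ofFinite _

/-- The variable of a circle with label `u₋`. -/
noncomputable def labelTerm (a : Label) (z : Pt) : PtRing :=
  match a with
  | .plus => 1
  | .minus => X z

/-- The monomial of a labelling of the circles. -/
noncomputable def labelProd {v : Vertex w} (y : Circle w v → Label) : PtRing :=
  ∏ c, labelTerm (y c) (toPt (Quot.out c : Point w))

open Classical in
/-- The monomial of the circles that do not pass through `p` and `q`. -/
noncomputable def labelProdAway {v : Vertex w} (y : Circle w v → Label) (p q : Point w) : PtRing :=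
  ∏ c ∈ (Finset.univ.erase (circle w v p)).erase (circle w v q),
    labelTerm (y c) (toPt (Quot.out c : Point w))

theorem Killed.labelTerm {r : Pt → Pt → Prop} {F : Func} (h : Killed r F) (a : Label) {z z' : Pt}
    (hz : r z z') : labelTerm a z • F = labelTerm a z' • F := by
  cases a
  exacts [rfl, h.eq _ _ hz]

theorem Killed.prod_labelTerm {r : Pt → Pt → Prop} {F : Func} (h : Killed r F) {ι : Type*} (s :
    Finset ι)
    (a : ι → Label) {f g : ι → Pt} (hfg : ∀ j ∈ s, r (f j) (g j)) :
    (∏ j ∈ s, TransverseKhovanov.labelTerm (a j) (f j)) • F =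
      (∏ j ∈ s, TransverseKhovanov.labelTerm (a j) (g j)) • F := by
  classical
  induction s using Finset.induction_on with
  | empty => simp
  | insert i s hi ih =>
    rw [Finset.prod_insert hi, Finset.prod_insert hi, mul_smul, mul_smul,
      ih fun j hj => hfg j (Finset.mem_insert_of_mem hj), smul_comm,
      h.labelTerm _ (hfg i (Finset.mem_insert_self i s)), smul_comm]

theorem labelProd_smul_of_ne {v : Vertex w} (y : Circle w v → Label) {p q : Point w} {F : Func}
    (hF : Killed (circleRel v) F) (h : circle w v p ≠ circle w v q) :
    labelProd y • F = labelTerm (y (circle w v p)) (toPt p) • labelTerm (y (circle w v q)) (toPt q)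
        •
      labelProdAway y p q • F := by
  classical
  rw [labelProd, ← Finset.mul_prod_erase _ _ (Finset.mem_univ (circle w v p)),
    ← Finset.mul_prod_erase _ _ (Finset.mem_erase.2 ⟨h.symm, Finset.mem_univ (circle w v q)⟩),
    mul_smul, mul_smul]
  rw [Killed.labelTerm ((hF.smul _).smul _) _ (toPt_out p), Killed.labelTerm (hF.smul _) _
      (toPt_out q)]
  rw [labelProdAway]

theorem labelProd_smul_of_eq {v : Vertex w} (y : Circle w v → Label) {p q : Point w} {F : Func}
    (hF : Killed (circleRel v) F) (h : circle w v p = circle w v q) :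
    labelProd y • F = labelTerm (y (circle w v p)) (toPt p) • labelProdAway y p q • F := by
  classical
  rw [labelProd, ← Finset.mul_prod_erase _ _ (Finset.mem_univ (circle w v p)), mul_smul]
  rw [Killed.labelTerm (hF.smul _) _ (toPt_out p)]
  rw [labelProdAway, ← h, Finset.erase_idem]

theorem Saddle.away {r r' : Pt → Pt → Prop} (e' : Equivalence r') {p q x : Pt} (h : Saddle r r' p q)
    (hp : ¬ r x p) (hq : ¬ r x q) : ¬ r' x p ∧ ¬ r' x q ∧ ∀ y, r x y ↔ r' x y := by
  rcases h with ⟨h1, h2⟩ | ⟨h1, h2⟩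
  · simp only [h2, Join]
    grind
  · simp only [h2, Join, not_or, not_and] at hp hq ⊢
    have := e'.refl p
    have := e'.refl q
    grind

end

section

variable {n : ℕ} {w : BraidWord n}

theorem Saddle.away_iff {r r' : Pt → Pt → Prop} (e : Equivalence r) (e' : Equivalence r') {p q x :
    Pt}
    (h : Saddle r r' p q) : (¬ r x p ∧ ¬ r x q) ↔ (¬ r' x p ∧ ¬ r' x q) :=
  ⟨fun hx => ⟨(h.away e' hx.1 hx.2).1, (h.away e' hx.1 hx.2).2.1⟩,
    fun hx => ⟨(h.symm.away e hx.1 hx.2).1, (h.symm.away e hx.1 hx.2).2.1⟩⟩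

theorem circleRel_equivalence (v : Vertex w) : Equivalence (circleRel v) := rel_equivalence _

variable {v v' : Vertex w} {p q : Point w} (hs : Saddle (circleRel v) (circleRel v') (toPt p) (toPt
    q))

/-- The labellings `y` and `y'` agree away from the circles through `p` and `q`. -/
def AgreeAway (y : Circle w v → Label) (y' : Circle w v' → Label) (p q : Point w) : Prop :=
  ∀ x : Point w, circle w v x ≠ circle w v p → circle w v x ≠ circle w v q →
    y' (circle w v' x) = y (circle w v x)

include hs

theorem circle_away {x : Point w} :
    (circle w v x ≠ circle w v p ∧ circle w v x ≠ circle w v q) ↔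
      (circle w v' x ≠ circle w v' p ∧ circle w v' x ≠ circle w v' q) := by
  simp only [ne_eq, circle_eq_iff]
  exact hs.away_iff (circleRel_equivalence v) (circleRel_equivalence v')

theorem circle_eq_of_away {x z : Point w} (hp : circle w v x ≠ circle w v p)
    (hq : circle w v x ≠ circle w v q) :
    circle w v x = circle w v z ↔ circle w v' x = circle w v' z := by
  simp only [ne_eq, circle_eq_iff] at *
  exact (hs.away (circleRel_equivalence v') hp hq).2.2 _

/-- Away from the saddle the circles of `v` and `v'` correspond. Their chosen representatives
`Quot.out` may differ, but a killed functional does not notice. -/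
theorem labelProdAway_smul {y : Circle w v → Label} {y' : Circle w v' → Label}
    (hy : AgreeAway y y' p q) {F : Func} (hF : Killed (circleRel v') F) :
    labelProdAway y' p q • F = labelProdAway y p q • F := by
  classical
  have hout : ∀ c : Circle w v, circle w v (Quot.out c) = c := fun c => Quot.out_eq c
  have hout' : ∀ c : Circle w v', circle w v' (Quot.out c) = c := fun c => Quot.out_eq c
  have e : labelProdAway y p q = ∏ c ∈ (Finset.univ.erase (circle w v' p)).erase (circle w v' q),
      labelTerm (y' c) (toPt (Quot.out (circle w v (Quot.out c)) : Point w)) := by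
    rw [labelProdAway]
    refine Finset.prod_bij' (fun c _ => circle w v' (Quot.out c)) (fun c _ => circle w v (Quot.out
        c))
      ?_ ?_ ?_ ?_ ?_
    · intro c hc
      simp only [Finset.mem_erase, Finset.mem_univ, and_true] at hc ⊢
      rw [and_comm, ← circle_away hs, hout]
      exact hc.symm
    · intro c hc
      simp only [Finset.mem_erase, Finset.mem_univ, and_true] at hc ⊢
      rw [and_comm, circle_away hs, hout']
      exact hc.symm
    · intro c hc
      simp only [Finset.mem_erase, Finset.mem_univ, and_true] at hc
      have := hout' (circle w v' (Quot.out c))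
      have h2 := (circle_eq_of_away hs (x := Quot.out c)
        (z := Quot.out (circle w v' (Quot.out c))) (by rw [hout]; exact hc.2) (by rw [hout]; exact hc.1)).2 this.symm
      rw [← h2, hout]
    · intro c hc
      simp only [Finset.mem_erase, Finset.mem_univ, and_true] at hc
      have := hout (circle w v (Quot.out c))
      have h3 := (circle_away hs (x := Quot.out c)).2 (by rw [hout']; exact hc.symm)
      have h2 := (circle_eq_of_away hs (x := Quot.out c)
        (z := Quot.out (circle w v (Quot.out c))) h3.1 h3.2).1 this.symm
      rw [← h2, hout']
    · intro c hc
      simp only [Finset.mem_erase, Finset.mem_univ, and_true] at hc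
      have := hout' (circle w v' (Quot.out c))
      have h2 := (circle_eq_of_away hs (x := Quot.out c)
        (z := Quot.out (circle w v' (Quot.out c))) (by rw [hout]; exact hc.2) (by rw [hout]; exact hc.1)).2 this.symm
      rw [← h2, hout, hy _ (by rw [hout]; exact hc.2) (by rw [hout]; exact hc.1), hout]
  rw [e, labelProdAway]
  refine hF.prod_labelTerm _ _ fun c hc => ?_
  simp only [Finset.mem_erase, Finset.mem_univ, and_true] at hc
  have h3 := (circle_away hs (x := Quot.out c)).2 (by rw [hout']; exact hc.symm)
  rw [← circle_eq_iff, ← circle_eq_of_away hs h3.1 h3.2, hout]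

open Classical in
/-- The labelling that agrees with `y` away from `p` and `q` and has given values there. -/
noncomputable def relabel (v' : Vertex w) (y : Circle w v → Label) (p q : Point w) (a b : Label) :
    Circle w v' → Label := fun c =>
  if c = circle w v' p then a else if c = circle w v' q then b else
    y (circle w v (Quot.out c))

theorem relabel_agreeAway (y : Circle w v → Label) (a b : Label) :
    AgreeAway y (relabel v' y p q a b) p q := by
  intro x hp hq
  have h := (circle_away hs (x := x)).1 ⟨hp, hq⟩
  rw [relabel, if_neg h.1, if_neg h.2]
  congr 1
  exact ((circle_eq_of_away hs hp hq).2 (Quot.out_eq (circle w v' x)).symm).symm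

theorem eq_relabel {y : Circle w v → Label} {y' : Circle w v' → Label} (hy : AgreeAway y y' p q) :
    y' = relabel v' y p q (y' (circle w v' p)) (y' (circle w v' q)) := by
  funext c
  induction c using Quot.ind with | _ x
  change y' (circle w v' x) = relabel v' y p q _ _ (circle w v' x)
  by_cases hp : circle w v' x = circle w v' p
  · rw [relabel, if_pos hp, hp]
  by_cases hq : circle w v' x = circle w v' q
  · rw [relabel, if_neg hp, if_pos hq, hq]
  have h := (circle_away hs (x := x)).2 ⟨hp, hq⟩
  rw [relabel_agreeAway hs _ _ _ x h.1 h.2, hy x h.1 h.2]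

omit hs in
theorem relabel_left (y : Circle w v → Label) (a b : Label) :
    relabel v' y p q a b (circle w v' p) = a := if_pos rfl

omit hs in
theorem relabel_right (y : Circle w v → Label) (a b : Label) (h : circle w v' q ≠ circle w v' p) :
    relabel v' y p q a b (circle w v' q) = b := by
  rw [relabel, if_neg h, if_pos rfl]

end

theorem Func.sum_apply {ι : Type*} (s : Finset ι) (f : ι → Func) (a : PtRing) :
    (∑ i ∈ s, f i) a = ∑ i ∈ s, f i a := LinearMap.sum_apply s f a

theorem Func.zsmul_apply (k : ℤ) (φ : Func) (a : PtRing) : (k • φ) a = k * φ a := by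
  have := LinearMap.smul_apply k (show PtRing →ₗ[ℤ] ℤ from φ) a
  exact this

/-! ### Merge and split maps as transposes of `sad` -/

section

variable {n : ℕ} {w : BraidWord n} {v v' : Vertex w} {p q : Point w}
  (hs : Saddle (circleRel v) (circleRel v') (toPt p) (toPt q))

/-- The two labels. -/
def boolLabel (b : Bool) : Label := if b then .minus else .plus

theorem boolLabel_injective : Function.Injective boolLabel := by
  intro a b
  cases a <;> cases b <;> simp [boolLabel]

theorem boolLabel_surjective : Function.Surjective boolLabel := by
  rintro (_ | _)
  exacts [⟨false, rfl⟩, ⟨true, rfl⟩]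

include hs

/-- Merging is the quotient map that identifies X_p with X_q, so its transpose leaves the functional
unchanged; two labels u₋ give a square, matching `mulCoeff`. -/
theorem merge_formula (y : Circle w v → Label) (hpq : circle w v p ≠ circle w v q) {F : Func}
    (hF : Killed (circleRel v') F) :
    ∑ b : Bool, mulCoeff (y (circle w v p)) (y (circle w v q)) (boolLabel b) •
      (labelProd (relabel v' y p q (boolLabel b) (boolLabel b)) • F) = labelProd y • F := by
  have hpq' : circle w v' p = circle w v' q := by
    rw [circle_eq_iff]
    rw [Ne, circle_eq_iff] at hpq
    exact (hs.of_not_rel (circleRel_equivalence v) (circleRel_equivalence v') hpq).1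
  have hF' : Killed (circleRel v) F := by
    rw [Ne, circle_eq_iff] at hpq
    have h2 := (hs.of_not_rel (circleRel_equivalence v) (circleRel_equivalence v') hpq).2
    exact hF.mono fun x y h => (h2 x y).2 (Or.inl h)
  rw [labelProd_smul_of_ne y hF' hpq]
  simp only [labelProd_smul_of_eq _ hF hpq', labelProdAway_smul hs (relabel_agreeAway hs y _ _) hF,
    relabel_left]
  have e' : (X (toPt p) : PtRing) • labelProdAway y p q • F = (X (toPt q) : PtRing) • labelProdAway
      y p q • F :=
    (hF.smul _).eq _ _ (circle_eq_iff.1 hpq')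
  have h1 : ∀ z, (X z : PtRing) • (X z : PtRing) • (labelProdAway y p q • F) = 0 := (hF.smul _).sq
  have h2 : (X (toPt p) : PtRing) • (X (toPt q) : PtRing) • (labelProdAway y p q • F) = 0 := by
    rw [← e', h1]
  rw [Fintype.sum_bool]
  cases y (circle w v p) <;> cases y (circle w v q) <;>
    simp [boolLabel, mulCoeff, labelTerm, e', h2]

/-- The coproduct is multiplication by X_p + X_q: it sends 1 to X_p + X_q, and X to X_p X_q since
squares vanish. -/
theorem split_formula (y : Circle w v → Label) (hpq : circle w v p = circle w v q) {F : Func}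
    (hF : Killed (circleRel v') F) :
    ∑ b : Bool × Bool, comulCoeff (y (circle w v p)) (boolLabel b.1) (boolLabel b.2) •
      (labelProd (relabel v' y p q (boolLabel b.1) (boolLabel b.2)) • F) =
        labelProd y • (X (toPt p) + X (toPt q) : PtRing) • F := by
  have hpq' : circle w v' p ≠ circle w v' q := by
    rw [Ne, circle_eq_iff]
    exact (hs.of_rel (circle_eq_iff.1 hpq)).1
  have hF' : Killed (circleRel v) ((X (toPt p) + X (toPt q) : PtRing) • F) := by
    rw [← sad_of (circle_eq_iff.1 hpq)]
    exact hF.sad_smul hs (circleRel_equivalence v')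
  rw [labelProd_smul_of_eq y hF' hpq]
  simp only [labelProd_smul_of_ne _ hF hpq', labelProdAway_smul hs (relabel_agreeAway hs y _ _) hF,
    relabel_left, relabel_right _ _ _ hpq'.symm]
  rw [Fintype.sum_prod_type, Fintype.sum_bool, Fintype.sum_bool, Fintype.sum_bool]
  have h1 : ∀ z, (X z : PtRing) • (X z : PtRing) • (labelProdAway y p q • F) = 0 := (hF.smul _).sq
  have h2 : labelProdAway y p q • (X (toPt p) + X (toPt q) : PtRing) • F =
    (X (toPt p) + X (toPt q) : PtRing) • labelProdAway y p q • F := smul_comm _ _ _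
  rw [h2]
  cases y (circle w v p) <;> simp [boolLabel, comulCoeff, labelTerm, add_smul, h1]

end

section

variable {n : ℕ} {w : BraidWord n}

theorem edgeCoeff_eq (t : Fin w.length) (v v' : Vertex w) (y : Circle w v → Label)
    (y' : Circle w v' → Label) :
    edgeCoeff w t ⟨v, y⟩ ⟨v', y'⟩ = open Classical in
      if AgreeAway y y' (left w t, t.castSucc) (right w t, t.succ) then
        if circle w v (left w t, t.castSucc) ≠ circle w v (right w t, t.succ) then
          mulCoeff (y (circle w v (left w t, t.castSucc))) (y (circle w v (right w t, t.succ)))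
            (y' (circle w v' (left w t, t.castSucc)))
        else comulCoeff (y (circle w v (left w t, t.castSucc)))
            (y' (circle w v' (left w t, t.castSucc))) (y' (circle w v' (right w t, t.succ)))
      else 0 := by
  classical
  simp only [edgeCoeff, AgreeAway]
  congr

-- Among the generators at `v'` only the relabellings of `y` at the circles through the crossing
-- have a non-zero coefficient: two for a merge and four for a split. This reduces the matrix of an
-- edge to the two formulas above.
open Classical in
theorem sum_edgeCoeff (t : Fin w.length) {v v' : Vertex w} (y : Circle w v → Label)
    (hs : Saddle (circleRel v) (circleRel v') (toPt (w := w) (left w t, t.castSucc))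
      (toPt (w := w) (right w t, t.succ))) (Φ : Vertex w → Func) (hF : Killed (circleRel v') (Φ
          v')) :
    ∑ T : Generator w, (if T.1 = v' then edgeCoeff w t ⟨v, y⟩ T * Φ T.1 (labelProd T.2) else 0) =
      (sad (circleRel v) (toPt (w := w) (left w t, t.castSucc)) (toPt (w := w) (right w t, t.succ))
          •
        Φ v') (labelProd y) := by
  obtain ⟨p, hp⟩ : ∃ p : Point w, p = (left w t, t.castSucc) := ⟨_, rfl⟩
  obtain ⟨q, hq⟩ : ∃ q : Point w, q = (right w t, t.succ) := ⟨_, rfl⟩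
  have hcoeff := edgeCoeff_eq t v v' y
  rw [← hp, ← hq] at hcoeff
  rw [← hp, ← hq] at hs ⊢
  by_cases hpq : circle w v p = circle w v q
  · have hpq' : circle w v' q ≠ circle w v' p := by
      rw [Ne, eq_comm, circle_eq_iff]
      exact (hs.of_rel (circle_eq_iff.1 hpq)).1
    rw [sad_of (circle_eq_iff.1 hpq)]
    have H := DFunLike.congr_fun (split_formula hs y hpq hF) 1
    rw [Func.smul_apply, mul_one] at H
    rw [← H, Func.sum_apply]
    refine (Finset.sum_of_injOn (t := (Finset.univ : Finset (Generator w))) (fun b : Bool × Bool =>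
        (⟨v', relabel v' y p q (boolLabel b.1) (boolLabel b.2)⟩ :
      Generator w)) ?_ ?_ ?_ ?_).symm
    · intro b _ b' _ h
      have h := eq_of_heq (Sigma.mk.inj h).2
      have h1 := congrFun h (circle w v' p)
      have h2 := congrFun h (circle w v' q)
      rw [relabel_left, relabel_left] at h1
      rw [relabel_right _ _ _ hpq', relabel_right _ _ _ hpq'] at h2
      exact Prod.ext (boolLabel_injective h1) (boolLabel_injective h2)
    · exact fun _ _ => Finset.mem_coe.2 (Finset.mem_univ _)
    · rintro ⟨u, y'⟩ - hT
      split_ifs with hu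
      · obtain rfl : u = v' := hu
        rw [hcoeff, if_neg, zero_mul]
        intro ha
        obtain ⟨a, ha'⟩ := boolLabel_surjective (y' (circle w u p))
        obtain ⟨b, hb'⟩ := boolLabel_surjective (y' (circle w u q))
        refine hT ⟨(a, b), Finset.mem_coe.2 (Finset.mem_univ _), ?_⟩
        dsimp only
        rw [ha', hb', ← eq_relabel hs ha]
      · rfl
    · rintro ⟨a, b⟩ -
      rw [if_pos rfl, hcoeff, if_pos (relabel_agreeAway hs _ _ _), if_neg (not_not.2 hpq),
          relabel_left,
        relabel_right _ _ _ hpq', Func.zsmul_apply, Func.smul_apply, mul_one]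
  · have hpq' : circle w v' p = circle w v' q := by
      rw [circle_eq_iff]
      rw [circle_eq_iff] at hpq
      exact (hs.of_not_rel (circleRel_equivalence v) (circleRel_equivalence v') hpq).1
    rw [sad_of_not (fun h => hpq (circle_eq_iff.2 h)), one_smul]
    have H := DFunLike.congr_fun (merge_formula hs y hpq hF) 1
    rw [← mul_one (labelProd y), ← Func.smul_apply, ← H, Func.sum_apply]
    refine (Finset.sum_of_injOn (t := (Finset.univ : Finset (Generator w))) (fun b : Bool => (⟨v',
        relabel v' y p q (boolLabel b) (boolLabel b)⟩ :
      Generator w)) ?_ ?_ ?_ ?_).symm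
    · intro b _ b' _ h
      have h1 := congrFun (eq_of_heq (Sigma.mk.inj h).2) (circle w v' p)
      rw [relabel_left, relabel_left] at h1
      exact boolLabel_injective h1
    · exact fun _ _ => Finset.mem_coe.2 (Finset.mem_univ _)
    · rintro ⟨u, y'⟩ - hT
      split_ifs with hu
      · obtain rfl : u = v' := hu
        rw [hcoeff, if_neg, zero_mul]
        intro ha
        obtain ⟨a, ha'⟩ := boolLabel_surjective (y' (circle w u p))
        refine hT ⟨a, Finset.mem_coe.2 (Finset.mem_univ _), ?_⟩
        dsimp only
        have := eq_relabel hs ha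
        rw [← hpq', ← ha'] at this
        rw [← this]
      · rfl
    · intro b _
      rw [if_pos rfl, hcoeff, if_pos (relabel_agreeAway hs _ _ _), if_pos hpq, relabel_left,
        Func.zsmul_apply, Func.smul_apply, mul_one]

end

/-! ### The Khovanov differential and the signed edge sum -/

section

variable {n : ℕ} {w : BraidWord n}

theorem set_ofFn {m : ℕ} (v : Fin m → Bool) (t : Fin m) :
    (List.ofFn v).set t true = List.ofFn (Function.update v t true) := by
  refine List.ext_getElem (by simp) fun s h1 h2 => ?_
  rw [List.getElem_set, List.getElem_ofFn, List.getElem_ofFn, Function.update_apply]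
  simp only [Fin.ext_iff, eq_comm]

theorem count_take_ofFn {m : ℕ} (v : Fin m → Bool) (k : ℕ) (hk : k ≤ m) :
    ((List.ofFn v).take k).count true =
      (Finset.univ.filter fun j : Fin m => (j : ℕ) < k ∧ v j = true).card := by
  induction k with
  | zero => simp
  | succ k ih =>
    rw [List.take_succ_eq_append_getElem (by simpa using hk), List.count_append, ih (by omega),
        List.getElem_ofFn]
    have : (Finset.univ.filter fun j : Fin m => (j : ℕ) < k + 1 ∧ v j = true) =
        (Finset.univ.filter fun j : Fin m => (j : ℕ) < k ∧ v j = true) ∪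
          (Finset.univ.filter fun j : Fin m => (j : ℕ) = k ∧ v j = true) := by
      ext j
      simp only [Finset.mem_filter, Finset.mem_univ, true_and, Finset.mem_union]
      rw [Nat.lt_succ_iff_lt_or_eq, or_and_right]
    rw [this, Finset.card_union_of_disjoint]
    · congr 1
      cases hv : v ⟨k, hk⟩
      · rw [Finset.filter_false_of_mem]
        · simp
        · rintro j - ⟨rfl, h⟩
          exact absurd h (by simp [hv])
      · rw [show (Finset.univ.filter fun j : Fin m => (j : ℕ) = k ∧ v j = true) = {⟨k, hk⟩} from ?_]
        · simp
        · ext j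
          simp only [Finset.mem_filter, Finset.mem_univ, true_and, Finset.mem_singleton,
              Fin.ext_iff]
          refine ⟨And.left, fun h => ⟨h, ?_⟩⟩
          rw [← hv]
          congr 1
          exact Fin.ext h
    · rw [Finset.disjoint_filter]
      intro j _ h1 h2
      omega

theorem sgn_ofFn (v : Vertex w) (t : Fin w.length) : sgn (List.ofFn v) t = ((edgeSign w v t : ℤ) :
    PtRing) := by
  rw [sgn, count_take_ofFn _ _ t.2.le, edgeSign]
  simp

theorem getD_letters (t : Fin w.length) : w.letters.getD t (0, true) = ((w.get t).1.val, (w.get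
    t).2) := by
  rw [List.getD_eq_getElem _ _ (by rw [length_letters]; exact t.2)]
  simp [BraidWord.letters]

theorem saddle_circleRel {v : Vertex w} {t : Fin w.length} (h : v t = false) :
    Saddle (circleRel v) (circleRel (Function.update v t true)) (toPt (w := w) (left w t,
        t.castSucc))
      (toPt (w := w) (right w t, t.succ)) := by
  have := saddle_edge (A := w.letters) [] (v := List.ofFn v) (by simp [length_letters]) (t := t)
    (by rw [length_letters]; exact t.2) (by simp [h])
  rw [List.append_nil, List.append_nil, set_ofFn, getD_letters] at this
  exact this

/-- The functional on the Khovanov complex that a family of functionals on polynomials defines. -/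
noncomputable def chainFunctional (w : BraidWord n) (φ : List Bool → Func) : CKh w →ₗ[ℤ] ℤ :=
  Finsupp.linearCombination ℤ fun S : Generator w => φ (List.ofFn S.1) (labelProd S.2)

theorem chainFunctional_single (φ : List Bool → Func) (S : Generator w) :
    chainFunctional w φ (Finsupp.single S 1) = φ (List.ofFn S.1) (labelProd S.2) := by
  rw [chainFunctional, Finsupp.linearCombination_single, one_smul]

theorem edgeSum_letters (φ : List Bool → Func) (v : Vertex w) :
    edgeSum 0 w.letters (circleRel v) φ (List.ofFn v) = ∑ t : Fin w.length, if v t = false then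
      edgeSign w v t • sad (circleRel v) (toPt (w := w) (left w t, t.castSucc))
        (toPt (w := w) (right w t, t.succ)) • φ (List.ofFn (Function.update v t true)) else 0 := by
  rw [edgeSum, length_letters, Finset.sum_range]
  refine Finset.sum_congr rfl fun t _ => ?_
  rw [getD_letters, set_ofFn, sgn_ofFn, mul_smul, Int.cast_smul_eq_zsmul, zero_add]
  simp only [List.getElem?_ofFn, t.2, dite_true, Option.some_inj]
  rfl

/-- On a generator at `v` the composite with `d` is the edge sum of φ at `v` evaluated at the
monomial of the labelling, so it vanishes by the cocycle condition. -/
theorem chainFunctional_d {φ : List Bool → Func}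
    (h1 : ∀ v, v.length = w.letters.length → Killed (rel (res w.letters v)) (φ v))
    (h2 : ∀ v, v.length = w.letters.length → edgeSum 0 w.letters (rel (res w.letters v)) φ v = 0)
    (x : CKh w) : chainFunctional w φ (d w x) = 0 := by
  classical
  suffices h : (chainFunctional w φ).comp (d w) = 0 from LinearMap.congr_fun h x
  refine Finsupp.lhom_ext' fun S => LinearMap.ext_ring ?_
  have hlen : ∀ v : Vertex w, (List.ofFn v).length = w.letters.length := fun v => by simp
      [length_letters]
  change chainFunctional w φ (d w (Finsupp.single S 1)) = 0
  rw [d, Finsupp.linearCombination_single, one_smul, map_sum]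
  simp only [map_smul, chainFunctional_single, dCoeff, smul_eq_mul, Finset.sum_mul]
  rw [Finset.sum_comm]
  have H := DFunLike.congr_fun (h2 (List.ofFn S.1) (hlen S.1)) (labelProd S.2)
  have H2 := edgeSum_letters φ S.1
  rw [circleRel] at H2
  rw [H2, Func.sum_apply] at H
  refine Eq.trans (Finset.sum_congr rfl fun t _ => ?_) H
  by_cases hv : S.1 t = false
  · rw [if_pos hv, Func.zsmul_apply]
    rw [← circleRel, ← sum_edgeCoeff t S.2 (saddle_circleRel hv) (fun v => φ (List.ofFn v)) (h1 _
        (hlen _)), Finset.mul_sum]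
    refine Finset.sum_congr rfl fun T _ => ?_
    simp only [hv, true_and]
    split_ifs
    · exact mul_assoc _ _ _
    · simp
  · rw [if_neg hv]
    simp [hv]

end

/-! ### Evaluation on ψ and descent to homology -/

section

variable {n : ℕ} {w : BraidWord n}

theorem ofFn_orientedVertex (w : BraidWord n) : List.ofFn (orientedVertex w) = orient w.letters :=
    by
  refine List.ext_getElem (by simp [length_letters]) fun s h1 h2 => ?_
  simp [orientedVertex, orient, BraidWord.letters]

/-- The circles of the oriented resolution are the strings, each met once at level 0, so the
monomial of ψ acts like the product of the variables X (j, 0). -/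
theorem chainFunctional_psiChain {φ : List Bool → Func}
    (h : Killed (rel (res w.letters (orient w.letters))) (φ (orient w.letters))) :
    chainFunctional w φ (psiChain w) = φ (orient w.letters) (∏ j ∈ Finset.range (n + 1), X (j, 0))
        := by
  have hR : circleRel (orientedVertex w) = rel (res w.letters (orient w.letters)) := by
    rw [circleRel, ofFn_orientedVertex]
  have e1 : labelProd (psiGenerator w).2 =
      ∏ j : Fin (n + 1), X (toPt (Quot.out (circle w (orientedVertex w) (j, 0)) : Point w)) := by
    refine (Fintype.prod_bijective (fun j : Fin (n + 1) => circle w (orientedVertex w) (j, 0)) ⟨?_,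
        ?_⟩ _ _
      fun _ => rfl).symm
    · intro j k hjk
      exact congrArg (Quot.lift (fun x : Point w => x.1) fun _ _ => fst_eq_of_joined w) hjk
    · intro c
      induction c using Quot.ind with | _ x
      refine ⟨x.1, circle_eq_iff.2 ?_⟩
      rw [hR]
      exact (rel_equivalence _).symm (rel_orient _ _ _)
  have e2 : (∏ j : Fin (n + 1), X (toPt (Quot.out (circle w (orientedVertex w) (j, 0)) : Point w))
      : PtRing) •
      φ (orient w.letters) = (∏ j : Fin (n + 1), X ((j : ℕ), 0) : PtRing) • φ (orient w.letters) :=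
    h.prod_labelTerm Finset.univ (fun _ => Label.minus) fun j _ => by
      rw [← hR]
      exact toPt_out _
  have := DFunLike.congr_fun e2 1
  rw [Func.smul_apply, Func.smul_apply, mul_one, mul_one] at this
  rw [psiChain, chainFunctional_single, Finset.prod_range, ← this, e1]
  change φ (List.ofFn (orientedVertex w)) _ = _
  rw [ofFn_orientedVertex]

/-- A functional on Khovanov homology that takes a unit as value on `ψ`. -/
theorem exists_functional (h : Good n w.letters) : ∃ f : Kh w →ₗ[ℤ] ℤ, IsUnit (f (psi w)) := by
  obtain ⟨φ, h1, h2, h3⟩ := h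
  refine ⟨Submodule.liftQ _ ((chainFunctional w φ).domRestrict _) fun x hx => ?_, ?_⟩
  · obtain ⟨y, hy⟩ := hx
    rw [LinearMap.mem_ker, LinearMap.domRestrict_apply]
    change chainFunctional w φ ((LinearMap.ker (d w)).subtype x) = 0
    rw [← hy]
    exact chainFunctional_d h1 h2 y
  · change IsUnit (chainFunctional w φ (psiChain w))
    rw [chainFunctional_psiChain (h1 _ (length_orient _))]
    exact h3

end

theorem apply_eq_zero_of_mem_torsion {M : Type*} [AddCommGroup M] (f : M →ₗ[ℤ] ℤ) {x : M}
    (hx : x ∈ Submodule.torsion ℤ M) : f x = 0 := by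
  obtain ⟨a, ha⟩ := hx
  have := congrArg f ha
  rw [map_zero, Submonoid.smul_def, map_smul, smul_eq_mul, mul_eq_zero] at this
  exact this.resolve_left (nonZeroDivisors.coe_ne_zero a)

end TransverseKhovanov

theorem mainTheorem3 {n m : ℕ} (w : TransverseKhovanov.BraidWord n)
    (v : TransverseKhovanov.BraidWord m)
    (hv : TransverseKhovanov.IsQuasipositive v.toBraid)
    (hwv : TransverseKhovanov.SameTransverseLink ⟨n, w⟩ ⟨m, v⟩) :
    TransverseKhovanov.psi w ≠ 0 ∧
      TransverseKhovanov.psi w ∉ Submodule.torsion ℤ (TransverseKhovanov.Kh w) ∧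
      TransverseKhovanov.IsPrimitive (TransverseKhovanov.psi w) := by
  obtain ⟨f, hf⟩ := TransverseKhovanov.exists_functional
    ((TransverseKhovanov.good_of_sameTransverseLink hwv).2
      (TransverseKhovanov.good_of_isQuasipositive hv))
  have ht : TransverseKhovanov.psi w ∉ Submodule.torsion ℤ (TransverseKhovanov.Kh w) := fun h => by
    rw [TransverseKhovanov.apply_eq_zero_of_mem_torsion f h] at hf
    exact not_isUnit_zero hf
  refine ⟨fun h => ht (h ▸ Submodule.zero_mem _), ht, fun k y hy => ?_⟩
  -- The functional kills the torsion element, so f ψ = k · f y, and a factor of a unit is a unit.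
  have := TransverseKhovanov.apply_eq_zero_of_mem_torsion f hy
  rw [map_sub, map_smul, smul_eq_mul, sub_eq_zero] at this
  rw [this] at hf
  exact isUnit_of_mul_isUnit_left hf
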